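/- Let $k$ be an algebraically closed field of characteristic zero, let $L\subseteq k$ be a subfield, and let $g\ge 2$ be an integer. A hyperelliptic curve of genus $g$ over a field $E\subseteq k$ is a curve with an equation $Y^2=F(X)$, where $F\in E[X]$ is separable of degree $2g+1$ or $2g+2$. Two such curves over $k$ are isomorphic if their function fields are isomorphic over $k$. For such a curve $C$ over $k$ with function field $K=k(X,Y)$, let $G=\mathrm{Aut}(K/k)$, let $G_0=\mathrm{Gal}(K/k(X))=\langle z_0\rangle$ be the central subgroup of order two generated by the hyperelliptic involution, and let $\overline G=G/G_0$ be the reduced automorphism group. An extra involution of $C$ is an involution of $G$ different from $z_0$. Let $\mathcal H_g$ be the coarse moduli space of hyperelliptic curves of genus $g$, regarded as a variety over $\mathbb Q$, namely the locus of nonzero discriminant in $\mathrm{Proj}$ of the graded ring of $SL_2$-invariants, with rational coefficients, of binary forms of degree $2g+2$. Thus $[C]\in\mathcal H_g(L)$ means that for all homogeneous invariants $I,J$ of the same degree in this ring with $J(F)\neq 0$ one has $I(F)/J(F)\in L$, where $F$ is read as a binary form of degree $2g+2$. Let $C$ be a hyperelliptic curve of genus $g$ over $k$ which has an extra involution (that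 is, $[C]$ lies in the locus $\mathcal L_g\subset\mathcal H_g$) and whose reduced automorphism group $\overline G$ has at least two involutions. If $[C]\in\mathcal H_g(L)$, then the isomorphism class of $C$ has a representative defined over $L$: there is a separable polynomial $F_0\in L[X]$ of degree $2g+1$ or $2g+2$ such that the curve $Y^2=F_0(X)$ over $k$ is isomorphic to $C$. -/

import Mathlib

open Polynomial

noncomputable section
namespace HyperellipticModuli
section Kernel
variable {k : Type*} [Field k]

/-- The ring `k(X)[Y] / (Y² - F)`; it is a field when `F` is not a square. -/
abbrev QuadExt (F : k[X]) : Type _ :=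
  AdjoinRoot (X ^ 2 - C (algebraMap k[X] (RatFunc k) F) : (RatFunc k)[X])

lemma quad_monic (F : k[X]) :
    (X ^ 2 - C (algebraMap k[X] (RatFunc k) F) : (RatFunc k)[X]).Monic :=
  monic_X_pow_sub_C _ two_ne_zero

lemma quad_natDegree (F : k[X]) :
    (X ^ 2 - C (algebraMap k[X] (RatFunc k) F) : (RatFunc k)[X]).natDegree = 2 :=
  natDegree_X_pow_sub_C

lemma root_sq (F : k[X]) : (AdjoinRoot.root _ : QuadExt F) ^ 2 =
    AdjoinRoot.of _ (algebraMap k[X] (RatFunc k) F) := by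
  have h := AdjoinRoot.eval₂_root (X ^ 2 - C (algebraMap k[X] (RatFunc k) F) : (RatFunc k)[X])
  simpa [sub_eq_zero] using h

lemma exists_coords (F : k[X]) (u : QuadExt F) : ∃ a b : RatFunc k,
    u = AdjoinRoot.of _ a + AdjoinRoot.of _ b * AdjoinRoot.root _ := by
  induction u using AdjoinRoot.induction_on with
  | ih p =>
    set f := (X ^ 2 - C (algebraMap k[X] (RatFunc k) F) : (RatFunc k)[X]) with hf
    have hd : (p %ₘ f).natDegree ≤ 1 := by
      have := natDegree_modByMonic_lt p (quad_monic F) (by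
        intro h; have := quad_natDegree F; rw [h] at this; simp at this)
      rw [quad_natDegree] at this
      exact Nat.lt_succ_iff.mp this
    obtain ⟨b, a, hab⟩ := exists_eq_X_add_C_of_natDegree_le_one hd
    refine ⟨a, b, ?_⟩
    have h1 : AdjoinRoot.mk f p = AdjoinRoot.mk f (p %ₘ f) := by
      rw [AdjoinRoot.mk_eq_mk]
      refine ⟨p /ₘ f, ?_⟩
      have := modByMonic_add_div p f
      linear_combination -this
    rw [h1, hab, map_add, map_mul, AdjoinRoot.mk_C, AdjoinRoot.mk_C, AdjoinRoot.mk_X, add_comm]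

lemma coords_zero (F : k[X]) {a b : RatFunc k}
    (h : (AdjoinRoot.of _ a + AdjoinRoot.of _ b * AdjoinRoot.root _ : QuadExt F) = 0) :
    a = 0 ∧ b = 0 := by
  by_contra hab
  have hne : (C b * X + C a : (RatFunc k)[X]) ≠ 0 := by
    intro h0
    apply hab
    have c0 := congrArg (fun p => p.coeff 0) h0
    have c1 := congrArg (fun p => p.coeff 1) h0
    simp at c0 c1
    exact ⟨c0, c1⟩
  refine AdjoinRoot.mk_ne_zero_of_natDegree_lt (quad_monic F) hne ?_ ?_
  · rw [quad_natDegree]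
    exact lt_of_le_of_lt natDegree_linear_le (by norm_num)
  · simpa [add_comm] using h

lemma five_le_of_sq_mul {F D : k[X]} (hF : Squarefree F) (h5 : 5 ≤ F.natDegree) {e : RatFunc k}
    (he : e ≠ 0) (h : e ^ 2 * algebraMap k[X] (RatFunc k) F = algebraMap k[X] (RatFunc k) D) :
    5 ≤ D.natDegree := by
  have hF0 : F ≠ 0 := by rintro rfl; simp at h5
  have hq : e.denom ≠ 0 := e.denom_ne_zero
  have hq' : algebraMap k[X] (RatFunc k) e.denom ≠ 0 := by
    simpa using hq
  have hp : e.num ≠ 0 := RatFunc.num_ne_zero he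
  have h2 : e.num ^ 2 * F = e.denom ^ 2 * D := by
    apply IsFractionRing.injective k[X] (RatFunc k)
    rw [← RatFunc.num_div_denom e] at h
    simp only [map_mul, map_pow]
    rw [← h]
    field_simp
  have hdvd : e.denom * e.denom ∣ F := by
    have : IsCoprime (e.denom ^ 2) (e.num ^ 2) := (e.isCoprime_num_denom.symm).pow
    rw [← pow_two]
    exact this.dvd_of_dvd_mul_left ⟨D, h2⟩
  have hu : e.denom.natDegree = 0 := natDegree_eq_zero_of_isUnit (hF _ hdvd)
  have hD : D ≠ 0 := by
    rintro rfl
    simp [hp, hF0] at h2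
  have := congrArg natDegree h2
  rw [natDegree_mul (pow_ne_zero _ hp) hF0, natDegree_mul (pow_ne_zero _ hq) hD, natDegree_pow,
    natDegree_pow, hu] at this
  omega

lemma common_denom (a b : RatFunc k) : ∃ q p₁ p₀ : k[X], q ≠ 0 ∧
    algebraMap k[X] (RatFunc k) p₁ = algebraMap k[X] (RatFunc k) q * a ∧
    algebraMap k[X] (RatFunc k) p₀ = algebraMap k[X] (RatFunc k) q * b := by
  have ha : algebraMap k[X] (RatFunc k) a.denom ≠ 0 := by simpa using a.denom_ne_zero
  have hb : algebraMap k[X] (RatFunc k) b.denom ≠ 0 := by simpa using b.denom_ne_zero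
  have ha' := (div_eq_iff ha).mp a.num_div_denom
  have hb' := (div_eq_iff hb).mp b.num_div_denom
  refine ⟨a.denom * b.denom, a.num * b.denom, b.num * a.denom,
    mul_ne_zero a.denom_ne_zero b.denom_ne_zero, ?_, ?_⟩
  · rw [map_mul, map_mul, ha']; ring
  · rw [map_mul, map_mul, hb']; ring

lemma coeff_quad {R : Type*} [CommRing R] (A B : R) :
    (X ^ 2 + C A * X + C B : R[X]).coeff 2 = 1 ∧ (X ^ 2 + C A * X + C B : R[X]).coeff 1 = A ∧
    (X ^ 2 + C A * X + C B : R[X]).coeff 0 = B := by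
  refine ⟨?_, ?_, ?_⟩ <;> simp [coeff_X, coeff_C]

lemma exists_quadratic_relation (F : k[X]) (s : QuadExt F) : ∃ q₂ q₁ q₀ : k[X], q₂ ≠ 0 ∧
    AdjoinRoot.of _ (algebraMap k[X] (RatFunc k) q₂) * s ^ 2
      + AdjoinRoot.of _ (algebraMap k[X] (RatFunc k) q₁) * s
      + AdjoinRoot.of _ (algebraMap k[X] (RatFunc k) q₀) = 0 := by
  obtain ⟨c, d, rfl⟩ := exists_coords F s
  obtain ⟨q, q₁, q₀, hq, h₁, h₀⟩ :=
    common_denom (-2 * c) (c ^ 2 - d ^ 2 * algebraMap k[X] (RatFunc k) F)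
  refine ⟨q, q₁, q₀, hq, ?_⟩
  rw [h₁, h₀]
  simp only [map_mul, map_sub, map_pow, map_neg, map_ofNat]
  have := root_sq F
  linear_combination (AdjoinRoot.of _ (algebraMap k[X] (RatFunc k) q)) *
    (AdjoinRoot.of _ d) ^ 2 * this

lemma natDegree_coeff_le_swap (P : k[X][X]) (i : ℕ) :
    (P.coeff i).natDegree ≤ (Bivariate.swap P).natDegree := by
  have key : ∀ (P : k[X][X]) (i j : ℕ), ((Bivariate.swap P).coeff j).coeff i
      = (P.coeff i).coeff j := by
    intro P i j
    induction P using Polynomial.induction_on' with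
    | add p q hp hq => simp only [map_add, coeff_add, hp, hq]
    | monomial n a =>
      induction a using Polynomial.induction_on' with
      | add p q hp hq => simp only [map_add, coeff_add, hp, hq]
      | monomial m r =>
        rw [Bivariate.swap_monomial_monomial]
        simp only [coeff_monomial]
        split_ifs <;> simp_all [coeff_monomial]
  rw [natDegree_le_iff_coeff_eq_zero]
  intro j hj
  rw [← key, coeff_eq_zero_of_natDegree_lt hj, coeff_zero]

lemma aut_polynomial (F : k[X]) (σ : QuadExt F ≃ₐ[k] QuadExt F) (q : k[X]) :
    σ (AdjoinRoot.of _ (algebraMap k[X] (RatFunc k) q)) =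
      aeval (σ (AdjoinRoot.of _ (algebraMap k[X] (RatFunc k) X))) q := by
  induction q using Polynomial.induction_on' with
  | add p q hp hq => simp only [map_add, hp, hq]
  | monomial n a =>
    have h : AdjoinRoot.of (X ^ 2 - C (algebraMap k[X] (RatFunc k) F) : (RatFunc k)[X])
        (algebraMap k[X] (RatFunc k) (C a)) = algebraMap k (QuadExt F) a := by
      have h1 : algebraMap k[X] (RatFunc k) (C a) = algebraMap k (RatFunc k) a :=
        (IsScalarTower.algebraMap_apply k k[X] (RatFunc k) a).symm
      rw [h1]
      exact (IsScalarTower.algebraMap_apply k (RatFunc k) (QuadExt F) a).symm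
    rw [← C_mul_X_pow_eq_monomial]
    simp only [map_mul, map_pow, h, AlgEquiv.commutes, aeval_C, aeval_X]

lemma aut_X_mem (F : k[X]) (h2 : (2 : k) ≠ 0) (hF : Squarefree F) (h5 : 5 ≤ F.natDegree)
    (σ : QuadExt F ≃ₐ[k] QuadExt F) :
    ∃ w : RatFunc k, σ (AdjoinRoot.of _ (algebraMap k[X] (RatFunc k) X)) = AdjoinRoot.of _ w := by
  classical
  set x : QuadExt F := AdjoinRoot.of _ (algebraMap k[X] (RatFunc k) X) with hx
  obtain ⟨a, b, hu⟩ := exists_coords F (σ x)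
  by_cases hb : b = 0
  · exact ⟨a, by simp [hu, hb]⟩
  exfalso
  obtain ⟨q₂, q₁, q₀, hq, hrel⟩ := exists_quadratic_relation F (σ.symm x)
  have hrel' : aeval (σ x) q₂ * x ^ 2 + aeval (σ x) q₁ * x + aeval (σ x) q₀ = 0 := by
    have := congrArg σ hrel
    rwa [map_add, map_add, map_mul, map_mul, map_pow, aut_polynomial F σ q₂,
      aut_polynomial F σ q₁, aut_polynomial F σ q₀, AlgEquiv.apply_symm_apply, map_zero] at this
  set Q' : k[X][X] := C q₂ * X ^ 2 + C q₁ * X + C q₀ with hQ'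
  have hQ'0 : Q' ≠ 0 := by
    intro h0
    apply hq
    have := congrArg (fun p => p.coeff 2) h0
    simpa [hQ', coeff_X, coeff_C] using this
  have hQ'd : Q'.natDegree ≤ 2 := natDegree_quadratic_le
  set Q : k[X][X] := Bivariate.swap Q' with hQ
  have hev : aeval (σ x) (Q.map (algebraMap k[X] (RatFunc k))) = 0 := by
    have e1 : ∀ R : k[X][X], aeval (σ x) (R.map (algebraMap k[X] (RatFunc k)))
        = aevalAeval x (σ x) R := by
      intro R
      induction R using Polynomial.induction_on' with
      | add p q hp hq => rw [Polynomial.map_add, map_add, map_add, hp, hq]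
      | monomial n r =>
        have := aut_polynomial F AlgEquiv.refl r
        simp only [AlgEquiv.coe_refl, id] at this
        rw [map_monomial, aeval_monomial, ← C_mul_X_pow_eq_monomial, map_mul, map_pow,
          AdjoinRoot.algebraMap_eq, this]
        simp [hx]
    rw [e1, hQ, Bivariate.aevalAeval_swap, hQ']
    simp only [map_add, map_mul, map_pow, aevalAeval_C, aevalAeval_Y]
    exact hrel'
  set m : (RatFunc k)[X] :=
    X ^ 2 + C (-2 * a) * X + C (a ^ 2 - b ^ 2 * algebraMap k[X] (RatFunc k) F) with hm
  have hmm : m.Monic := by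
    rw [hm]; monicity!
  have hmd : m.natDegree = 2 := by rw [hm]; compute_degree!
  have hm0 : aeval (σ x) m = 0 := by
    rw [hm, hu]
    simp only [map_add, map_mul, map_sub, map_pow, aeval_X, aeval_C, AdjoinRoot.algebraMap_eq,
      map_neg, map_ofNat]
    linear_combination (AdjoinRoot.of _ b) ^ 2 * root_sq F
  have hdiv : m ∣ Q.map (algebraMap k[X] (RatFunc k)) := by
    rw [← modByMonic_eq_zero_iff_dvd hmm]
    have hd : (Q.map (algebraMap k[X] (RatFunc k)) %ₘ m).natDegree ≤ 1 := by
      have := natDegree_modByMonic_lt (Q.map (algebraMap k[X] (RatFunc k))) hmm (by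
        intro h; rw [h] at hmd; simp at hmd)
      omega
    obtain ⟨β, α, hab⟩ := exists_eq_X_add_C_of_natDegree_le_one hd
    have h0 : aeval (σ x) (Q.map (algebraMap k[X] (RatFunc k)) %ₘ m) = 0 := by
      have := congrArg (aeval (σ x)) (modByMonic_add_div (Q.map (algebraMap k[X] (RatFunc k))) m)
      rwa [map_add, map_mul, hm0, zero_mul, add_zero, hev] at this
    rw [hab, hu] at h0
    have h1 := coords_zero F (a := α + β * a) (b := β * b) (by
      simp only [map_add, map_mul, aeval_X, aeval_C, AdjoinRoot.algebraMap_eq] at h0 ⊢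
      linear_combination h0)
    have hβ : β = 0 := (mul_eq_zero.mp h1.2).resolve_right hb
    have hα : α = 0 := by simpa [hβ] using h1.1
    rw [hab, hα, hβ]; simp
  let _ : NormalizedGCDMonoid k[X] := (inferInstance : Nonempty (NormalizedGCDMonoid k[X])).some
  obtain ⟨c, c₁, c₀, hc0, h₁, h₀⟩ :=
    common_denom (-2 * a) (a ^ 2 - b ^ 2 * algebraMap k[X] (RatFunc k) F)
  set N : k[X][X] := C c * X ^ 2 + C c₁ * X + C c₀ with hN
  have hNm : N.map (algebraMap k[X] (RatFunc k)) = C (algebraMap k[X] (RatFunc k) c) * m := by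
    rw [hN, hm]
    simp only [Polynomial.map_add, Polynomial.map_mul, Polynomial.map_pow, map_C, map_X, h₁, h₀,
      C_mul]
    ring
  have hN0 : N ≠ 0 := by
    intro h
    apply hc0
    have := congrArg (fun p => p.coeff 2) h
    simpa [hN, coeff_X, coeff_C] using this
  have hct : N.content ≠ 0 := by rwa [Ne, content_eq_zero_iff]
  set P := N.primPart with hP
  set t : RatFunc k := algebraMap k[X] (RatFunc k) c / algebraMap k[X] (RatFunc k) N.content with ht
  have hct' : algebraMap k[X] (RatFunc k) N.content ≠ 0 := by simpa using hct
  have hc' : algebraMap k[X] (RatFunc k) c ≠ 0 := by simpa using hc0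
  have ht0 : t ≠ 0 := div_ne_zero hc' hct'
  have hPm : P.map (algebraMap k[X] (RatFunc k)) = C t * m := by
    have e : C (algebraMap k[X] (RatFunc k) N.content) * P.map (algebraMap k[X] (RatFunc k)) =
        C (algebraMap k[X] (RatFunc k) c) * m := by
      rw [← hNm]
      conv_rhs => rw [N.eq_C_content_mul_primPart]
      simp [hP]
    have hC : (C (algebraMap k[X] (RatFunc k) N.content) : (RatFunc k)[X]) ≠ 0 := by simpa using hct
    apply mul_left_cancel₀ hC
    rw [e, ← mul_assoc, ← C_mul, ht, mul_div_cancel₀ _ hct']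
  have hPQ : P ∣ Q := by
    apply (isPrimitive_primPart N).dvd_of_fraction_map_dvd_fraction_map (K := RatFunc k)
    rw [← hP, hPm]
    exact (IsUnit.mul_left_dvd (isUnit_C.mpr ht0.isUnit)).mpr hdiv
  have hPd : (Bivariate.swap P).natDegree ≤ 2 := by
    have h1 : Bivariate.swap P ∣ Q' := by
      have := map_dvd (Bivariate.swap (R := k)) hPQ
      rwa [hQ, Bivariate.swap_swap_apply] at this
    exact (natDegree_le_of_dvd h1 hQ'0).trans hQ'd
  have hcoef : ∀ i, (P.coeff i).natDegree ≤ 2 := fun i =>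
    (natDegree_coeff_le_swap P i).trans hPd
  have hval : ∀ i, algebraMap k[X] (RatFunc k) (P.coeff i) = t * m.coeff i := by
    intro i
    rw [← coeff_map, hPm, coeff_C_mul]
  obtain ⟨m2, m1, m0⟩ := coeff_quad (-2 * a) (a ^ 2 - b ^ 2 * algebraMap k[X] (RatFunc k) F)
  rw [← hm] at m2 m1 m0
  have h2' : (2 : RatFunc k) ≠ 0 := by
    intro h
    apply h2
    apply (algebraMap k (RatFunc k)).injective
    rw [map_ofNat, map_zero, h]
  have hfin := five_le_of_sq_mul (D := P.coeff 1 ^ 2 - 4 * (P.coeff 2 * P.coeff 0))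
    (e := 2 * t * b) hF h5 (mul_ne_zero (mul_ne_zero h2' ht0) hb) (by
      simp only [map_sub, map_mul, map_pow, hval, m2, m1, m0, map_ofNat]
      ring)
  have hle : (P.coeff 1 ^ 2 - 4 * (P.coeff 2 * P.coeff 0)).natDegree ≤ 4 := by
    refine (natDegree_sub_le _ _).trans (max_le ?_ ?_)
    · have := natDegree_pow_le (p := P.coeff 1) (n := 2)
      have := hcoef 1
      omega
    · have e4 : (4 : k[X]) = C 4 := by rw [map_ofNat]
      rw [e4]
      refine (natDegree_C_mul_le _ _).trans (natDegree_mul_le.trans ?_)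
      have := hcoef 2
      have := hcoef 0
      omega
  omega

/-- Uniqueness of the rational subfield `k(X)` of degree two: every `k`-automorphism of
`k(X, √F)`, with `F` squarefree of degree at least five, maps `k(X)` into itself. -/
lemma aut_mem (F : k[X]) (h2 : (2 : k) ≠ 0) (hF : Squarefree F) (h5 : 5 ≤ F.natDegree)
    (σ : QuadExt F ≃ₐ[k] QuadExt F) (r : RatFunc k) :
    ∃ w : RatFunc k, σ (AdjoinRoot.of _ r) = AdjoinRoot.of _ w := by
  obtain ⟨v, hv⟩ := aut_X_mem F h2 hF h5 σ
  have hinj : Function.Injective (AdjoinRoot.of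
      (X ^ 2 - C (algebraMap k[X] (RatFunc k) F) : (RatFunc k)[X])) := by
    apply AdjoinRoot.of.injective_of_degree_ne_zero
    rw [degree_X_pow_sub_C (by norm_num)]
    norm_num
  have hpoly : ∀ q : k[X], σ (AdjoinRoot.of _ (algebraMap k[X] (RatFunc k) q)) =
      AdjoinRoot.of _ (aeval v q) := by
    intro q
    rw [aut_polynomial, hv, ← AdjoinRoot.algebraMap_eq, aeval_algebraMap_apply]
  have hd : aeval v r.denom ≠ 0 := by
    intro h0
    have h1 := hpoly r.denom
    rw [h0, map_zero, EmbeddingLike.map_eq_zero_iff] at h1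
    have h3 := hinj (h1.trans (map_zero _).symm)
    exact r.denom_ne_zero (by simpa using h3)
  refine ⟨aeval v r.num / aeval v r.denom, ?_⟩
  have hr : r * algebraMap k[X] (RatFunc k) r.denom = algebraMap k[X] (RatFunc k) r.num := by
    have h4 : algebraMap k[X] (RatFunc k) r.denom ≠ 0 := by simpa using r.denom_ne_zero
    exact ((div_eq_iff h4).mp r.num_div_denom).symm
  have h5 := congrArg (fun z => σ (AdjoinRoot.of _ z)) hr
  simp only [map_mul, hpoly] at h5
  have h6 : AdjoinRoot.of (X ^ 2 - C (algebraMap k[X] (RatFunc k) F) : (RatFunc k)[X])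
      (aeval v r.denom) * AdjoinRoot.of _ (aeval v r.denom)⁻¹ = 1 := by
    rw [← map_mul, mul_inv_cancel₀ hd, map_one]
  rw [div_eq_mul_inv, map_mul]
  linear_combination (AdjoinRoot.of _ (aeval v r.denom)⁻¹) * h5 -
    (σ (AdjoinRoot.of _ r)) * h6

end Kernel
end HyperellipticModuli

open HyperellipticModuli

/-- A hyperelliptic curve of genus `g ≥ 2` over the field `k` (of characteristic different from
`2`), given by an equation `Y² = F(X)` with `F` separable of degree `2g + 2`, or of degree
`2g + 1` when the point at infinity is a branch point. -/
structure HyperellipticCurve (k : Type*) [Field k] (g : ℕ) where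
  /-- The right-hand side of the equation `Y² = F(X)`. -/
  F : k[X]
  two_le_genus : 2 ≤ g
  separable : F.Separable
  natDegree_eq : F.natDegree = 2 * g + 1 ∨ F.natDegree = 2 * g + 2

namespace HyperellipticCurve

section FunctionField
variable {k : Type*} [Field k] {g : ℕ}

/-- The function field `K = k(X, Y)`, `Y² = F(X)`, of the curve. -/
abbrev FunctionField (C : HyperellipticCurve k g) : Type _ := QuadExt C.F

/-- Two curves over `k` are isomorphic when their function fields are isomorphic over `k`. -/
def Isomorphic (C D : HyperellipticCurve k g) : Prop :=
  Nonempty (C.FunctionField ≃ₐ[k] D.FunctionField)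

/-- The automorphism group `G = Aut(K/k)`. -/
abbrev AutGroup (C : HyperellipticCurve k g) : Type _ := C.FunctionField ≃ₐ[k] C.FunctionField

/-- The subgroup `G₀ = Gal(K/k(X))` of `G`, generated by the hyperelliptic involution. -/
def hyperellipticSubgroup (C : HyperellipticCurve k g) : Subgroup C.AutGroup :=
  (AlgEquiv.restrictScalarsHom k :
    (C.FunctionField ≃ₐ[RatFunc k] C.FunctionField) →* C.AutGroup).range

lemma mem_hyperellipticSubgroup (C : HyperellipticCurve k g) (σ : C.AutGroup) :
    σ ∈ C.hyperellipticSubgroup ↔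
      ∀ r : RatFunc k, σ (algebraMap (RatFunc k) C.FunctionField r) =
        algebraMap (RatFunc k) C.FunctionField r := by
  constructor
  · rintro ⟨τ, rfl⟩ r
    exact τ.commutes r
  · intro h
    exact ⟨AlgEquiv.ofRingEquiv (f := (σ : C.FunctionField ≃+* C.FunctionField)) h,
      AlgEquiv.ext fun _ => rfl⟩

instance normal_hyperellipticSubgroup [CharZero k] (C : HyperellipticCurve k g) :
    C.hyperellipticSubgroup.Normal where
  conj_mem := by
    intro τ hτ σ
    rw [mem_hyperellipticSubgroup] at hτ ⊢
    intro r
    have h5 : 5 ≤ C.F.natDegree := by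
      have := C.two_le_genus
      have := C.natDegree_eq
      omega
    obtain ⟨w, hw⟩ := aut_mem C.F two_ne_zero C.separable.squarefree h5 σ⁻¹ r
    have h1 : σ⁻¹ (algebraMap (RatFunc k) C.FunctionField r) =
      algebraMap (RatFunc k) C.FunctionField w := hw
    rw [AlgEquiv.mul_apply, AlgEquiv.mul_apply, h1, hτ, ← h1]
    exact σ.apply_symm_apply _

/-- The reduced automorphism group `G / G₀`. -/
abbrev ReducedAutGroup [CharZero k] (C : HyperellipticCurve k g) : Type _ :=
  C.AutGroup ⧸ C.hyperellipticSubgroup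

/-- The curve has an extra involution (its class lies in the locus `𝓛_g`): an involution in `G`
different from the hyperelliptic one. -/
def HasExtraInvolution (C : HyperellipticCurve k g) : Prop :=
  ∃ z : C.AutGroup, orderOf z = 2 ∧ z ∉ C.hyperellipticSubgroup

/-- The base change of a curve along an embedding of fields: the same equation, read over the
larger field. -/
def baseChange {L : Type*} [Field L] (C : HyperellipticCurve L g) (φ : L →+* k) :
    HyperellipticCurve k g where
  F := C.F.map φ
  two_le_genus := C.two_le_genus
  separable := C.separable.map
  natDegree_eq := by rw [natDegree_map]; exact C.natDegree_eq

/-- The curve `C` over `k` is, up to isomorphism over `k`, defined over the subfield `L`. -/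
def HasModelOver (C : HyperellipticCurve k g) (L : Subfield k) : Prop :=
  ∃ C₀ : HyperellipticCurve L g, (C₀.baseChange L.subtype).Isomorphic C

end FunctionField

section Moduli
variable {k : Type*} [Field k]

/-- A binary form `∑ aᵢ Xⁱ Zⁿ⁻ⁱ` of degree `n` is encoded by the polynomial `f = ∑ aᵢ Xⁱ` of
degree at most `n`. This is the substitution `X ↦ aX + bZ`, `Z ↦ cX + dZ`
for the matrix `γ = (a, b; c, d)`. -/
def formSubst (n : ℕ) (γ : Matrix.SpecialLinearGroup (Fin 2) k) (f : k[X]) : k[X] :=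
  ∑ i ∈ Finset.range (n + 1), C (f.coeff i) * (C (γ.1 0 0) * X + C (γ.1 0 1)) ^ i *
    (C (γ.1 1 0) * X + C (γ.1 1 1)) ^ (n - i)

/-- The value at a binary form `f` of degree `n` of a polynomial `I` with rational coefficients
in the coefficients of the general binary form of degree `n`. -/
def evalForm [CharZero k] (n : ℕ) (I : MvPolynomial (Fin (n + 1)) ℚ) (f : k[X]) : k :=
  MvPolynomial.aeval (fun i : Fin (n + 1) => f.coeff i) I

/-- `I` is an invariant of binary forms of degree `n` under `SL₂`. Together with homogeneity this
says that `I` is a relative invariant of `GL₂`. -/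
def IsFormInvariant (k : Type*) [Field k] [CharZero k] (n : ℕ)
    (I : MvPolynomial (Fin (n + 1)) ℚ) : Prop :=
  ∀ (γ : Matrix.SpecialLinearGroup (Fin 2) k) (f : k[X]), f.natDegree ≤ n →
    evalForm n I (formSubst n γ f) = evalForm n I f

/-- Over an algebraically closed field `k` of characteristic zero, the field generated by all
values at the curve of absolute invariants, that is, of quotients
`I / J` of invariants of the same degree, with rational coefficients, of binary forms of degree
`2g + 2`. The coarse moduli space `𝓗_g` over `ℚ` is the open subvariety (non-zero discriminant)
of `Proj` of the graded ring of these invariants, and this is the residue field, inside `k`, of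
the point `[C]` of `𝓗_g`. -/
def moduliField [CharZero k] {g : ℕ} (C : HyperellipticCurve k g) : Subfield k :=
  Subfield.closure {x | ∃ (d : ℕ) (I J : MvPolynomial (Fin (2 * g + 2 + 1)) ℚ),
    I.IsHomogeneous d ∧ J.IsHomogeneous d ∧
    IsFormInvariant k (2 * g + 2) I ∧ IsFormInvariant k (2 * g + 2) J ∧
    evalForm (2 * g + 2) J C.F ≠ 0 ∧
    x = evalForm (2 * g + 2) I C.F / evalForm (2 * g + 2) J C.F}

/-- The moduli point `[C]` of the curve is an `L`-rational point of the moduli space: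
`[C] ∈ 𝓗_g(L)`. -/
def ModuliPointRational [CharZero k] {g : ℕ} (C : HyperellipticCurve k g) (L : Subfield k) :
    Prop :=
  C.moduliField ≤ L

end Moduli

end HyperellipticCurve

end

/-!
The curve is determined up to isomorphism by the `2g + 2` roots of its form in the projective line,
its branch points, up to `GL₂`. The proof has three steps.

*Conjugates.* To a labelled configuration of points is attached a character of the monoid of regular
directed multigraphs: the bracket monomial of a multigraph, divided by a power of the product of all
brackets (`crossChar`). Cross ratios are among its values, so that it determines the labelled
configuration up to `GL₂` (`exists_gl_of_crossChar_eq`). The sum of these characters over all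
labellings is a quotient of two invariants of the form (`exists_homogeneous_symmetrized_bracket`),
hence lies in the field of moduli. If that field is contained in `L`, an automorphism `σ` of `k`
over `L` preserves the sum. Characters being linearly independent, it permutes the summands: the
`σ`-conjugate of the branch points is `GL₂`-equivalent to the branch points
(`HyperellipticCurve.exists_gl_galPerm_eq`).

*A marked point.* Automorphisms of the function field preserve `k(X)`, act on it by Möbius
transformations and preserve the branch points, so the stabiliser `H` of the branch points in `PGL₂`
is a finite group with two distinct involutions
(`HyperellipticCurve.exists_involutions_branchStab`). By Burnside's lemma, either the points fixed
by some non-trivial element of `H` include an `H`-orbit distinguished by its cardinality, or `H`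
has order four (`exists_unique_orbit_or_card_eq_four`). In the first case a point `P` of this
orbit, and in the second case a point constructed from the three anticommuting matrices which lift
the involutions of the Klein four-group (`exists_marked_of_klein`), can be made fixed by all the
equivalences of the first step, after correcting them by elements of `H` (`exists_marked_point`).

*Descent.* With `P` moved to infinity, the equivalences become affine. In characteristic zero the
barycentre of the finite branch points can be moved to the origin, and then the equivalences become
homotheties `x ↦ a x`. The coefficients of the polynomial vanishing at these points are multiplied
by powers of `a`, and one rescaling puts all of them in `L` (`exists_rescale_mem`), since `L` is the
field fixed by the automorphisms of `k` over `L` (`mem_of_forall_algEquiv_eq`). Forms with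
`GL₂`-equivalent roots have isomorphic function fields (`nonempty_quadExt_equiv`).
-/

noncomputable section
namespace HyperellipticModuli

/-! ### Points of the projective line and brackets -/

section Bracket
variable {k : Type*} [Field k]

/-- The projective line over `k`. -/
abbrev ProjLine (k : Type*) [Field k] : Type _ := Projectivization k (Fin 2 → k)

/-- The bracket `[v w]`, the determinant of two vectors of the plane. It vanishes if and only if
the points of the projective line defined by `v` and `w` coincide. -/
def bracket {A : Type*} [CommRing A] (v w : Fin 2 → A) : A := v 0 * w 1 - v 1 * w 0

lemma bracket_smul_smul (a b : k) (v w : Fin 2 → k) :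
    bracket (a • v) (b • w) = a * b * bracket v w := by
  simp [bracket]; ring

lemma bracket_gl_smul (g : GL (Fin 2) k) (v w : Fin 2 → k) :
    bracket (g • v) (g • w) = g.1.det * bracket v w := by
  simp [bracket, Matrix.det_fin_two]; ring

lemma bracket_eq_zero_iff {v w : Fin 2 → k} (hv : v ≠ 0) (hw : w ≠ 0) :
    bracket v w = 0 ↔ Projectivization.mk k v hv = Projectivization.mk k w hw := by
  rw [Projectivization.mk_eq_mk_iff']
  constructor
  · intro h
    simp only [bracket, sub_eq_zero] at h
    by_cases h0 : w 0 = 0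
    · have h1 : w 1 ≠ 0 := fun h1 => hw (by ext i; fin_cases i <;> simp [h0, h1])
      refine ⟨v 1 / w 1, ?_⟩
      ext i
      fin_cases i
      · simp only [Fin.zero_eta, Pi.smul_apply, h0, smul_eq_mul, mul_zero]
        rw [h0, mul_zero] at h
        exact ((mul_eq_zero.mp h).resolve_right h1).symm
      · simp [h1]
    · refine ⟨v 0 / w 0, ?_⟩
      ext i
      fin_cases i
      · simp [h0]
      · simp only [Fin.mk_one, Pi.smul_apply, smul_eq_mul]
        field_simp
        linear_combination h
  · rintro ⟨a, rfl⟩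
    simp [bracket]; ring

lemma rep_bracket_ne_zero {x y : ProjLine k} (h : x ≠ y) : bracket x.rep y.rep ≠ 0 := by
  rw [Ne, bracket_eq_zero_iff x.rep_nonzero y.rep_nonzero, Projectivization.mk_rep,
    Projectivization.mk_rep]
  exact h

lemma bracket_self (v : Fin 2 → k) : bracket v v = 0 := by simp [bracket]; ring

lemma eq_combination {e w : Fin 2 → k} (h : bracket e w ≠ 0) (v : Fin 2 → k) :
    v = (bracket v w / bracket e w) • e + (bracket e v / bracket e w) • w := by
  ext i
  simp only [Pi.add_apply, Pi.smul_apply, smul_eq_mul]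
  field_simp
  fin_cases i <;> simp [bracket] <;> ring

/-- The matrix with two given columns, in general position. -/
def glOfColumns (v w : Fin 2 → k) (h : bracket v w ≠ 0) : GL (Fin 2) k :=
  Matrix.GeneralLinearGroup.mkOfDetNeZero !![v 0, w 0; v 1, w 1] (by
    rw [Matrix.det_fin_two_of]; intro h'; apply h; simp only [bracket]; linear_combination h')

lemma glOfColumns_smul (v w : Fin 2 → k) (h : bracket v w ≠ 0) (u : Fin 2 → k) :
    glOfColumns v w h • u = u 0 • v + u 1 • w := by
  ext i
  fin_cases i <;> simp [glOfColumns, Matrix.GeneralLinearGroup.mkOfDetNeZero] <;> ring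

/-- Three distinct points are the images of `(1 : 0)`, `(0 : 1)`, `(1 : 1)`. -/
lemma exists_gl_frame {v₀ v₁ v₂ : Fin 2 → k} (h01 : bracket v₀ v₁ ≠ 0) (h12 : bracket v₂ v₁ ≠ 0)
    (h02 : bracket v₀ v₂ ≠ 0) : ∃ (g : GL (Fin 2) k) (a b : k), a ≠ 0 ∧ b ≠ 0 ∧
      g • ![1, 0] = a • v₀ ∧ g • ![0, 1] = b • v₁ ∧ g • ![1, 1] = v₂ := by
  have ha : bracket v₂ v₁ / bracket v₀ v₁ ≠ 0 := div_ne_zero h12 h01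
  have hb : bracket v₀ v₂ / bracket v₀ v₁ ≠ 0 := div_ne_zero h02 h01
  refine ⟨glOfColumns ((bracket v₂ v₁ / bracket v₀ v₁) • v₀) ((bracket v₀ v₂ / bracket v₀ v₁) • v₁)
    (by rw [bracket_smul_smul]; exact mul_ne_zero (mul_ne_zero ha hb) h01),
    _, _, ha, hb, ?_, ?_, ?_⟩
  · rw [glOfColumns_smul]; simp
  · rw [glOfColumns_smul]; simp
  · rw [glOfColumns_smul]
    ext i
    simp only [Matrix.cons_val_zero, Matrix.cons_val_one, one_smul, Pi.add_apply, Pi.smul_apply,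
      smul_eq_mul]
    field_simp
    fin_cases i <;> simp [bracket] <;> ring

/-- `GL₂` is transitive on triples of distinct points. -/
lemma exists_gl_smul_triple {x y z x' y' z' : ProjLine k} (hxy : x ≠ y) (hyz : z ≠ y) (hxz : x ≠ z)
    (hxy' : x' ≠ y') (hyz' : z' ≠ y') (hxz' : x' ≠ z') :
    ∃ g : GL (Fin 2) k, g • x = x' ∧ g • y = y' ∧ g • z = z' := by
  have key : ∀ x y z : ProjLine k, x ≠ y → z ≠ y → x ≠ z → ∃ g : GL (Fin 2) k,
      g • (Projectivization.mk k ![1, 0] (by simp)) = x ∧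
      g • (Projectivization.mk k ![0, 1] (by simp)) = y ∧
      g • (Projectivization.mk k ![1, 1] (by simp)) = z := by
    intro x y z hxy hyz hxz
    obtain ⟨g, a, b, ha, hb, h0, h1, h2⟩ := exists_gl_frame (rep_bracket_ne_zero hxy)
      (rep_bracket_ne_zero hyz) (rep_bracket_ne_zero hxz)
    refine ⟨g, ?_, ?_, ?_⟩
    · rw [Projectivization.smul_mk]
      conv_rhs => rw [← x.mk_rep]
      rw [Projectivization.mk_eq_mk_iff']
      exact ⟨a, h0.symm⟩
    · rw [Projectivization.smul_mk]
      conv_rhs => rw [← y.mk_rep]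
      rw [Projectivization.mk_eq_mk_iff']
      exact ⟨b, h1.symm⟩
    · rw [Projectivization.smul_mk]
      conv_rhs => rw [← z.mk_rep]
      rw [Projectivization.mk_eq_mk_iff']
      exact ⟨1, by rw [one_smul, h2]⟩
  obtain ⟨g, h0, h1, h2⟩ := key x y z hxy hyz hxz
  obtain ⟨g', h0', h1', h2'⟩ := key x' y' z' hxy' hyz' hxz'
  refine ⟨g' * g⁻¹, ?_, ?_, ?_⟩
  · rw [mul_smul, ← h0, inv_smul_smul, h0']
  · rw [mul_smul, ← h1, inv_smul_smul, h1']
  · rw [mul_smul, ← h2, inv_smul_smul, h2']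

/-- A linear map which fixes three points of the projective line is a homothety. -/
lemma gl_smul_eq_self_of_triple {g : GL (Fin 2) k} {x y z : ProjLine k} (hxy : x ≠ y) (hyz : z ≠ y)
    (hxz : x ≠ z) (hx : g • x = x) (hy : g • y = y) (hz : g • z = z) :
    ∃ c : k, c ≠ 0 ∧ ∀ v : Fin 2 → k, g • v = c • v := by
  have key : ∀ x : ProjLine k, g • x = x → ∃ c : k, g • x.rep = c • x.rep := by
    intro x hx
    rw [← x.mk_rep, Projectivization.smul_mk, Projectivization.mk_eq_mk_iff'] at hx
    obtain ⟨a, ha⟩ := hx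
    exact ⟨a, ha.symm⟩
  obtain ⟨a, ha⟩ := key x hx
  obtain ⟨b, hb⟩ := key y hy
  obtain ⟨c, hc⟩ := key z hz
  have hxy := rep_bracket_ne_zero hxy
  have hyz := rep_bracket_ne_zero hyz
  have hxz := rep_bracket_ne_zero hxz
  have e := eq_combination hxy
  have e' : ∀ v : Fin 2 → k, g • v = (bracket v y.rep / bracket x.rep y.rep) • a • x.rep
      + (bracket x.rep v / bracket x.rep y.rep) • b • y.rep := by
    intro v
    conv_lhs => rw [e v]
    rw [smul_add, smul_comm, smul_comm g, ha, hb]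
  have h1 := congrArg (fun v => bracket v y.rep) ((e' z.rep).symm.trans hc)
  have h2 := congrArg (fun v => bracket x.rep v) ((e' z.rep).symm.trans hc)
  have hac : a = c := by
    apply mul_right_cancel₀ hyz
    have : bracket ((bracket z.rep y.rep / bracket x.rep y.rep) • a • x.rep
      + (bracket x.rep z.rep / bracket x.rep y.rep) • b • y.rep) y.rep =
        a * bracket z.rep y.rep := by
      trans a * (bracket z.rep y.rep / bracket x.rep y.rep) * bracket x.rep y.rep
      · simp [bracket]; ring
      · field_simp
    rw [← this]
    refine h1.trans ?_
    simp [bracket]; ring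
  have hbc : b = c := by
    apply mul_right_cancel₀ hxz
    have : bracket x.rep ((bracket z.rep y.rep / bracket x.rep y.rep) • a • x.rep
      + (bracket x.rep z.rep / bracket x.rep y.rep) • b • y.rep) = b * bracket x.rep z.rep := by
      trans b * (bracket x.rep z.rep / bracket x.rep y.rep) * bracket x.rep y.rep
      · simp [bracket]; ring
      · field_simp
    rw [← this]
    refine h2.trans ?_
    simp [bracket]; ring
  refine ⟨c, ?_, ?_⟩
  · rintro rfl
    rw [zero_smul] at hc
    exact z.rep_nonzero ((smul_eq_zero_iff_eq g).mp hc)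
  · intro v
    rw [e' v, hac, hbc]
    conv_rhs => rw [e v]
    rw [smul_add, smul_comm c, smul_comm c]

end Bracket

/-! ### The characters of a configuration of points -/

section CrossRatio
variable {k : Type*} [Field k] {ι : Type*} [Fintype ι]

/-- The degree of the vertex `x` in the directed multigraph on `ι` with `m (a, b)` edges from
`a` to `b`. -/
def edgeDegree (m : ι × ι → ℕ) (x : ι) : ℕ := ∑ j, (m (x, j) + m (j, x))

/-- The product of the brackets of the edges of a directed multigraph, for a family of vectors. -/
def bracketProd {A : Type*} [CommRing A] (m : ι × ι → ℕ) (v : ι → Fin 2 → A) : A :=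
  ∏ p : ι × ι, bracket (v p.1) (v p.2) ^ m p

lemma edgeDegree_add (m m' : ι × ι → ℕ) (x : ι) :
    edgeDegree (m + m') x = edgeDegree m x + edgeDegree m' x := by
  simp only [edgeDegree, Pi.add_apply, ← Finset.sum_add_distrib]
  exact Finset.sum_congr rfl fun j _ => by ring

lemma bracketProd_add (m m' : ι × ι → ℕ) (v : ι → Fin 2 → k) :
    bracketProd (m + m') v = bracketProd m v * bracketProd m' v := by
  simp only [bracketProd, Pi.add_apply, pow_add, Finset.prod_mul_distrib]

lemma bracketProd_smul (m : ι × ι → ℕ) (c : ι → k) (v : ι → Fin 2 → k) :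
    bracketProd m (fun i => c i • v i) = (∏ i, c i ^ edgeDegree m i) * bracketProd m v := by
  have h1 : ∏ p : ι × ι, c p.1 ^ m p = ∏ i, c i ^ ∑ j, m (i, j) := by
    rw [Fintype.prod_prod_type]
    exact Finset.prod_congr rfl fun i _ => Finset.prod_pow_eq_pow_sum _ _ (c i)
  have h2 : ∏ p : ι × ι, c p.2 ^ m p = ∏ i, c i ^ ∑ j, m (j, i) := by
    rw [Fintype.prod_prod_type_right]
    exact Finset.prod_congr rfl fun i _ => Finset.prod_pow_eq_pow_sum _ _ (c i)
  simp only [bracketProd, bracket_smul_smul, mul_pow, Finset.prod_mul_distrib, h1, h2, edgeDegree,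
    Finset.sum_add_distrib, pow_add]

lemma bracketProd_gl_smul (m : ι × ι → ℕ) (g : GL (Fin 2) k) (v : ι → Fin 2 → k) :
    bracketProd m (fun i => g • v i) = g.1.det ^ (∑ p, m p) * bracketProd m v := by
  simp only [bracketProd, bracket_gl_smul, mul_pow, Finset.prod_mul_distrib,
    Finset.prod_pow_eq_pow_sum]

lemma bracketProd_comp_perm {A : Type*} [CommRing A] (m : ι × ι → ℕ) (π : Equiv.Perm ι)
    (v : ι → Fin 2 → A) :
    bracketProd m (v ∘ π) = bracketProd (fun p => m (π.symm p.1, π.symm p.2)) v := by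
  rw [bracketProd, bracketProd, ← Equiv.prod_comp (Equiv.prodCongr π π) fun p : ι × ι =>
    bracket (v p.1) (v p.2) ^ m (π.symm p.1, π.symm p.2)]
  simp

lemma sum_edgeDegree (m : ι × ι → ℕ) : ∑ x, edgeDegree m x = 2 * ∑ p, m p := by
  simp only [edgeDegree, Finset.sum_add_distrib]
  rw [← Fintype.sum_prod_type, ← Fintype.sum_prod_type_right (f := fun p => m p)]
  ring

variable [DecidableEq ι]

variable (ι) in
/-- The complete directed graph. -/
def completeEdges : ι × ι → ℕ := fun p => if p.1 = p.2 then 0 else 1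

lemma edgeDegree_completeEdges (x : ι) :
    edgeDegree (completeEdges ι) x = 2 * (Fintype.card ι - 1) := by
  have h1 : ∀ j, (completeEdges ι (x, j) + completeEdges ι (j, x)) = if j ≠ x then 2 else 0 := by
    intro j
    simp only [completeEdges]
    by_cases h : x = j
    · simp [h]
    · simp [h, Ne.symm h]
  simp only [edgeDegree, h1]
  rw [← Finset.sum_filter, Finset.sum_const, Finset.filter_ne', Finset.card_erase_of_mem
    (Finset.mem_univ _), Finset.card_univ, smul_eq_mul, mul_comm]

lemma edgeDegree_single (a b x : ι) : edgeDegree (Pi.single (a, b) 1) x =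
    (if x = a then 1 else 0) + (if x = b then 1 else 0) := by
  have h1 : ∀ a b c d : ι, (Pi.single (a, b) 1 : ι × ι → ℕ) (c, d) =
      if c = a ∧ d = b then 1 else 0 := by
    intro a b c d
    simp [Pi.single_apply, Prod.ext_iff]
  simp only [edgeDegree, h1, Finset.sum_add_distrib]
  congr 1
  · by_cases h : x = a <;> simp [h]
  · by_cases h : x = b <;> simp [h]

lemma bracketProd_single (a b : ι) (v : ι → Fin 2 → k) :
    bracketProd (Pi.single (a, b) 1) v = bracket (v a) (v b) := by
  rw [bracketProd, Finset.prod_eq_single (a, b)]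
  · simp
  · intro p _ hp
    simp [hp]
  · simp

lemma bracketProd_completeEdges_ne_zero {v : ι → Fin 2 → k}
    (hv : ∀ i j, i ≠ j → bracket (v i) (v j) ≠ 0) : bracketProd (completeEdges ι) v ≠ 0 := by
  refine Finset.prod_ne_zero_iff.mpr fun p _ => ?_
  by_cases h : p.1 = p.2
  · simp [completeEdges, h]
  · exact pow_ne_zero _ (hv _ _ h)

lemma bracketProd_completeEdges_perm (π : Equiv.Perm ι) (v : ι → Fin 2 → k) :
    bracketProd (completeEdges ι) (v ∘ π) = bracketProd (completeEdges ι) v := by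
  rw [bracketProd_comp_perm]
  simp only [completeEdges, EmbeddingLike.apply_eq_iff_eq]
  rfl

variable (ι) in
/-- The monoid of pairs `(m, e)` in which `m` is a directed multigraph on `ι`, regular of degree
`e` times the degree of the complete directed graph. -/
def RegularGraphs : AddSubmonoid ((ι × ι → ℕ) × ℕ) where
  carrier := {r | ∀ x, edgeDegree r.1 x = r.2 * (2 * (Fintype.card ι - 1))}
  add_mem' := by
    intro a b ha hb x
    rw [Prod.fst_add, edgeDegree_add, ha, hb, Prod.snd_add, add_mul]
  zero_mem' := by
    intro x
    simp [edgeDegree]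

lemma sum_regularGraphs (r : RegularGraphs ι) :
    ∑ p, r.1.1 p = r.1.2 * ∑ p, completeEdges ι p := by
  have h1 := sum_edgeDegree r.1.1
  have h2 := sum_edgeDegree (completeEdges ι)
  have h3 : ∀ x, edgeDegree r.1.1 x = r.1.2 * edgeDegree (completeEdges ι) x := by
    intro x
    rw [r.2 x, edgeDegree_completeEdges]
  simp only [h3, ← Finset.mul_sum] at h1
  rw [h2] at h1
  linarith

/-- The character of a family `v` of vectors: it sends `(m, e)` to the quotient of the bracket
monomial of `m` by the `e`-th power of the product of all brackets. -/
def crossHom (v : ι → Fin 2 → k) : Multiplicative (RegularGraphs ι) →* k where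
  toFun r := bracketProd r.toAdd.1.1 v / bracketProd (completeEdges ι) v ^ r.toAdd.1.2
  map_one' := by simp [bracketProd]
  map_mul' a b := by
    simp only [toAdd_mul, AddSubmonoid.coe_add, Prod.fst_add, Prod.snd_add, bracketProd_add,
      pow_add, mul_div_mul_comm]

lemma crossHom_apply (v : ι → Fin 2 → k) (r : Multiplicative (RegularGraphs ι)) :
    crossHom v r = bracketProd r.toAdd.1.1 v / bracketProd (completeEdges ι) v ^ r.toAdd.1.2 := rfl

lemma crossHom_smul (c : ι → k) (hc : ∀ i, c i ≠ 0) (v : ι → Fin 2 → k) :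
    crossHom (fun i => c i • v i) = crossHom v := by
  refine MonoidHom.ext fun r => ?_
  have h3 : ∀ x, edgeDegree r.toAdd.1.1 x = edgeDegree (completeEdges ι) x * r.toAdd.1.2 := by
    intro x
    rw [r.toAdd.2 x, edgeDegree_completeEdges, mul_comm]
  have h0 : (∏ i, c i ^ edgeDegree (completeEdges ι) i) ≠ 0 :=
    Finset.prod_ne_zero_iff.mpr fun i _ => pow_ne_zero _ (hc i)
  simp only [crossHom_apply, bracketProd_smul, mul_pow, h3, pow_mul, Finset.prod_pow]
  rw [mul_div_mul_left _ _ (pow_ne_zero _ h0)]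

lemma crossHom_gl_smul (g : GL (Fin 2) k) (v : ι → Fin 2 → k) :
    crossHom (fun i => g • v i) = crossHom v := by
  refine MonoidHom.ext fun r => ?_
  simp only [crossHom_apply, bracketProd_gl_smul, mul_pow, sum_regularGraphs]
  rw [← pow_mul, mul_comm r.toAdd.1.2, mul_div_mul_left]
  exact pow_ne_zero _ g.det_ne_zero

lemma crossHom_map {k' : Type*} [Field k'] (σ : k →+* k') (v : ι → Fin 2 → k)
    (r : Multiplicative (RegularGraphs ι)) :
    crossHom (fun i => σ ∘ v i) r = σ (crossHom v r) := by
  simp [crossHom_apply, bracketProd, bracket]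

/-- The edges whose bracket monomial, divided by that of the complete graph, is the cross ratio
`[a b][c d] / [a c][b d]`. -/
lemma exists_regularGraph_cross {a b c d : ι} (hab : a ≠ b) (hac : a ≠ c) (hbd : b ≠ d) :
    ∃ r : Multiplicative (RegularGraphs ι),
    ∀ v : ι → Fin 2 → k, (∀ i j, i ≠ j → bracket (v i) (v j) ≠ 0) →
      crossHom v r * (bracket (v a) (v c) * bracket (v b) (v d)) =
        bracket (v a) (v b) * bracket (v c) (v d) := by
  set m₀ : ι × ι → ℕ := fun p =>
    if p = (a, c) ∨ p = (b, d) then 0 else completeEdges ι p with hm₀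
  have hm : m₀ + (Pi.single (a, c) 1 + Pi.single (b, d) 1) = completeEdges ι := by
    ext p
    have hne : (a, c) ≠ (b, d) := by simp [hab]
    simp only [hm₀, Pi.add_apply, Pi.single_apply]
    by_cases h1 : p = (a, c)
    · subst h1; simp [completeEdges, hac, hab]
    · by_cases h2 : p = (b, d)
      · subst h2; simp [completeEdges, hbd, hab.symm]
      · simp [h1, h2]
  set m : ι × ι → ℕ := m₀ + (Pi.single (a, b) 1 + Pi.single (c, d) 1) with hm'
  have hreg : (m, 1) ∈ RegularGraphs ι := by
    intro x
    have h1 := congrArg (fun m => edgeDegree m x) hm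
    have h2 := congrArg (fun m => edgeDegree m x) hm'
    simp only [edgeDegree_add, edgeDegree_single, edgeDegree_completeEdges] at h1 h2
    simp only [one_mul]
    omega
  refine ⟨Multiplicative.ofAdd ⟨(m, 1), hreg⟩, fun v hv => ?_⟩
  have h1 := congrArg (fun m => bracketProd m v) hm
  have h2 := congrArg (fun m => bracketProd m v) hm'
  simp only [bracketProd_add, bracketProd_single] at h1 h2
  rw [crossHom_apply]
  simp only [toAdd_ofAdd, pow_one]
  rw [h2, ← h1]
  have hh1 := hv _ _ hac
  have hh2 := hv _ _ hbd
  have hh3 : bracketProd m₀ v ≠ 0 := by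
    intro h0
    rw [h0, zero_mul] at h1
    exact bracketProd_completeEdges_ne_zero hv h1.symm
  field_simp

/-- The character of a labelled configuration of points of the projective line. By `crossHom_smul`
it does not depend on the chosen representatives of the points. -/
def crossChar (ℓ : ι → ProjLine k) : Multiplicative (RegularGraphs ι) →* k :=
  crossHom fun i => (ℓ i).rep

lemma crossChar_eq_of_smul_rep {ℓ : ι → ProjLine k} {v : ι → Fin 2 → k} (hv : ∀ i, v i ≠ 0)
    (h : ∀ i, Projectivization.mk k (v i) (hv i) = ℓ i) : crossChar ℓ = crossHom v := by
  have h1 : ∀ i, ∃ a : kˣ, a • v i = (ℓ i).rep := by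
    intro i
    rw [← h i]
    exact Projectivization.exists_smul_eq_mk_rep k (v i) (hv i)
  choose a ha using h1
  rw [crossChar, ← crossHom_smul (fun i => (a i : k)) (fun i => (a i).ne_zero) v]
  congr 1
  ext1 i
  rw [← ha i]
  rfl

lemma crossChar_gl_smul (g : GL (Fin 2) k) (ℓ : ι → ProjLine k) :
    crossChar (fun i => g • ℓ i) = crossChar ℓ := by
  rw [crossChar_eq_of_smul_rep (v := fun i => g • (ℓ i).rep)
    (fun i => (smul_ne_zero_iff_ne g).mpr (ℓ i).rep_nonzero), crossHom_gl_smul, crossChar]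
  intro i
  conv_rhs => rw [← (ℓ i).mk_rep]
  rfl

/-- The characters separate the labelled configurations up to `GL₂`: three of the points can be
matched, and the cross ratios with these three determine the others. -/
lemma exists_gl_of_crossChar_eq (hι : 3 ≤ Fintype.card ι) {ℓ ℓ' : ι → ProjLine k}
    (hℓ : Function.Injective ℓ) (hℓ' : Function.Injective ℓ') (h : crossChar ℓ = crossChar ℓ') :
    ∃ g : GL (Fin 2) k, ∀ i, g • ℓ i = ℓ' i := by
  obtain ⟨a, b, c, hab, hac, hbc⟩ := Fintype.two_lt_card_iff.mp hι
  obtain ⟨g, ha, hb, hc⟩ := exists_gl_smul_triple (hℓ.ne hab) (hℓ.ne hbc.symm) (hℓ.ne hac)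
    (hℓ'.ne hab) (hℓ'.ne hbc.symm) (hℓ'.ne hac)
  refine ⟨g, fun d => ?_⟩
  by_cases hda : a = d
  · rw [← hda, ha]
  by_cases hdb : b = d
  · rw [← hdb, hb]
  by_cases hdc : c = d
  · rw [← hdc, hc]
  rw [← crossChar_gl_smul g] at h
  have hinj : Function.Injective (fun i => g • ℓ i) := (MulAction.injective g).comp hℓ
  obtain ⟨r, hr⟩ := exists_regularGraph_cross (k := k) hab hac hdb
  have h1 := hr _ (fun i j hij => rep_bracket_ne_zero (hinj.ne hij))
  have h2 := hr _ (fun i j hij => rep_bracket_ne_zero (hℓ'.ne hij))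
  have hrr := DFunLike.congr_fun h r
  simp only [crossChar] at hrr
  rw [hrr] at h1
  simp only [ha, hb, hc] at h1
  have hbc' := rep_bracket_ne_zero (hℓ'.ne hbc)
  have hab' := rep_bracket_ne_zero (hℓ'.ne hab)
  have hac' := rep_bracket_ne_zero (hℓ'.ne hac)
  have hbd' := rep_bracket_ne_zero (hℓ'.ne hdb)
  set x := (g • ℓ d).rep
  set y := (ℓ' d).rep
  set t := (crossHom fun i => (ℓ' i).rep) r
  set A := (ℓ' a).rep
  set B := (ℓ' b).rep
  set G := (ℓ' c).rep
  have hz : bracket x y = 0 := by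
    have h3 : (bracket A B * bracket A G * bracket B G) * bracket x y = 0 := by
      -- the Plücker relation
      have hP : bracket B G * bracket x y =
          bracket B x * bracket G y - bracket B y * bracket G x := by
        simp only [bracket]; ring
      have e : bracket A B * bracket A G *
          (bracket B x * bracket G y - bracket B y * bracket G x) = 0 := by
        linear_combination (bracket A G * bracket B y) * h1 - (bracket A G * bracket B x) * h2
      linear_combination (bracket A B * bracket A G) * hP + e
    exact (mul_eq_zero.mp h3).resolve_left (mul_ne_zero (mul_ne_zero hab' hac') hbc')
  rw [bracket_eq_zero_iff (Projectivization.rep_nonzero _) (Projectivization.rep_nonzero _),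
    Projectivization.mk_rep, Projectivization.mk_rep] at hz
  exact hz

end CrossRatio

/-! ### Degrees of symmetric polynomials -/

section Symmetric

lemma multiset_esymm_cons {R : Type*} [CommSemiring R] (a : R) (s : Multiset R) (n : ℕ) :
    (a ::ₘ s).esymm (n + 1) = s.esymm (n + 1) + a * s.esymm n := by
  simp [Multiset.esymm, Multiset.powersetCard_cons, Multiset.map_map, Multiset.sum_map_mul_left]

lemma finSuccEquiv_esymm (R : Type*) [CommRing R] (m i : ℕ) :
    MvPolynomial.finSuccEquiv R m (MvPolynomial.esymm (Fin (m + 1)) R (i + 1)) =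
      C (MvPolynomial.esymm (Fin m) R (i + 1)) + X * C (MvPolynomial.esymm (Fin m) R i) := by
  have h1 : ∀ p, MvPolynomial.finSuccEquiv R m p =
      MvPolynomial.aeval (fun j => MvPolynomial.finSuccEquiv R m (MvPolynomial.X j)) p := by
    intro p
    exact DFunLike.congr_fun (MvPolynomial.aeval_unique
      (MvPolynomial.finSuccEquiv R m).toAlgHom) p
  have h2 : ∀ i, C (MvPolynomial.esymm (Fin m) R i) = (Multiset.map
      (fun j : Fin m => (C (MvPolynomial.X j) : (MvPolynomial (Fin m) R)[X]))
      Finset.univ.val).esymm i := by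
    intro i
    rw [← MvPolynomial.aeval_esymm_eq_multiset_esymm (Fin m) R]
    have := DFunLike.congr_fun (MvPolynomial.aeval_unique
      (IsScalarTower.toAlgHom R (MvPolynomial (Fin m) R) (MvPolynomial (Fin m) R)[X]))
      (MvPolynomial.esymm (Fin m) R i)
    exact this
  rw [h1, MvPolynomial.aeval_esymm_eq_multiset_esymm, Fin.univ_succ, Finset.cons_val,
    Multiset.map_cons, multiset_esymm_cons, h2, h2]
  simp [Function.comp_def, MvPolynomial.finSuccEquiv_X_zero,
    MvPolynomial.finSuccEquiv_X_succ]

lemma natDegree_coeff_finsupp_prod {σ A : Type*} [CommRing A] (a b : σ → A) (s : σ →₀ ℕ) :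
    (s.prod fun i e => (C (b i) + X * C (a i)) ^ e).natDegree ≤ s.degree ∧
      (s.prod fun i e => (C (b i) + X * C (a i)) ^ e).coeff s.degree =
        s.prod fun i e => a i ^ e := by
  have h1 : ∀ i, (C (b i) + X * C (a i)).natDegree ≤ 1 := fun i => by
    compute_degree
  induction s using Finsupp.induction_linear with
  | zero => simp
  | add s t hs ht =>
    rw [Finsupp.prod_add_index' (by simp) (by intros; rw [pow_add]),
      Finsupp.prod_add_index' (by simp) (by intros; rw [pow_add]), map_add]
    exact ⟨natDegree_mul_le.trans (add_le_add hs.1 ht.1),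
      by rw [coeff_mul_add_eq_of_natDegree_le hs.1 ht.1, hs.2, ht.2]⟩
  | single i e =>
    rw [Finsupp.prod_single_index (by simp), Finsupp.prod_single_index (by simp),
      Finsupp.degree_single]
    constructor
    · simpa using natDegree_pow_le_of_le e (h1 i)
    · have := coeff_pow_of_natDegree_le (m := e) (h1 i)
      rw [mul_one] at this
      rw [this]
      simp [coeff_C]

/-- The top coefficient of a polynomial evaluated at linear polynomials in a new variable. -/
lemma coeff_aeval_linear {σ R A : Type*} [CommRing R] [CommRing A] [Algebra R A]
    (a b : σ → A) (P : MvPolynomial σ R) {D : ℕ} (hD : P.totalDegree ≤ D) :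
    (MvPolynomial.aeval (fun i => C (b i) + X * C (a i)) P).coeff D =
      MvPolynomial.aeval a (MvPolynomial.homogeneousComponent D P) := by
  classical
  rw [MvPolynomial.homogeneousComponent_apply, map_sum, MvPolynomial.aeval_def,
    MvPolynomial.eval₂_eq, finsetSum_coeff, Finset.sum_filter]
  refine Finset.sum_congr rfl fun s hs => ?_
  have hsD : s.degree ≤ D := (MvPolynomial.le_totalDegree hs).trans hD
  obtain ⟨h1, h2⟩ := natDegree_coeff_finsupp_prod a b s
  have e1 : (algebraMap R A[X]) (MvPolynomial.coeff s P) =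
      C (algebraMap R A (MvPolynomial.coeff s P)) := rfl
  have e2 : ∏ i ∈ s.support, (C (b i) + X * C (a i)) ^ s i =
    s.prod fun i e => (C (b i) + X * C (a i)) ^ e := rfl
  rw [e1, coeff_C_mul, e2]
  split_ifs with h
  · rw [← h, h2, MvPolynomial.aeval_monomial]
  · rw [coeff_eq_zero_of_natDegree_lt (by omega), mul_zero]

/-- A symmetric polynomial of degree at most `d` in each variable is a polynomial of total degree
at most `d` in the elementary symmetric polynomials. Indeed the terms of top degree `D`, with the
first variable singled out, contribute the coefficient of its `D`-th power. -/
lemma totalDegree_le_of_degreeOf_esymm {R : Type*} [CommRing R] [IsDomain R] [Infinite R] (m d : ℕ)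
    (P : MvPolynomial (Fin (m + 1)) R) (h : MvPolynomial.degreeOf 0 (MvPolynomial.aeval
      (fun i : Fin (m + 1) => MvPolynomial.esymm (Fin (m + 1)) R (i + 1)) P) ≤ d) :
    P.totalDegree ≤ d := by
  by_contra! hlt
  set D := P.totalDegree with hD
  rw [← MvPolynomial.natDegree_finSuccEquiv] at h
  have h1 : MvPolynomial.finSuccEquiv R m (MvPolynomial.aeval
      (fun i : Fin (m + 1) => MvPolynomial.esymm (Fin (m + 1)) R (i + 1)) P) =
      MvPolynomial.aeval (fun i : Fin (m + 1) => C (MvPolynomial.esymm (Fin m) R (i + 1)) +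
        X * C (MvPolynomial.esymm (Fin m) R i)) P := by
    have := MvPolynomial.comp_aeval_apply (B := (MvPolynomial (Fin m) R)[X])
      (f := fun i : Fin (m + 1) => MvPolynomial.esymm (Fin (m + 1)) R (i + 1))
      (MvPolynomial.finSuccEquiv R m).toAlgHom P
    refine this.trans ?_
    congr 1
    congr 1
    ext1 i
    exact finSuccEquiv_esymm R m i
  have h2 := coeff_aeval_linear (fun i : Fin (m + 1) => MvPolynomial.esymm (Fin m) R i)
    (fun i : Fin (m + 1) => MvPolynomial.esymm (Fin m) R (i + 1)) P hD.le
  rw [← h1, coeff_eq_zero_of_natDegree_lt (lt_of_le_of_lt h hlt)] at h2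
  set T := MvPolynomial.homogeneousComponent D P with hT
  have hTh : T.IsHomogeneous D := MvPolynomial.homogeneousComponent_isHomogeneous D P
  -- algebraic independence of the elementary symmetric polynomials in the remaining variables
  have h3 : MvPolynomial.aeval (Fin.cons 1 MvPolynomial.X :
      Fin (m + 1) → MvPolynomial (Fin m) R) T = 0 := by
    apply MvPolynomial.esymmAlgHom_fin_injective (n := m) (m := m) R le_rfl
    rw [map_zero]
    apply Subtype.ext
    rw [MvPolynomial.esymmAlgHom_apply, MvPolynomial.comp_aeval_apply]
    refine Eq.trans ?_ h2.symm
    congr 2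
    ext1 i
    refine Fin.cases ?_ (fun i => ?_) i
    · simp
    · simp
  -- `T` is homogeneous and vanishes where the first variable is one, so it vanishes wherever the
  -- first variable is not zero
  have h4 : MvPolynomial.X 0 * T = 0 := by
    apply MvPolynomial.funext
    intro x
    rw [map_mul, map_zero, MvPolynomial.eval_X]
    by_cases hx : x 0 = 0
    · rw [hx, zero_mul]
    have hx' : algebraMap R (FractionRing R) (x 0) ≠ 0 := by
      simpa using hx
    have h6 := congrArg (MvPolynomial.aeval (fun i : Fin m => algebraMap R (FractionRing R)
      (x i.succ) / algebraMap R (FractionRing R) (x 0))) h3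
    rw [MvPolynomial.comp_aeval_apply, map_zero] at h6
    have h7 : (fun i : Fin (m + 1) => algebraMap R (FractionRing R) (x i)) =
        algebraMap R (FractionRing R) (x 0) • (fun i => MvPolynomial.aeval
          (fun i : Fin m => algebraMap R (FractionRing R) (x i.succ) /
            algebraMap R (FractionRing R) (x 0))
          ((Fin.cons 1 MvPolynomial.X : Fin (m + 1) → MvPolynomial (Fin m) R) i)) := by
      ext1 i
      refine Fin.cases ?_ (fun i => ?_) i
      · simp
      · simp only [Pi.smul_apply, Fin.cons_succ, MvPolynomial.aeval_X, smul_eq_mul]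
        field_simp
    have h8 : MvPolynomial.aeval (fun i : Fin (m + 1) => algebraMap R (FractionRing R) (x i)) T
        = 0 := by
      rw [h7, MvPolynomial.aeval_def, MvPolynomial.eval₂_eq']
      rw [MvPolynomial.aeval_def, MvPolynomial.eval₂_eq'] at h6
      have h9 := congrArg (fun z => algebraMap R (FractionRing R) (x 0) ^ D * z) h6
      simp only [mul_zero] at h9
      rw [← h9, Finset.mul_sum]
      refine Finset.sum_congr rfl fun s hs => ?_
      have hs' : ∑ i, s i = D := by
        have := hTh (MvPolynomial.mem_support_iff.mp hs)
        rw [← this]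
        simp [Finsupp.weight_apply, Finsupp.sum_fintype]
      simp only [Pi.smul_apply, smul_eq_mul, mul_pow, Finset.prod_mul_distrib]
      rw [Finset.prod_pow_eq_pow_sum, hs']
      ring
    have h10 : algebraMap R (FractionRing R) (MvPolynomial.eval x T) = 0 := by
      rw [← h8]
      exact (MvPolynomial.aeval_algebraMap_apply (FractionRing R) x T).symm
    rw [(map_eq_zero_iff _ (IsFractionRing.injective R (FractionRing R))).mp h10, mul_zero]
  have hT0 : T = 0 := (mul_eq_zero.mp h4).resolve_left (MvPolynomial.X_ne_zero 0)
  have hP : P ≠ 0 := by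
    rintro rfl
    simp at hD
    omega
  obtain ⟨s, hs, hs'⟩ := Finset.exists_mem_eq_sup P.support
    (MvPolynomial.support_nonempty.mpr hP) (fun s => s.sum fun _ e => e)
  have := congrArg (MvPolynomial.coeff s) hT0
  rw [hT, MvPolynomial.coeff_homogeneousComponent, if_pos, MvPolynomial.coeff_zero] at this
  · exact (MvPolynomial.mem_support_iff.mp hs) this
  · rw [hD, MvPolynomial.totalDegree, hs']
    rfl

end Symmetric

/-! ### Invariants of binary forms from brackets -/

section Invariants

/-- The binary form with the given points as roots: the product of the linear forms
`v₁ X - v₀ Z`, dehomogenised at `Z = 1`. -/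
def formOf {A ι : Type*} [CommRing A] [Fintype ι] (v : ι → Fin 2 → A) : A[X] :=
  ∏ i, (C (v i 1) * X - C (v i 0))

lemma formOf_map {A B ι : Type*} [CommRing A] [CommRing B] [Fintype ι] (φ : A →+* B)
    (v : ι → Fin 2 → A) : (formOf v).map φ = formOf fun i => φ ∘ v i := by
  simp [formOf, Polynomial.map_prod]

lemma natDegree_formOf_le {A ι : Type*} [CommRing A] [Fintype ι] (v : ι → Fin 2 → A) :
    (formOf v).natDegree ≤ Fintype.card ι := by
  refine (natDegree_prod_le _ _).trans ?_
  refine (Finset.sum_le_card_nsmul _ _ 1 fun i _ => ?_).trans (by simp)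
  compute_degree

lemma bracketProd_map {A B ι : Type*} [CommRing A] [CommRing B] [Fintype ι] (φ : A →+* B)
    (m : ι × ι → ℕ) (v : ι → Fin 2 → A) :
    φ (bracketProd m v) = bracketProd m fun i => φ ∘ v i := by
  simp [bracketProd, bracket]

lemma coeff_formOf {k : Type*} [Field k] {n : ℕ} (v : Fin n → Fin 2 → k) (hv : ∀ i, v i 1 ≠ 0)
    {j : ℕ} (hj : j ≤ n) : (formOf v).coeff (n - j) = (∏ i, v i 1) *
      ((-1) ^ j *
        MvPolynomial.aeval (fun i => v i 0 / v i 1) (MvPolynomial.esymm (Fin n) ℤ j)) := by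
  have h1 : formOf v = C (∏ i, v i 1) *
      (Multiset.map (fun a => X - C a) (Finset.univ.val.map fun i => v i 0 / v i 1)).prod := by
    rw [Multiset.map_map, map_prod, formOf]
    change _ = _ * ∏ i, (X - C (v i 0 / v i 1))
    rw [← Finset.prod_mul_distrib]
    refine Finset.prod_congr rfl fun i _ => ?_
    rw [mul_sub, ← C_mul, mul_div_cancel₀ _ (hv i)]
  rw [h1, coeff_C_mul, Multiset.prod_X_sub_C_coeff _ (by simp),
    MvPolynomial.aeval_esymm_eq_multiset_esymm]
  simp [Nat.sub_sub_self hj]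

/-- The homogenisation, in degree `d`, of a polynomial in the elementary symmetric functions of the
roots, as a polynomial in the coefficients of a binary form. -/
def homogenizeEsymm {n : ℕ} (P : MvPolynomial (Fin n) ℚ) (d : ℕ) : MvPolynomial (Fin (n + 1)) ℚ :=
  ∑ s ∈ P.support, MvPolynomial.C (P.coeff s) * (MvPolynomial.X (Fin.last n) ^ (d - s.degree) *
    ∏ i, (MvPolynomial.C ((-1) ^ (i.1 + 1)) * MvPolynomial.X i.rev.castSucc) ^ s i)

lemma isHomogeneous_homogenizeEsymm {n : ℕ} (P : MvPolynomial (Fin n) ℚ) {d : ℕ}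
    (hd : P.totalDegree ≤ d) : (homogenizeEsymm P d).IsHomogeneous d := by
  refine MvPolynomial.IsHomogeneous.sum _ _ _ fun s hs => ?_
  refine MvPolynomial.IsHomogeneous.C_mul ?_ _
  have hsd : s.degree ≤ d := (MvPolynomial.le_totalDegree hs).trans hd
  have h1 : (∏ i, ((MvPolynomial.C ((-1) ^ (i.1 + 1)) * MvPolynomial.X i.rev.castSucc) ^ s i :
      MvPolynomial (Fin (n + 1)) ℚ)).IsHomogeneous (∑ i, s i) :=
    MvPolynomial.IsHomogeneous.prod _ _ _ fun i _ => by
      simpa using (MvPolynomial.isHomogeneous_C_mul_X ((-1 : ℚ) ^ (i.1 + 1)) i.rev.castSucc).pow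
        (s i)
  have h2 := (MvPolynomial.isHomogeneous_X_pow (R := ℚ) (Fin.last n) (d - s.degree)).mul h1
  have h3 : d - s.degree + ∑ i, s i = d := by
    rw [← Finsupp.degree_eq_sum]
    omega
  rwa [h3] at h2

lemma aeval_homogenizeEsymm {k : Type*} [Field k] [CharZero k] {n : ℕ} (P : MvPolynomial (Fin n) ℚ)
    {d : ℕ} (hd : P.totalDegree ≤ d) (v : Fin n → Fin 2 → k) (hv : ∀ i, v i 1 ≠ 0) :
    MvPolynomial.aeval (fun i : Fin (n + 1) => (formOf v).coeff i) (homogenizeEsymm P d) =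
      (∏ i, v i 1) ^ d * MvPolynomial.aeval (fun i => v i 0 / v i 1)
        (MvPolynomial.aeval (fun i : Fin n => MvPolynomial.esymm (Fin n) ℚ (i + 1)) P) := by
  rw [MvPolynomial.comp_aeval_apply, homogenizeEsymm, map_sum, MvPolynomial.aeval_def
    (p := P), MvPolynomial.eval₂_eq', Finset.mul_sum]
  refine Finset.sum_congr rfl fun s hs => ?_
  have hsd : s.degree ≤ d := (MvPolynomial.le_totalDegree hs).trans hd
  have h0 : (formOf v).coeff n = ∏ i, v i 1 := by
    simpa using coeff_formOf v hv (Nat.zero_le n)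
  have h1 : ∀ i : Fin n, (formOf v).coeff (i.rev.castSucc : Fin (n + 1)) = (∏ i, v i 1) *
      ((-1) ^ (i.1 + 1) * MvPolynomial.aeval (fun i => v i 0 / v i 1)
        (MvPolynomial.esymm (Fin n) ℚ (i + 1))) := by
    intro i
    have := coeff_formOf v hv (j := i.1 + 1) i.2
    rw [Fin.val_castSucc, Fin.val_rev, this, MvPolynomial.aeval_esymm_eq_multiset_esymm,
      MvPolynomial.aeval_esymm_eq_multiset_esymm]
  simp only [map_mul, map_pow, map_prod, MvPolynomial.aeval_X, MvPolynomial.aeval_C, Fin.val_last,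
    h0, h1, map_neg, map_one]
  have h2 : ∀ i : Fin n, (-1 : k) ^ (i.1 + 1) * ((∏ i, v i 1) *
      ((-1) ^ (i.1 + 1) * MvPolynomial.aeval (fun i => v i 0 / v i 1)
        (MvPolynomial.esymm (Fin n) ℚ (i + 1)))) = (∏ i, v i 1) *
        MvPolynomial.aeval (fun i => v i 0 / v i 1) (MvPolynomial.esymm (Fin n) ℚ (i + 1)) := by
    intro i
    have : (-1 : k) ^ (i.1 + 1) * (-1) ^ (i.1 + 1) = 1 := by
      rw [← mul_pow]; simp
    linear_combination ((∏ i, v i 1) *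
        MvPolynomial.aeval (fun i => v i 0 / v i 1) (MvPolynomial.esymm (Fin n) ℚ (i + 1))) * this
  simp only [h2, mul_pow, Finset.prod_mul_distrib, Finset.prod_pow_eq_pow_sum]
  rw [← Finsupp.degree_eq_sum]
  have h3 : (∏ i, v i 1) ^ (d - s.degree) * (∏ i, v i 1) ^ s.degree = (∏ i, v i 1) ^ d := by
    rw [← pow_add]
    congr 1
    omega
  rw [← h3]
  ring

/-- The sum over all labellings of the bracket monomial of a multigraph, for the points
`(Xᵢ : 1)`. -/
def symBracket {n : ℕ} (m : Fin n × Fin n → ℕ) : MvPolynomial (Fin n) ℚ :=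
  ∑ π : Equiv.Perm (Fin n), bracketProd m ((fun i => ![MvPolynomial.X i, 1]) ∘ π)

lemma aeval_symBracket {k : Type*} [Field k] [CharZero k] {n : ℕ} (m : Fin n × Fin n → ℕ)
    (x : Fin n → k) : MvPolynomial.aeval x (symBracket m) =
      ∑ π : Equiv.Perm (Fin n), bracketProd m ((fun i => ![x i, 1]) ∘ π) := by
  rw [symBracket, map_sum]
  refine Finset.sum_congr rfl fun π _ => ?_
  refine (bracketProd_map (MvPolynomial.aeval x : MvPolynomial (Fin n) ℚ →ₐ[ℚ] k).toRingHom
    m _).trans ?_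
  congr 1
  ext i j
  fin_cases j <;> simp

lemma isSymmetric_symBracket {n : ℕ} (m : Fin n × Fin n → ℕ) : (symBracket m).IsSymmetric := by
  intro e
  rw [symBracket, map_sum]
  refine Eq.trans (Finset.sum_congr rfl fun π _ => ?_) (Equiv.sum_comp (Equiv.mulLeft e)
    fun π => bracketProd m ((fun i => ![(MvPolynomial.X i : MvPolynomial (Fin n) ℚ), 1]) ∘ π))
  refine (bracketProd_map (MvPolynomial.rename e : MvPolynomial (Fin n) ℚ →ₐ[ℚ] _).toRingHom
    m _).trans ?_
  congr 1
  ext i j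
  fin_cases j <;> simp

lemma degreeOf_bracketProd_le {n : ℕ} (m : Fin n × Fin n → ℕ) (x : Fin n) :
    MvPolynomial.degreeOf x (bracketProd m fun i =>
      ![(MvPolynomial.X i : MvPolynomial (Fin n) ℚ), 1]) ≤ edgeDegree m x := by
  have hb : ∀ a b : Fin n, MvPolynomial.degreeOf x (bracket
      ![(MvPolynomial.X a : MvPolynomial (Fin n) ℚ), 1] ![MvPolynomial.X b, 1]) ≤
      (if x = a then 1 else 0) + (if x = b then 1 else 0) := by
    intro a b
    have h1 : bracket ![(MvPolynomial.X a : MvPolynomial (Fin n) ℚ), 1] ![MvPolynomial.X b, 1] =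
        MvPolynomial.X a + MvPolynomial.C (-1) * MvPolynomial.X b := by
      simp [bracket, sub_eq_add_neg]
    rw [h1]
    refine (MvPolynomial.degreeOf_add_le _ _ _).trans (max_le ?_ ?_)
    · rw [MvPolynomial.degreeOf_X]
      exact Nat.le_add_right _ _
    · refine (MvPolynomial.degreeOf_C_mul_le _ _ _).trans ?_
      rw [MvPolynomial.degreeOf_X]
      exact Nat.le_add_left _ _
  refine (MvPolynomial.degreeOf_prod_le _ _ _).trans ?_
  refine (Finset.sum_le_sum fun p _ => (MvPolynomial.degreeOf_pow_le _ _ _).trans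
    (Nat.mul_le_mul_left (m p) (hb p.1 p.2))).trans ?_
  simp only [mul_add, Finset.sum_add_distrib, edgeDegree]
  rw [Fintype.sum_prod_type, Fintype.sum_prod_type_right]
  simp

lemma degreeOf_symBracket_le {n : ℕ} (m : Fin n × Fin n → ℕ) {d : ℕ}
    (hm : ∀ x, edgeDegree m x = d) (x : Fin n) :
    MvPolynomial.degreeOf x (symBracket m) ≤ d := by
  refine (MvPolynomial.degreeOf_sum_le _ _ _).trans (Finset.sup_le fun π _ => ?_)
  rw [bracketProd_comp_perm]
  refine (degreeOf_bracketProd_le _ x).trans ?_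
  rw [← hm (π.symm x)]
  exact (Equiv.sum_comp π.symm fun j => m (π.symm x, j) + m (j, π.symm x)).le

/-- The sum over all labellings of the bracket monomial of a regular multigraph of degree `d` is a
polynomial, homogeneous of degree `d`, in the coefficients of the form. -/
lemma exists_homogeneous_symmetrized_bracket {n : ℕ} (hn : n ≠ 0) (m : Fin n × Fin n → ℕ) {d : ℕ}
    (hm : ∀ x, edgeDegree m x = d) : ∃ I : MvPolynomial (Fin (n + 1)) ℚ, I.IsHomogeneous d ∧
      ∀ {k : Type*} [Field k] [CharZero k] (v : Fin n → Fin 2 → k),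
        MvPolynomial.aeval (fun i : Fin (n + 1) => (formOf v).coeff i) I =
          ∑ π : Equiv.Perm (Fin n), bracketProd m (v ∘ π) := by
  obtain ⟨n, rfl⟩ := Nat.exists_eq_succ_of_ne_zero hn
  obtain ⟨P, hP⟩ := MvPolynomial.esymmAlgHom_surjective (σ := Fin (n + 1)) (n := n + 1) ℚ (by simp)
    ⟨symBracket m, isSymmetric_symBracket m⟩
  have hP' : MvPolynomial.aeval (fun i : Fin (n + 1) => MvPolynomial.esymm (Fin (n + 1)) ℚ (i + 1))
      P = symBracket m := by
    rw [← MvPolynomial.esymmAlgHom_apply, hP]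
  have hPd : P.totalDegree ≤ d := by
    apply totalDegree_le_of_degreeOf_esymm
    rw [hP']
    exact degreeOf_symBracket_le m hm 0
  refine ⟨homogenizeEsymm P d, isHomogeneous_homogenizeEsymm P hPd, ?_⟩
  intro k _ _ v
  have key : ∀ v : Fin (n + 1) → Fin 2 → k, (∀ i, v i 1 ≠ 0) →
      MvPolynomial.aeval (fun i : Fin (n + 1 + 1) => (formOf v).coeff i) (homogenizeEsymm P d) =
          ∑ π : Equiv.Perm (Fin (n + 1)), bracketProd m (v ∘ π) := by
    intro v hv
    rw [aeval_homogenizeEsymm P hPd v hv, hP', aeval_symBracket, Finset.mul_sum]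
    refine Finset.sum_congr rfl fun π _ => ?_
    have h1 : v ∘ π = fun i => v (π i) 1 • ((fun i => ![v i 0 / v i 1, 1]) ∘ π) i := by
      ext i j
      fin_cases j
      · simp [mul_div_cancel₀ _ (hv (π i))]
      · simp
    rw [h1, bracketProd_smul]
    simp only [hm, Finset.prod_pow]
    rw [Equiv.prod_comp π fun i => v i 1]
  -- the general case follows from the case where no root is at infinity by a deformation
  set w : Fin (n + 1) → Fin 2 → k[X] := fun i => ![C (v i 0), C (v i 1) + X] with hw
  have hwt : ∀ t : k, (fun i => (evalRingHom t) ∘ w i) = fun i => ![v i 0, v i 1 + t] := by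
    intro t
    ext i j
    fin_cases j <;> simp [hw]
  set Q : k[X] := MvPolynomial.aeval (fun i : Fin (n + 1 + 1) => (formOf w).coeff i)
    (homogenizeEsymm P d) - ∑ π : Equiv.Perm (Fin (n + 1)), bracketProd m (w ∘ π) with hQ
  have hQt : ∀ t : k, Q.eval t = MvPolynomial.aeval (fun i : Fin (n + 1 + 1) =>
      (formOf fun i => ![v i 0, v i 1 + t]).coeff i) (homogenizeEsymm P d) -
        ∑ π : Equiv.Perm (Fin (n + 1)), bracketProd m ((fun i => ![v i 0, v i 1 + t]) ∘ π) := by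
    intro t
    rw [← hwt t, ← formOf_map, hQ, eval_sub, eval_finsetSum]
    congr 1
    · simp only [coeff_map]
      have := MvPolynomial.comp_aeval_apply (f := fun i : Fin (n + 1 + 1) => (formOf w).coeff i)
        ((Polynomial.aeval t).restrictScalars ℚ : k[X] →ₐ[ℚ] k) (homogenizeEsymm P d)
      simpa using this
    · refine Finset.sum_congr rfl fun π _ => ?_
      exact bracketProd_map (evalRingHom t) m _
  have hQ0 : Q = 0 := by
    apply eq_zero_of_infinite_isRoot
    refine Set.Infinite.mono (s := (Set.range fun i => - v i 1)ᶜ) ?_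
      (Set.finite_range _).infinite_compl
    intro t ht
    rw [Set.mem_ofPred_eq, IsRoot.def, hQt, sub_eq_zero]
    apply key
    intro i hi
    exact ht ⟨i, by simp at hi; linear_combination -hi⟩
  have h0 := hQt 0
  have e0 : (fun i => ![v i 0, v i 1 + 0]) = v := by
    ext i j
    fin_cases j <;> simp
  rw [hQ0, eval_zero, e0] at h0
  exact (sub_eq_zero.mp h0.symm)

end Invariants

/-! ### Roots of forms, Galois conjugation and the field of moduli -/

section Moduli
variable {k : Type*} [Field k]

/-- The product over the roots of a linear substitution: the form with the roots `v`, evaluated at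
a pair of polynomials. -/
lemma sum_coeff_formOf {ι : Type*} [Fintype ι] (v : ι → Fin 2 → k) (P Q : k[X]) :
    ∑ i ∈ Finset.range (Fintype.card ι + 1), C ((formOf v).coeff i) * P ^ i *
      Q ^ (Fintype.card ι - i) = ∏ i, (C (v i 1) * P - C (v i 0) * Q) := by
  have h1 : ∀ (n : ℕ) (f : k[X]), MvPolynomial.eval₂ C ![P, Q] (f.homogenize n) =
      ∑ i ∈ Finset.range (n + 1), C (f.coeff i) * P ^ i * Q ^ (n - i) := by
    intro n f
    rw [homogenize, Finset.Nat.sum_antidiagonal_eq_sum_range_succ_mk, MvPolynomial.eval₂_sum]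
    refine Finset.sum_congr rfl fun i _ => ?_
    rw [MvPolynomial.eval₂_monomial, Finsupp.prod_fintype _ _ (by simp)]
    simp [Fin.prod_univ_two, mul_assoc]
  have h2 := homogenize_finsetProd (s := Finset.univ) (p := fun i => C (v i 1) * X - C (v i 0))
    (n := fun _ : ι => 1) (fun i _ => by compute_degree)
  rw [← h1]
  have h3 : ∑ i : ι, 1 = Fintype.card ι := by simp
  rw [h3] at h2
  rw [formOf, h2, ← MvPolynomial.coe_eval₂Hom, map_prod]
  refine Finset.prod_congr rfl fun i _ => ?_
  rw [MvPolynomial.coe_eval₂Hom, h1]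
  simp [Finset.sum_range_succ, coeff_X, coeff_C]
  ring

/-- A linear substitution in the product of the linear forms with roots `v` is the product of the
linear forms whose roots are the `v i` transformed by the adjugate matrix. -/
lemma sum_coeff_formOf_linear {ι : Type*} [Fintype ι] (A : Matrix (Fin 2) (Fin 2) k)
    (v : ι → Fin 2 → k) :
    ∑ i ∈ Finset.range (Fintype.card ι + 1), C ((formOf v).coeff i) *
      (C (A 0 0) * X + C (A 0 1)) ^ i * (C (A 1 0) * X + C (A 1 1)) ^ (Fintype.card ι - i) =
    formOf fun i => ![A 1 1 * v i 0 - A 0 1 * v i 1, A 0 0 * v i 1 - A 1 0 * v i 0] := by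
  rw [sum_coeff_formOf, formOf]
  refine Finset.prod_congr rfl fun i _ => ?_
  simp only [Matrix.cons_val_zero, Matrix.cons_val_one, C_sub, C_mul]
  ring

lemma formSubst_formOf {n : ℕ} (γ : Matrix.SpecialLinearGroup (Fin 2) k) (v : Fin n → Fin 2 → k) :
    HyperellipticCurve.formSubst n γ (formOf v) = formOf fun i =>
      ![γ.1 1 1 * v i 0 - γ.1 0 1 * v i 1, γ.1 0 0 * v i 1 - γ.1 1 0 * v i 0] := by
  have h := sum_coeff_formOf_linear γ.1 v
  rwa [Fintype.card_fin] at h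

/-- Over an algebraically closed field, every binary form is a product of linear forms. -/
lemma exists_eq_formOf [IsAlgClosed k] {n : ℕ} (hn : n ≠ 0) {f : k[X]} (hf : f.natDegree ≤ n) :
    ∃ v : Fin n → Fin 2 → k, f = formOf v := by
  have key : ∀ (n : ℕ) (f : k[X]), f.natDegree ≤ n →
      ∃ (c : k) (v : Fin n → Fin 2 → k), f = C c * formOf v := by
    intro n
    induction n with
    | zero =>
      intro f hf
      exact ⟨f.coeff 0, fun i => i.elim0, by
        rw [eq_C_of_natDegree_le_zero hf]; simp [formOf]⟩
    | succ n ih =>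
      intro f hf
      by_cases h : f.natDegree ≤ n
      · obtain ⟨c, v, hv⟩ := ih f h
        refine ⟨c, Fin.cons ![-1, 0] v, ?_⟩
        rw [hv, formOf, formOf, Fin.prod_univ_succ]
        simp
      · obtain ⟨r, hr⟩ := IsAlgClosed.exists_root f (by
          intro h0
          exact h (by rw [natDegree_eq_of_degree_eq_some h0]; exact Nat.zero_le n))
        obtain ⟨q, hq⟩ := dvd_iff_isRoot.mpr hr
        have hq0 : q ≠ 0 := by
          rintro rfl
          simp [hq] at h
        have hqd : q.natDegree ≤ n := by
          rw [hq, natDegree_mul (X_sub_C_ne_zero r) hq0, natDegree_X_sub_C] at hf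
          omega
        obtain ⟨c, v, hv⟩ := ih q hqd
        refine ⟨c, Fin.cons ![r, 1] v, ?_⟩
        rw [hq, hv, formOf, formOf, Fin.prod_univ_succ]
        simp
        ring
  obtain ⟨n, rfl⟩ := Nat.exists_eq_succ_of_ne_zero hn
  obtain ⟨c, v, hv⟩ := key _ f hf
  refine ⟨Fin.cons (c • v 0) fun i => v i.succ, ?_⟩
  rw [hv, formOf, formOf, Fin.prod_univ_succ, Fin.prod_univ_succ]
  simp
  ring

/-- The roots of a form whose dehomogenisation is squarefree of at least the right degree minus one
are distinct. -/
lemma bracket_ne_zero_of_squarefree {ι : Type*} [Fintype ι] {v : ι → Fin 2 → k}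
    (hs : Squarefree (formOf v)) (hd : Fintype.card ι ≤ (formOf v).natDegree + 1) {i j : ι}
    (hij : i ≠ j) : bracket (v i) (v j) ≠ 0 := by
  classical
  intro hb
  have h0 : ∀ i, v i ≠ 0 := by
    intro i hi
    apply hs.ne_zero
    exact Finset.prod_eq_zero (Finset.mem_univ i) (by simp [hi])
  obtain ⟨a, ha⟩ := (Projectivization.mk_eq_mk_iff' k _ _ (h0 i) (h0 j)).mp
    ((bracket_eq_zero_iff (h0 i) (h0 j)).mp hb)
  have hprod : formOf v = (C (v i 1) * X - C (v i 0)) * ((C (v j 1) * X - C (v j 0)) *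
      ∏ l ∈ (Finset.univ.erase i).erase j, (C (v l 1) * X - C (v l 0))) := by
    rw [formOf, ← Finset.mul_prod_erase _ _ (Finset.mem_univ i),
      ← Finset.mul_prod_erase (Finset.univ.erase i) _
        (Finset.mem_erase.mpr ⟨hij.symm, Finset.mem_univ j⟩)]
  by_cases hj : v j 1 = 0
  · have hi : v i 1 = 0 := by rw [← ha]; simp [hj]
    have hcard : ((Finset.univ.erase i).erase j).card = Fintype.card ι - 2 := by
      rw [Finset.card_erase_of_mem (Finset.mem_erase.mpr ⟨hij.symm, Finset.mem_univ j⟩),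
        Finset.card_erase_of_mem (Finset.mem_univ i), Finset.card_univ]
      omega
    have h2 : 2 ≤ Fintype.card ι := by
      have := Fintype.one_lt_card_iff.mpr ⟨i, j, hij⟩
      omega
    have h3 : (formOf v).natDegree ≤ Fintype.card ι - 2 := by
      rw [hprod, hi, hj, ← hcard]
      simp only [map_zero, zero_mul, zero_sub, ← C_neg, ← mul_assoc, ← C_mul]
      refine (natDegree_C_mul_le _ _).trans ((natDegree_prod_le _ _).trans ?_)
      refine (Finset.sum_le_card_nsmul _ _ 1 fun i _ => ?_).trans (by simp)
      compute_degree
    omega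
  · have hunit : IsUnit (C (v j 1) * X - C (v j 0)) := by
      apply hs
      refine ⟨C a * ∏ l ∈ (Finset.univ.erase i).erase j, (C (v l 1) * X - C (v l 0)), ?_⟩
      rw [hprod, ← ha]
      simp only [Pi.smul_apply, smul_eq_mul, C_mul]
      ring
    have h1 := natDegree_eq_zero_of_isUnit hunit
    rw [sub_eq_add_neg, ← C_neg, natDegree_linear hj] at h1
    exact one_ne_zero h1

lemma isFormInvariant_of_bracket [IsAlgClosed k] [CharZero k] {n : ℕ} (hn : n ≠ 0)
    (m : Fin n × Fin n → ℕ) {I : MvPolynomial (Fin (n + 1)) ℚ}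
    (hI : ∀ v : Fin n → Fin 2 → k,
        MvPolynomial.aeval (fun i : Fin (n + 1) => (formOf v).coeff i) I =
          ∑ π : Equiv.Perm (Fin n), bracketProd m (v ∘ π)) :
    HyperellipticCurve.IsFormInvariant k n I := by
  intro γ f hf
  obtain ⟨v, rfl⟩ := exists_eq_formOf hn hf
  rw [formSubst_formOf, HyperellipticCurve.evalForm, HyperellipticCurve.evalForm, hI, hI]
  refine Finset.sum_congr rfl fun π _ => ?_
  refine Finset.prod_congr rfl fun p _ => ?_
  congr 1
  have hdet := γ.2
  rw [Matrix.det_fin_two] at hdet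
  simp only [bracket, Function.comp_apply, Matrix.cons_val_zero, Matrix.cons_val_one]
  linear_combination (v (π p.1) 0 * v (π p.2) 1 - v (π p.1) 1 * v (π p.2) 0) * hdet

/-- Distinct characters being linearly independent, the characters of a finite family can be
recovered from its sum. -/
lemma exists_eq_of_sum_monoidHom_eq [CharZero k] {G P Q : Type*} [Monoid G] [Fintype P] [Fintype Q]
    (χ : P → G →* k) (ψ : Q → G →* k) (h : ∀ r, ∑ p, χ p r = ∑ q, ψ q r) (p : P) :
    ∃ q, ψ q = χ p := by
  classical
  have hli := linearIndependent_monoidHom G k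
  rw [LinearIndependent] at hli
  have h1 : (∑ p, Finsupp.single (χ p) (1 : k)) = ∑ q, Finsupp.single (ψ q) (1 : k) := by
    apply hli
    rw [map_sum, map_sum]
    ext r
    simpa [Finset.sum_apply] using h r
  have h2 := DFunLike.congr_fun h1 (χ p)
  rw [Finsupp.finsetSum_apply, Finsupp.finsetSum_apply] at h2
  simp only [Finsupp.single_apply, Finset.sum_boole] at h2
  rw [Nat.cast_inj] at h2
  have h3 : 0 < (Finset.univ.filter fun q => ψ q = χ p).card := by
    rw [← h2]
    exact Finset.card_pos.mpr ⟨p, by simp⟩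
  obtain ⟨q, hq⟩ := Finset.card_pos.mp h3
  exact ⟨q, (Finset.mem_filter.mp hq).2⟩

/-- The action of a field automorphism on the projective line, coordinate by coordinate. -/
def galPerm (σ : k ≃+* k) : Equiv.Perm (ProjLine k) where
  toFun := Projectivization.map (σ := (σ : k →+* k))
    { toFun := fun v : Fin 2 → k => σ ∘ v
      map_add' := fun v w => by ext; simp
      map_smul' := fun c v => funext fun i => map_mul σ c (v i) }
    (fun v w h => funext fun i => σ.injective (congrFun h i))
  invFun := Projectivization.map (σ := (σ.symm : k →+* k))
    { toFun := fun v : Fin 2 → k => σ.symm ∘ v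
      map_add' := fun v w => by ext; simp
      map_smul' := fun c v => funext fun i => map_mul σ.symm c (v i) }
    (fun v w h => funext fun i => σ.symm.injective (congrFun h i))
  left_inv x := by
    induction x using Projectivization.ind with
    | h v hv =>
      have h : σ.symm ∘ σ ∘ v = v := by ext i; simp
      exact congrArg (Projectivization.mk' k) (Subtype.ext h)
  right_inv x := by
    induction x using Projectivization.ind with
    | h v hv =>
      have h : σ ∘ σ.symm ∘ v = v := by ext i; simp
      exact congrArg (Projectivization.mk' k) (Subtype.ext h)

lemma comp_ne_zero (σ : k ≃+* k) {v : Fin 2 → k} (hv : v ≠ 0) : σ ∘ v ≠ 0 := by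
  intro h
  apply hv
  ext i
  have := congrFun h i
  simpa using this

lemma galPerm_mk (σ : k ≃+* k) (v : Fin 2 → k) (hv : v ≠ 0) :
    galPerm σ (Projectivization.mk k v hv) = Projectivization.mk k (σ ∘ v) (comp_ne_zero σ hv) :=
  rfl

lemma galPerm_gl_smul (σ : k ≃+* k) (g : GL (Fin 2) k) (x : ProjLine k) :
    galPerm σ (g • x) = (Matrix.GeneralLinearGroup.map (σ : k →+* k) g) • galPerm σ x := by
  induction x using Projectivization.ind with
  | h v hv =>
    rw [Projectivization.smul_mk, galPerm_mk, galPerm_mk, Projectivization.smul_mk]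
    congr 1
    ext i
    fin_cases i <;> simp

lemma crossChar_galPerm {ι : Type*} [Fintype ι] [DecidableEq ι] (σ : k ≃+* k) (ℓ : ι → ProjLine k)
    (r : Multiplicative (RegularGraphs ι)) :
    crossChar (fun i => galPerm σ (ℓ i)) r = σ (crossChar ℓ r) := by
  rw [crossChar_eq_of_smul_rep (v := fun i => σ ∘ (ℓ i).rep)
    (fun i => comp_ne_zero σ (ℓ i).rep_nonzero), crossChar]
  · exact crossHom_map (σ : k →+* k) _ r
  · intro i
    conv_rhs => rw [← (ℓ i).mk_rep]
    rfl

end Moduli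
end HyperellipticModuli

namespace HyperellipticCurve
open HyperellipticModuli
variable {k : Type*} [Field k] {g : ℕ}

lemma natDegree_le (C : HyperellipticCurve k g) : C.F.natDegree ≤ 2 * g + 2 := by
  have := C.natDegree_eq
  omega

/-- The form of degree `2g + 2` of a hyperelliptic curve has `2g + 2` distinct roots. -/
lemma exists_formOf [IsAlgClosed k] (C : HyperellipticCurve k g) :
    ∃ v : Fin (2 * g + 2) → Fin 2 → k, C.F = formOf v ∧
      ∀ i j, i ≠ j → bracket (v i) (v j) ≠ 0 := by
  obtain ⟨v, hv⟩ := exists_eq_formOf (n := 2 * g + 2) (by omega) C.natDegree_le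
  refine ⟨v, hv, fun i j hij => bracket_ne_zero_of_squarefree ?_ ?_ hij⟩
  · rw [← hv]
    exact C.separable.squarefree
  · rw [← hv, Fintype.card_fin]
    have := C.natDegree_eq
    omega

/-- The symmetrised characters of the branch points take their values in the field of moduli. -/
lemma sum_crossHom_mem_moduliField [IsAlgClosed k] [CharZero k] (C : HyperellipticCurve k g)
    {v : Fin (2 * g + 2) → Fin 2 → k} (hF : C.F = formOf v)
    (hv : ∀ i j, i ≠ j → bracket (v i) (v j) ≠ 0)
    (r : Multiplicative (RegularGraphs (Fin (2 * g + 2)))) :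
    ∑ π : Equiv.Perm (Fin (2 * g + 2)), crossHom (v ∘ π) r ∈ C.moduliField := by
  have hn : 2 * g + 2 ≠ 0 := by omega
  obtain ⟨I, hI, hI'⟩ := exists_homogeneous_symmetrized_bracket hn r.toAdd.1.1 r.toAdd.2
  set e := r.toAdd.1.2 with he
  have hJe : ∀ x, edgeDegree (e • completeEdges (Fin (2 * g + 2))) x =
      e * (2 * (Fintype.card (Fin (2 * g + 2)) - 1)) := by
    intro x
    rw [← edgeDegree_completeEdges x]
    simp only [edgeDegree, Pi.smul_apply, smul_eq_mul, ← mul_add, ← Finset.mul_sum]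
  obtain ⟨J, hJ, hJ'⟩ := exists_homogeneous_symmetrized_bracket hn _ hJe
  have hΔ := bracketProd_completeEdges_ne_zero hv
  have hJF : evalForm (2 * g + 2) J C.F = Fintype.card (Equiv.Perm (Fin (2 * g + 2))) *
      bracketProd (completeEdges (Fin (2 * g + 2))) v ^ e := by
    rw [evalForm, hF, hJ']
    have : ∀ π : Equiv.Perm (Fin (2 * g + 2)), bracketProd
        (e • completeEdges (Fin (2 * g + 2))) (v ∘ π) =
          bracketProd (completeEdges (Fin (2 * g + 2))) v ^ e := by
      intro π
      rw [← bracketProd_completeEdges_perm π v]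
      simp only [bracketProd, Pi.smul_apply, smul_eq_mul, ← Finset.prod_pow, ← pow_mul, mul_comm e]
    rw [Finset.sum_congr rfl fun π _ => this π, Finset.sum_const, Finset.card_univ, nsmul_eq_mul]
  have hcard : (Fintype.card (Equiv.Perm (Fin (2 * g + 2))) : k) ≠ 0 :=
    Nat.cast_ne_zero.mpr Fintype.card_ne_zero
  have hIF : evalForm (2 * g + 2) I C.F =
      ∑ π : Equiv.Perm (Fin (2 * g + 2)), bracketProd r.toAdd.1.1 (v ∘ π) := by
    rw [evalForm, hF, hI']
  have hmem : evalForm (2 * g + 2) I C.F / evalForm (2 * g + 2) J C.F ∈ C.moduliField :=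
    Subfield.subset_closure ⟨_, I, J, hI, hJ,
      isFormInvariant_of_bracket hn _ fun v => hI' v,
      isFormInvariant_of_bracket hn _ fun v => hJ' v,
      by rw [hJF]; exact mul_ne_zero hcard (pow_ne_zero _ hΔ), rfl⟩
  have hsum : ∑ π : Equiv.Perm (Fin (2 * g + 2)), crossHom (v ∘ π) r =
      Fintype.card (Equiv.Perm (Fin (2 * g + 2))) *
        (evalForm (2 * g + 2) I C.F / evalForm (2 * g + 2) J C.F) := by
    rw [hIF, hJF]
    simp only [crossHom_apply, bracketProd_completeEdges_perm, ← he]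
    rw [← Finset.sum_div]
    field_simp
  rw [hsum]
  exact mul_mem (natCast_mem _ _) hmem

/-- The field of moduli determines the branch points up to `GL₂`: if the moduli point is rational
over `L`, the conjugates over `L` of the set of branch points are equivalent to it. -/
lemma exists_gl_galPerm_eq [IsAlgClosed k] [CharZero k] {L : Subfield k}
    (C : HyperellipticCurve k g) (hL : C.ModuliPointRational L)
    {v : Fin (2 * g + 2) → Fin 2 → k} (hF : C.F = formOf v)
    (hv : ∀ i j, i ≠ j → bracket (v i) (v j) ≠ 0) {ℓ : Fin (2 * g + 2) → ProjLine k}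
    (h0 : ∀ i, v i ≠ 0) (hℓ : ∀ i, ℓ i = Projectivization.mk k (v i) (h0 i)) (σ : k ≃ₐ[L] k) :
    ∃ (γ : GL (Fin 2) k) (π : Equiv.Perm (Fin (2 * g + 2))),
      ∀ i, γ • galPerm (σ : k ≃+* k) (ℓ i) = ℓ (π i) := by
  have hinj : Function.Injective ℓ := by
    intro i j hij
    by_contra h
    rw [hℓ, hℓ, ← bracket_eq_zero_iff] at hij
    exact hv i j h hij
  have hcross : ∀ π : Equiv.Perm (Fin (2 * g + 2)), crossChar (ℓ ∘ π) = crossHom (v ∘ π) :=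
    fun π => crossChar_eq_of_smul_rep (v := v ∘ π) (fun i => h0 (π i)) fun i => (hℓ (π i)).symm
  have hsum : ∀ r, ∑ π : Equiv.Perm (Fin (2 * g + 2)), crossChar (ℓ ∘ π) r ∈ L := by
    intro r
    simp only [hcross]
    exact hL (C.sum_crossHom_mem_moduliField hF hv r)
  obtain ⟨π, hπ⟩ := exists_eq_of_sum_monoidHom_eq
    (fun π : Equiv.Perm (Fin (2 * g + 2)) => crossChar fun i => galPerm (σ : k ≃+* k) ((ℓ ∘ π) i))
    (fun π : Equiv.Perm (Fin (2 * g + 2)) => crossChar (ℓ ∘ π)) (by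
      intro r
      simp only [crossChar_galPerm]
      rw [← map_sum]
      exact σ.commutes ⟨_, hsum r⟩) 1
  have := C.two_le_genus
  obtain ⟨γ, hγ⟩ := exists_gl_of_crossChar_eq (by rw [Fintype.card_fin]; omega)
    ((galPerm (σ : k ≃+* k)).injective.comp hinj) (hinj.comp π.injective) hπ.symm
  exact ⟨γ, π, hγ⟩

end HyperellipticCurve

namespace HyperellipticModuli

/-! ### Automorphisms of an algebraically closed field -/

section Fixed
variable {k : Type*} [Field k] [IsAlgClosed k]

/-- An automorphism of the polynomial ring generated by a transcendence basis extends to `k`. -/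
lemma exists_ringEquiv_extend {E : Type*} [Field E] [Algebra E k] {ι : Type*} {v : ι → k}
    (hv : IsTranscendenceBasis E v) (A : MvPolynomial ι E ≃+* MvPolynomial ι E) :
    ∃ σ : k ≃+* k, ∀ p, σ (MvPolynomial.aeval v p) = MvPolynomial.aeval v (A p) := by
  let _ := IsAlgClosed.isAlgClosure_of_transcendence_basis v hv
  let e : Algebra.adjoin E (Set.range v) ≃+* Algebra.adjoin E (Set.range v) :=
    (hv.1.aevalEquiv.symm.toRingEquiv.trans A).trans hv.1.aevalEquiv.toRingEquiv
  refine ⟨IsAlgClosure.equivOfEquiv k k e, fun p => ?_⟩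
  have h1 := IsAlgClosure.equivOfEquiv_algebraMap k k e (hv.1.aevalEquiv p)
  have h2 : e (hv.1.aevalEquiv p) = hv.1.aevalEquiv (A p) := by simp [e]
  rw [h2] at h1
  exact h1

/-- The field fixed by all automorphisms of `k` over the subfield `L` is `L`. -/
lemma mem_of_forall_algEquiv_eq [CharZero k] (L : Subfield k) (x : k)
    (hx : ∀ σ : k ≃ₐ[L] k, σ x = x) : x ∈ L := by
  -- An algebraic `x` outside `L` is moved by an automorphism of the algebraic closure of `L` in
  -- `k`, which extends to `k`. A transcendental `x` is moved by an extension of `x ↦ x + 1`.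
  by_cases halg : IsAlgebraic L x
  · let E := algebraicClosure L k
    have hxE : x ∈ E := mem_algebraicClosure_iff.mpr halg
    have hfix : (⟨x, hxE⟩ : E) ∈ (⊥ : IntermediateField L E) := by
      rw [InfiniteGalois.mem_bot_iff_fixed]
      intro τ
      obtain ⟨s, hs⟩ := exists_isTranscendenceBasis E k
      obtain ⟨σ, hσ⟩ := exists_ringEquiv_extend hs (MvPolynomial.mapEquiv s τ.toRingEquiv)
      have h1 : ∀ a : E, σ a = τ a := by
        intro a
        have := hσ (MvPolynomial.C a)
        simpa using this
      have h2 := hx (AlgEquiv.ofRingEquiv (f := σ) fun a => by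
        have := h1 (algebraMap L E a)
        rw [τ.commutes] at this
        exact this)
      apply Subtype.ext
      rw [← h1]
      exact h2
    obtain ⟨y, hy⟩ := IntermediateField.mem_bot.mp hfix
    have hyx : (y : k) = x := congrArg Subtype.val hy
    rw [← hyx]
    exact y.2
  · exfalso
    obtain ⟨s, hxs, hs⟩ := exists_isTranscendenceBasis_superset (R := L) (A := k) (s := {x})
      (algebraicIndependent_unique_type_iff.mpr halg)
    obtain ⟨σ, hσ⟩ := exists_ringEquiv_extend hs (AlgEquiv.ofAlgHom
      (MvPolynomial.aeval fun i : s => MvPolynomial.X i + 1)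
      (MvPolynomial.aeval fun i : s => MvPolynomial.X i - 1)
      (by ext; simp) (by ext; simp) : MvPolynomial s L ≃ₐ[L] MvPolynomial s L).toRingEquiv
    have h2 := hx (AlgEquiv.ofRingEquiv (f := σ) fun a => by
      have := hσ (MvPolynomial.C a)
      simpa using this)
    have h3 := hσ (MvPolynomial.X ⟨x, hxs rfl⟩)
    simp at h3
    have h4 : σ x = x := h2
    rw [h4] at h3
    simp at h3

end Fixed

/-! ### Finite groups of projective transformations -/

section Mob
variable {k : Type*} [Field k]

variable (k) in
/-- The action of `GL₂` on the projective line, by permutations. -/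
def mob : GL (Fin 2) k →* Equiv.Perm (ProjLine k) := MulAction.toPermHom _ _

lemma mob_mk (g : GL (Fin 2) k) (v : Fin 2 → k) (hv : v ≠ 0) :
    mob k g (Projectivization.mk k v hv) =
      Projectivization.mk k (g • v) ((smul_ne_zero_iff_ne g).mpr hv) := rfl

lemma gl_smul_eq_mulVec (g : GL (Fin 2) k) (v : Fin 2 → k) : g • v = g.1.mulVec v := rfl

lemma mob_eq_of_smul {g g' : GL (Fin 2) k} {c : k} (h : ∀ v : Fin 2 → k, g • v = c • g' • v) :
    mob k g = mob k g' := by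
  ext x
  induction x using Projectivization.ind with
  | h v hv =>
    rw [mob_mk, mob_mk, Projectivization.mk_eq_mk_iff']
    exact ⟨c, (h v).symm⟩

/-- A projective transformation with three fixed points is the identity. -/
lemma mob_eq_one_of_triple {g : GL (Fin 2) k} {x y z : ProjLine k} (hxy : x ≠ y) (hyz : z ≠ y)
    (hxz : x ≠ z) (hx : mob k g x = x) (hy : mob k g y = y) (hz : mob k g z = z) :
    mob k g = 1 := by
  obtain ⟨c, -, hc⟩ := gl_smul_eq_self_of_triple hxy hyz hxz hx hy hz
  rw [← map_one (mob k)]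
  exact mob_eq_of_smul (c := c) fun v => by rw [hc, one_smul]

lemma mob_eq_one_iff {g : GL (Fin 2) k} :
    mob k g = 1 ↔ ∃ c : k, c ≠ 0 ∧ ∀ v : Fin 2 → k, g • v = c • v := by
  constructor
  · intro h
    have hne : ∀ v w : Fin 2 → k, bracket v w ≠ 0 → ∀ hv hw, Projectivization.mk k v hv ≠
        Projectivization.mk k w hw := fun v w h hv hw h' => h ((bracket_eq_zero_iff hv hw).mpr h')
    have hfix : ∀ x : ProjLine k, g • x = x := fun x => DFunLike.congr_fun h x
    exact gl_smul_eq_self_of_triple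
      (x := Projectivization.mk k ![1, 0] (by simp)) (y := Projectivization.mk k ![0, 1] (by simp))
      (z := Projectivization.mk k ![1, 1] (by simp)) (hne _ _ (by simp [bracket]) _ _)
      (hne _ _ (by simp [bracket]) _ _) (hne _ _ (by simp [bracket]) _ _)
      (hfix _) (hfix _) (hfix _)
  · rintro ⟨c, -, hc⟩
    rw [← map_one (mob k)]
    exact mob_eq_of_smul (c := c) fun v => by rw [hc, one_smul]

lemma mob_eq_mob_iff {g g' : GL (Fin 2) k} :
    mob k g = mob k g' ↔ ∃ c : k, c ≠ 0 ∧ g.1 = c • g'.1 := by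
  constructor
  · intro h
    have h1 : mob k (g'⁻¹ * g) = 1 := by rw [map_mul, map_inv, h, inv_mul_cancel]
    obtain ⟨c, hc0, hc⟩ := mob_eq_one_iff.mp h1
    refine ⟨c, hc0, ?_⟩
    apply Matrix.toLin'.injective
    ext1 v
    apply LinearMap.ext
    intro a
    have h2 := congrArg (fun z => g' • z) (hc (Pi.single v a))
    simp only [mul_smul, smul_inv_smul] at h2
    rw [smul_comm, gl_smul_eq_mulVec, gl_smul_eq_mulVec] at h2
    simpa [Matrix.smul_mulVec] using h2
  · rintro ⟨c, -, hc⟩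
    refine mob_eq_of_smul (c := c) fun v => ?_
    rw [gl_smul_eq_mulVec, hc, Matrix.smul_mulVec]
    rfl

lemma exists_bracket_ne_zero {e : Fin 2 → k} (he : e ≠ 0) : ∃ w : Fin 2 → k, bracket e w ≠ 0 := by
  by_cases h : e 0 = 0
  · refine ⟨![1, 0], ?_⟩
    have : e 1 ≠ 0 := fun h1 => he (by ext i; fin_cases i <;> simp [h, h1])
    simpa [bracket, h] using this
  · exact ⟨![0, 1], by simpa [bracket] using h⟩

lemma exists_smul_rep_of_fixed {g : GL (Fin 2) k} {x : ProjLine k} (h : mob k g x = x) :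
    ∃ a : k, g • x.rep = a • x.rep := by
  rw [← x.mk_rep, mob_mk, Projectivization.mk_eq_mk_iff'] at h
  obtain ⟨a, ha⟩ := h
  exact ⟨a, ha.symm⟩

lemma mob_fixed_of_smul {g : GL (Fin 2) k} {v : Fin 2 → k} {a : k} (hv : v ≠ 0)
    (h : g • v = a • v) : mob k g (Projectivization.mk k v hv) = Projectivization.mk k v hv := by
  rw [mob_mk, Projectivization.mk_eq_mk_iff']
  exact ⟨a, h.symm⟩

/-- A projective transformation of finite order, not the identity, has exactly two fixed points:
a matrix with a scalar power is diagonalisable in characteristic zero. -/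
lemma exists_two_fixed [IsAlgClosed k] [CharZero k] {g : GL (Fin 2) k} {n : ℕ} (hn : n ≠ 0)
    (hg : mob k g ^ n = 1) (h1 : mob k g ≠ 1) :
    ∃ x y : ProjLine k, x ≠ y ∧ ∀ z, mob k g z = z ↔ z = x ∨ z = y := by
  suffices h : ∃ x y : ProjLine k, x ≠ y ∧ mob k g x = x ∧ mob k g y = y by
    obtain ⟨x, y, hxy, hx, hy⟩ := h
    refine ⟨x, y, hxy, fun z => ⟨fun hz => ?_, ?_⟩⟩
    · by_contra! hne
      exact h1 (mob_eq_one_of_triple hxy hne.2 hne.1.symm hx hy hz)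
    · rintro (rfl | rfl) <;> assumption
  obtain ⟨a, ha⟩ := Module.End.exists_eigenvalue (Matrix.toLin' g.1)
  obtain ⟨e, he⟩ := ha.exists_hasEigenvector
  have hea : g • e = a • e := by
    have := he.apply_eq_smul
    simpa [gl_smul_eq_mulVec] using this
  have he0 := he.2
  have ha0 : a ≠ 0 := by
    rintro rfl
    rw [zero_smul] at hea
    exact he0 ((smul_eq_zero_iff_eq g).mp hea)
  obtain ⟨w, hw⟩ := exists_bracket_ne_zero he0
  obtain ⟨c, b, hcb⟩ : ∃ c b : k, g • w = c • e + b • w := ⟨_, _, eq_combination hw (g • w)⟩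
  by_cases hab : b = a
  · exfalso
    subst hab
    have hpow : ∀ j : ℕ, g ^ j • w = (j * b ^ (j - 1) * c) • e + b ^ j • w := by
      intro j
      induction j with
      | zero => simp
      | succ j ih =>
        rw [pow_succ', mul_smul, ih, smul_add, smul_comm g, smul_comm g, hea, hcb, smul_add,
          smul_smul, smul_smul, smul_smul, ← add_assoc, ← add_smul]
        rcases j with _ | j
        · simp
        · congr 2
          · simp only [Nat.add_sub_cancel]
            push_cast
            ring
          · ring
    rw [← map_pow] at hg
    obtain ⟨d, -, hd⟩ := mob_eq_one_iff.mp hg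
    have h2 := congrArg (fun v => bracket v w) ((hpow n).symm.trans (hd w))
    have h3 : (n * b ^ (n - 1) * c) * bracket e w = 0 := by
      refine Eq.trans ?_ (h2.trans ?_) <;> simp [bracket] <;> ring
    have hc : c = 0 := by
      have := (mul_eq_zero.mp h3).resolve_right hw
      exact (mul_eq_zero.mp this).resolve_left
        (mul_ne_zero (Nat.cast_ne_zero.mpr hn) (pow_ne_zero _ ha0))
    apply h1
    rw [mob_eq_one_iff]
    refine ⟨b, ha0, fun v => ?_⟩
    conv_lhs => rw [eq_combination hw v]
    conv_rhs => rw [eq_combination hw v]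
    rw [smul_add, smul_comm g, smul_comm g, hea, hcb, hc, zero_smul, zero_add, smul_add,
      smul_comm b, smul_comm b]
  · have hba : b - a ≠ 0 := sub_ne_zero.mpr hab
    set w' : Fin 2 → k := (c / (b - a)) • e + w with hw'
    have hbr : bracket e w' = bracket e w := by simp [hw', bracket]; ring
    have hw'0 : w' ≠ 0 := by
      intro h
      rw [h] at hbr
      exact hw (by rw [← hbr]; simp [bracket])
    have hgw' : g • w' = b • w' := by
      rw [hw', smul_add, smul_comm g, hea, hcb, smul_add, smul_smul, smul_smul, ← add_assoc,
        ← add_smul]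
      congr 2
      field_simp
      ring
    refine ⟨_, _, ?_, mob_fixed_of_smul he0 hea, mob_fixed_of_smul hw'0 hgw'⟩
    rw [Ne, ← bracket_eq_zero_iff he0 hw'0, hbr]
    exact hw

/-- An involution of the projective line is determined by its two fixed points. -/
lemma mob_involution_unique {g h : GL (Fin 2) k} (hg : mob k g ^ 2 = 1) (hg1 : mob k g ≠ 1)
    (hh : mob k h ^ 2 = 1) (hh1 : mob k h ≠ 1) {x y : ProjLine k} (hxy : x ≠ y)
    (hgx : mob k g x = x) (hgy : mob k g y = y) (hhx : mob k h x = x) (hhy : mob k h y = y) :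
    mob k g = mob k h := by
  have hw := rep_bracket_ne_zero hxy
  have key : ∀ g : GL (Fin 2) k, mob k g ^ 2 = 1 → mob k g ≠ 1 → mob k g x = x → mob k g y = y →
      ∃ a : k, a ≠ 0 ∧ g • x.rep = a • x.rep ∧ g • y.rep = (-a) • y.rep := by
    intro g hg hg1 hgx hgy
    obtain ⟨a, ha⟩ := exists_smul_rep_of_fixed hgx
    obtain ⟨b, hb⟩ := exists_smul_rep_of_fixed hgy
    have ha0 : a ≠ 0 := by
      rintro rfl
      rw [zero_smul] at ha
      exact x.rep_nonzero ((smul_eq_zero_iff_eq g).mp ha)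
    refine ⟨a, ha0, ha, ?_⟩
    rw [← map_pow] at hg
    obtain ⟨d, -, hd⟩ := mob_eq_one_iff.mp hg
    have h1 : (a ^ 2) • x.rep = d • x.rep := by
      rw [← hd, pow_two g, mul_smul, ha, smul_comm, ha, smul_smul, pow_two a]
    have h2 : (b ^ 2) • y.rep = d • y.rep := by
      rw [← hd, pow_two g, mul_smul, hb, smul_comm, hb, smul_smul, pow_two b]
    have h3 := smul_left_injective k x.rep_nonzero h1
    have h4 := smul_left_injective k y.rep_nonzero h2
    rcases sq_eq_sq_iff_eq_or_eq_neg.mp (h4.trans h3.symm) with h5 | h5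
    · exfalso
      apply hg1
      rw [mob_eq_one_iff]
      refine ⟨a, ha0, fun v => ?_⟩
      rw [eq_combination hw v, smul_add, smul_comm g, smul_comm g, ha, hb, h5, smul_add,
        smul_comm a, smul_comm a]
    · rw [hb, h5]
  obtain ⟨a, ha0, hax, hay⟩ := key g hg hg1 hgx hgy
  obtain ⟨b, hb0, hbx, hby⟩ := key h hh hh1 hhx hhy
  refine mob_eq_of_smul (c := a / b) fun v => ?_
  rw [eq_combination hw v, smul_add, smul_comm g, smul_comm g, hax, hay, smul_add,
    smul_comm h, smul_comm h, hbx, hby, smul_add, smul_smul, smul_smul, smul_smul, smul_smul,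
    smul_smul, smul_smul]
  congr 2 <;> field_simp

lemma galPerm_mul_mob (σ : k ≃+* k) (g : GL (Fin 2) k) :
    galPerm σ * mob k g = mob k (Matrix.GeneralLinearGroup.map (σ : k →+* k) g) * galPerm σ := by
  ext x
  exact galPerm_gl_smul σ g x

end Mob

/-! ### Counting orbits -/

section Burnside

/-- A family of three natural numbers which are not all equal takes some value only once. -/
lemma exists_unique_value_of_card_three {Ω : Type*} [Fintype Ω] (hΩ : Fintype.card Ω = 3)
    (f : Ω → ℕ) : (∃ a, ∀ b, f b = f a → b = a) ∨ ∀ a b, f a = f b := by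
  let e := (Fintype.equivFinOfCardEq hΩ).symm
  have h1 : (∃ a : Fin 3, ∀ b, f (e b) = f (e a) → b = a) ∨ ∀ a b : Fin 3, f (e a) = f (e b) := by
    by_cases h01 : f (e 0) = f (e 1)
    · by_cases h02 : f (e 0) = f (e 2)
      · right
        intro a b
        fin_cases a <;> fin_cases b <;> simp_all
      · left
        refine ⟨2, fun b hb => ?_⟩
        fin_cases b <;> simp_all
    · by_cases h02 : f (e 0) = f (e 2)
      · left
        refine ⟨1, fun b hb => ?_⟩
        fin_cases b <;> simp_all
      · left
        refine ⟨0, fun b hb => ?_⟩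
        fin_cases b <;> simp_all
  rcases h1 with ⟨a, ha⟩ | h
  · left
    refine ⟨e a, fun b hb => ?_⟩
    have := ha (e.symm b) (by simpa using hb)
    rw [← this, Equiv.apply_symm_apply]
  · right
    intro a b
    simpa using h (e.symm a) (e.symm b)

/-- A finite permutation group, not fixing two points, in which every element except the identity
has two fixed points: Burnside's lemma shows that there are three orbits of points with non-trivial
stabilisers. Either one of them is distinguished by its cardinality, or the group has
order four. -/
lemma exists_unique_orbit_or_card_eq_four {α : Type*} (H : Subgroup (Equiv.Perm α)) [Finite H]
    (hH : H ≠ ⊥) (h2 : ∀ h ∈ H, h ≠ 1 → ∃ x y, x ≠ y ∧ ∀ z, h z = z ↔ z = x ∨ z = y)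
    (hfix : ∀ x y, (∀ h ∈ H, h x = x) → (∀ h ∈ H, h y = y) → x = y) :
    (∃ x, (∃ h ∈ H, h ≠ 1 ∧ h x = x) ∧ ∀ y, (∃ h ∈ H, h ≠ 1 ∧ h y = y) →
      (MulAction.orbit H y).ncard = (MulAction.orbit H x).ncard → y ∈ MulAction.orbit H x) ∨
    Nat.card H = 4 := by
  classical
  let N : SubMulAction H α :=
    { carrier := {x | ∃ h ∈ H, h ≠ 1 ∧ h x = x}
      smul_mem' := by
        rintro c x ⟨h, hh, h1, hx⟩
        refine ⟨c.1 * h * c.1⁻¹, H.mul_mem (H.mul_mem c.2 hh) (H.inv_mem c.2), ?_, ?_⟩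
        · rw [Ne, conj_eq_one_iff]
          exact h1
        · change c.1 (h (c.1⁻¹ (c.1 x))) = c.1 x
          simp [hx] }
  have hNfin : Set.Finite (N : Set α) := by
    have : (N : Set α) = ⋃ h : H, {x | h.1 ≠ 1 ∧ h.1 x = x} := by
      ext x
      simp only [Set.mem_iUnion]
      constructor
      · rintro ⟨h, hh, h1, hx⟩
        exact ⟨⟨h, hh⟩, h1, hx⟩
      · rintro ⟨h, h1, hx⟩
        exact ⟨h.1, h.2, h1, hx⟩
    rw [this]
    refine Set.finite_iUnion fun h => ?_
    by_cases h1 : h.1 = 1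
    · simp [h1]
    · obtain ⟨x, y, -, hxy⟩ := h2 h.1 h.2 h1
      refine (Set.toFinite {x, y}).subset ?_
      rintro z ⟨-, hz⟩
      exact (hxy z).mp hz
  have : Finite N := hNfin
  have : Fintype N := Fintype.ofFinite N
  have : Fintype H := Fintype.ofFinite H
  let Ω := MulAction.orbitRel.Quotient H N
  have : Fintype Ω := Fintype.ofFinite Ω
  -- with `c = |H|` and `r` orbits in `N`, Burnside's lemma reads `|N| + 2 (c - 1) = r c`
  have hB : ∑ h : H, Fintype.card (MulAction.fixedBy N h) = Fintype.card Ω * Fintype.card H :=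
    MulAction.sum_card_fixedBy_eq_card_orbits_mul_card_group H N
  have hfixed : ∀ h : H, h ≠ 1 → Fintype.card (MulAction.fixedBy N h) = 2 := by
    intro h h1
    have h1' : h.1 ≠ 1 := fun h' => h1 (Subtype.ext h')
    obtain ⟨x, y, hne, hxy⟩ := h2 h.1 h.2 h1'
    have hx : x ∈ N := ⟨h.1, h.2, h1', (hxy x).mpr (Or.inl rfl)⟩
    have hy : y ∈ N := ⟨h.1, h.2, h1', (hxy y).mpr (Or.inr rfl)⟩
    have hset : MulAction.fixedBy N h = {⟨x, hx⟩, ⟨y, hy⟩} := by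
      ext z
      simp only [MulAction.mem_fixedBy, Set.mem_insert_iff, Set.mem_singleton_iff, Subtype.ext_iff]
      exact hxy z.1
    rw [← Nat.card_eq_fintype_card, Nat.card_coe_set_eq, hset, Set.ncard_pair]
    intro h'
    exact hne (congrArg Subtype.val h')
  have hone : Fintype.card (MulAction.fixedBy N (1 : H)) = Fintype.card N := by
    apply Fintype.card_congr
    exact (Equiv.subtypeUnivEquiv fun x => one_smul H x)
  rw [← Finset.add_sum_erase _ _ (Finset.mem_univ (1 : H)), hone, Finset.sum_congr rfl
    (fun h hh => hfixed h (Finset.ne_of_mem_erase hh)), Finset.sum_const,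
    Finset.card_erase_of_mem (Finset.mem_univ _), Finset.card_univ, smul_eq_mul] at hB
  set c := Fintype.card H with hc
  have hc2 : 2 ≤ c := by
    rw [hc, ← Nat.card_eq_fintype_card]
    exact (Subgroup.one_lt_card_iff_ne_bot H).mpr hH
  let f : Ω → ℕ := fun ω => Nat.card (MulAction.orbit H ω.out)
  have hsum : ∑ ω, f ω = Fintype.card N := by
    rw [← Nat.card_eq_fintype_card, Nat.card_congr (MulAction.selfEquivSigmaOrbits H N),
      Nat.card_sigma]
  have hdvd : ∀ x : N, ∃ m, 2 ≤ m ∧ Nat.card (MulAction.orbit H x) * m = c := by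
    intro x
    refine ⟨Nat.card (MulAction.stabilizer H x), ?_, ?_⟩
    · obtain ⟨h, hh, h1, hx⟩ := x.2
      refine (Subgroup.one_lt_card_iff_ne_bot _).mpr fun hbot => h1 ?_
      have : (⟨h, hh⟩ : H) ∈ MulAction.stabilizer H x := Subtype.ext hx
      rw [hbot, Subgroup.mem_bot] at this
      exact congrArg Subtype.val this
    · rw [← Nat.card_prod, Nat.card_congr (MulAction.orbitProdStabilizerEquivGroup H x),
        Nat.card_eq_fintype_card]
  have hpos : ∀ ω, 1 ≤ f ω := fun ω => by
    have : Nonempty (MulAction.orbit H ω.out) := (MulAction.nonempty_orbit _).to_subtype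
    exact Nat.card_pos
  have hle : ∀ ω, 2 * f ω ≤ c := fun ω => by
    obtain ⟨m, hm, hmc⟩ := hdvd ω.out
    have : f ω * 2 ≤ f ω * m := Nat.mul_le_mul_left _ hm
    change f ω * m = c at hmc
    omega
  have hsum_le : 2 * ∑ ω, f ω ≤ Fintype.card Ω * c := by
    rw [Finset.mul_sum]
    exact (Finset.sum_le_card_nsmul _ _ c fun ω _ => hle ω).trans (by simp)
  have hsum_ge : Fintype.card Ω ≤ ∑ ω, f ω := by
    have := Finset.card_nsmul_le_sum Finset.univ f 1 fun ω _ => hpos ω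
    simpa using this
  rw [← hsum] at hB
  -- Orbits in `N` have at most `c / 2` elements, which gives `r < 4`. If `r = 2`, both orbits
  -- are fixed points of `H`.
  have hΩ : Fintype.card Ω = 3 := by
    have hlt : Fintype.card Ω < 4 := by
      by_contra! h4
      have h5 : 4 * c ≤ Fintype.card Ω * c := Nat.mul_le_mul_right c h4
      omega
    have h01 : Fintype.card Ω ≠ 0 := by
      intro h0
      rw [h0] at hB
      omega
    have h11 : Fintype.card Ω ≠ 1 := by
      intro h0
      rw [h0] at hB hsum_ge
      omega
    have h21 : Fintype.card Ω ≠ 2 := by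
      intro h0
      rw [h0] at hB hsum_ge
      have hs2 : ∑ ω, f ω = 2 := by omega
      obtain ⟨a, b, hab, huniv⟩ := Finset.card_eq_two.mp (Finset.card_univ.trans h0)
      have hab' : f a + f b = 2 := by
        rw [← hs2, huniv, Finset.sum_pair hab]
      have hfa := hpos a
      have hfb := hpos b
      have hfixed1 : ∀ ω, f ω = 1 → ∀ h ∈ H, h (ω.out : N).1 = (ω.out : N).1 := by
        intro ω hω h hh
        have hsub := (Nat.card_eq_one_iff_unique.mp hω).1
        have := hsub.elim ⟨_, MulAction.mem_orbit ω.out (⟨h, hh⟩ : H)⟩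
          ⟨_, MulAction.mem_orbit_self ω.out⟩
        exact congrArg (fun z => z.1.1) this
      have := hfix _ _ (hfixed1 a (by omega)) (hfixed1 b (by omega))
      have h3 : (a.out : N) = b.out := Subtype.ext this
      apply hab
      rw [← Quotient.out_eq' a, ← Quotient.out_eq' b, h3]
    omega
  have horb : ∀ x : N, (MulAction.orbit H x.1).ncard = Nat.card (MulAction.orbit H x) := by
    intro x
    rw [← SubMulAction.val_image_orbit, Set.ncard_image_of_injective _ Subtype.val_injective,
      Nat.card_coe_set_eq]
  have hfmk : ∀ x : N, Nat.card (MulAction.orbit H x) = f (Quotient.mk'' x) := by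
    intro x
    have h3 : (Quotient.mk'' x : Ω).out ∈ MulAction.orbit H x :=
      MulAction.orbitRel_apply.mp (Quotient.mk_out x)
    have h4 := MulAction.orbit_eq_iff.mpr h3
    simp only [f]
    rw [h4]
  rcases exists_unique_value_of_card_three hΩ f with ⟨a, ha⟩ | hall
  · left
    refine ⟨(a.out : N).1, (a.out : N).2, fun y hy hcard => ?_⟩
    have h3 : f (Quotient.mk'' (⟨y, hy⟩ : N)) = f a := by
      rw [← hfmk, ← horb]
      refine hcard.trans ?_
      rw [horb]
    have h4 := ha _ h3
    have h5 : (⟨y, hy⟩ : N) ∈ MulAction.orbit H (a.out : N) := by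
      apply MulAction.orbitRel_apply.mp
      apply Quotient.exact
      rw [Quotient.out_eq]
      exact h4
    obtain ⟨h, hh⟩ := h5
    exact ⟨h, congrArg Subtype.val hh⟩
  · right
    obtain ⟨ω⟩ : Nonempty Ω := Fintype.card_pos_iff.mp (by omega)
    -- three orbits of the same size `f` give `3 f + 2 (c - 1) = 3 c`, with `f` a divisor of `c`
    have h3 : ∑ ω', f ω' = 3 * f ω := by
      rw [Finset.sum_congr rfl fun ω' _ => hall ω' ω, Finset.sum_const, Finset.card_univ, hΩ,
        smul_eq_mul]
    rw [h3, hΩ] at hB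
    obtain ⟨m, hm, hmc⟩ := hdvd ω.out
    change f ω * m = c at hmc
    have h4 : f ω ∣ 2 := by
      have h5 : f ω ∣ c := ⟨m, hmc.symm⟩
      have h6 : 3 * f ω = c + 2 := by omega
      have h7 : f ω ∣ c + 2 := ⟨3, by omega⟩
      exact (Nat.dvd_add_right h5).mp h7
    have h5 : f ω ≤ 2 := Nat.le_of_dvd two_pos h4
    have h6 := hpos ω
    rw [Nat.card_eq_fintype_card]
    have h7 : f ω = 1 ∨ f ω = 2 := by omega
    omega

end Burnside

/-! ### The Klein four-group and anticommuting matrices -/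

section Klein
variable {k : Type*} [Field k]

/-- An involution of the projective line lifts to a matrix with square one. -/
lemma exists_lift_mul_self_eq_one [IsAlgClosed k] {g : GL (Fin 2) k} (h : mob k g ^ 2 = 1) :
    ∃ g' : GL (Fin 2) k, mob k g' = mob k g ∧ g'.1 * g'.1 = 1 := by
  have h1 : mob k (g * g) = mob k 1 := by rw [map_mul, map_one, ← pow_two, h]
  obtain ⟨c, hc0, hc⟩ := mob_eq_mob_iff.mp h1
  obtain ⟨r, hr⟩ := IsAlgClosed.exists_pow_nat_eq c two_pos
  have hr0 : r ≠ 0 := by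
    rintro rfl
    rw [zero_pow two_ne_zero] at hr
    exact hc0 hr.symm
  refine ⟨Matrix.GeneralLinearGroup.scalar (Fin 2) (Units.mk0 r hr0)⁻¹ * g, ?_, ?_⟩
  · refine mob_eq_mob_iff.mpr ⟨r⁻¹, inv_ne_zero hr0, ?_⟩
    ext i j
    simp [Matrix.GeneralLinearGroup.scalar, Matrix.scalar_apply]
  · have h2 : g.1 * g.1 = c • 1 := by simpa using hc
    have h3 : (Matrix.GeneralLinearGroup.scalar (Fin 2) (Units.mk0 r hr0)⁻¹ * g).1 = r⁻¹ • g.1 := by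
      ext i j
      simp [Matrix.GeneralLinearGroup.scalar, Matrix.scalar_apply]
    rw [h3, Matrix.smul_mul, Matrix.mul_smul, h2, smul_smul, smul_smul, ← hr]
    have : r⁻¹ * r⁻¹ * r ^ 2 = 1 := by field_simp
    rw [this, one_smul]

lemma apply_one_one_of_mul_self_eq_one {g : GL (Fin 2) k} (h : g.1 * g.1 = 1)
    (h1 : mob k g ≠ 1) : g.1 1 1 = - g.1 0 0 := by
  by_contra hne
  have htr : g.1 0 0 + g.1 1 1 ≠ 0 := fun h' => hne (by linear_combination h')
  have e00 := congrFun (congrFun h 0) 0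
  have e01 := congrFun (congrFun h 0) 1
  have e10 := congrFun (congrFun h 1) 0
  have e11 := congrFun (congrFun h 1) 1
  simp only [Matrix.mul_apply, Fin.sum_univ_two, Matrix.one_apply_eq] at e00 e01 e10 e11
  rw [Matrix.one_apply_ne (by decide)] at e01 e10
  have hb : g.1 0 1 = 0 :=
    (mul_eq_zero.mp (show (g.1 0 0 + g.1 1 1) * g.1 0 1 = 0 by linear_combination e01)).resolve_left
      htr
  have hc : g.1 1 0 = 0 :=
    (mul_eq_zero.mp (show (g.1 0 0 + g.1 1 1) * g.1 1 0 = 0 by linear_combination e10)).resolve_left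
      htr
  have had : g.1 0 0 = g.1 1 1 := by
    have : (g.1 0 0 + g.1 1 1) * (g.1 0 0 - g.1 1 1) = 0 := by
      linear_combination e00 - e11
    exact sub_eq_zero.mp ((mul_eq_zero.mp this).resolve_left htr)
  apply h1
  rw [← map_one (mob k)]
  refine mob_eq_mob_iff.mpr ⟨g.1 0 0, ?_, ?_⟩
  · intro h0
    apply htr
    rw [← had, h0, add_zero]
  · ext i j
    fin_cases i <;> fin_cases j <;> simp [hb, hc, had]

/-- Matrices with square one lifting two distinct commuting involutions anticommute. -/
lemma mul_eq_neg_mul_of_commute {g g' : GL (Fin 2) k} (h : g.1 * g.1 = 1) (h' : g'.1 * g'.1 = 1)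
    (h1 : mob k g ≠ 1) (h1' : mob k g' ≠ 1) (hne : mob k g ≠ mob k g')
    (hcomm : mob k g * mob k g' = mob k g' * mob k g) : g.1 * g'.1 = - (g'.1 * g.1) := by
  rw [← map_mul, ← map_mul] at hcomm
  obtain ⟨c, -, hc⟩ := mob_eq_mob_iff.mp hcomm
  simp only [Units.val_mul] at hc
  have t := apply_one_one_of_mul_self_eq_one h h1
  have t' := apply_one_one_of_mul_self_eq_one h' h1'
  obtain ⟨τ, hτ⟩ : ∃ τ : k, g.1 * g'.1 + g'.1 * g.1 = τ • 1 := by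
    refine ⟨2 * g.1 0 0 * g'.1 0 0 + g.1 0 1 * g'.1 1 0 + g.1 1 0 * g'.1 0 1, ?_⟩
    ext i j
    fin_cases i <;> fin_cases j <;>
      simp [Matrix.mul_apply, Fin.sum_univ_two, t, t'] <;> ring
  by_cases hc1 : c = -1
  · rw [hc, hc1, neg_smul, one_smul]
  · exfalso
    have hc1' : c + 1 ≠ 0 := fun h0 => hc1 (by linear_combination h0)
    have h2 : (c + 1) • (g'.1 * g.1) = τ • 1 := by
      rw [add_smul, one_smul, ← hc, hτ]
    have h3 : g'.1 * g.1 = ((c + 1)⁻¹ * τ) • (1 : GL (Fin 2) k).1 := by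
      rw [mul_smul, Units.val_one, ← h2, smul_smul, inv_mul_cancel₀ hc1', one_smul]
    have h5 : (c + 1)⁻¹ * τ ≠ 0 := by
      intro h0
      rw [h0, zero_smul] at h3
      have h6 : (g' * g).1 = 0 := h3
      have h7 := (g' * g).det_ne_zero
      rw [h6, Matrix.det_zero] at h7
      exact h7 rfl
    have h4 : mob k (g' * g) = mob k 1 := mob_eq_mob_iff.mpr ⟨_, h5, h3⟩
    have h6 : mob k (g' * g') = mob k 1 := by
      rw [show g' * g' = 1 from Units.ext h']
    rw [map_mul, map_one] at h4 h6
    exact hne (mul_left_cancel (h4.trans h6.symm))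

variable {M : Fin 3 → Matrix (Fin 2) (Fin 2) k}

lemma mul_combination_add (hM : ∀ i, M i * M i = 1) (hMM : ∀ i j, i ≠ j → M i * M j = - (M j * M i))
    (x : Fin 3 → k) (i : Fin 3) :
    M i * (∑ j, x j • M j) + (∑ j, x j • M j) * M i = (2 * x i) • 1 := by
  rw [Finset.mul_sum, Finset.sum_mul, ← Finset.sum_add_distrib, Finset.sum_eq_single i]
  · rw [Matrix.mul_smul, Matrix.smul_mul, hM, ← add_smul, two_mul]
  · intro j _ hj
    rw [Matrix.mul_smul, Matrix.smul_mul, hMM i j hj.symm, smul_neg, neg_add_cancel]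
  · simp

lemma combination_mul_self [CharZero k] (hM : ∀ i, M i * M i = 1)
    (hMM : ∀ i j, i ≠ j → M i * M j = - (M j * M i)) (x : Fin 3 → k) :
    (∑ j, x j • M j) * (∑ j, x j • M j) = (∑ j, x j ^ 2) • 1 := by
  have h1 : ∑ i, x i • (M i * (∑ j, x j • M j) + (∑ j, x j • M j) * M i) =
      (2 : k) • (∑ j, x j ^ 2) • (1 : Matrix (Fin 2) (Fin 2) k) := by
    rw [smul_smul, Finset.mul_sum, Finset.sum_smul]
    refine Finset.sum_congr rfl fun i _ => ?_
    rw [mul_combination_add hM hMM, smul_smul]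
    congr 1
    ring
  have h2 : ∑ i, x i • (M i * (∑ j, x j • M j) + (∑ j, x j • M j) * M i) =
      (2 : k) • ((∑ j, x j • M j) * (∑ j, x j • M j)) := by
    simp only [smul_add, Finset.sum_add_distrib]
    rw [two_smul]
    congr 1
    · rw [Finset.sum_mul]
      exact Finset.sum_congr rfl fun i _ => (Matrix.smul_mul _ _ _).symm
    · rw [Finset.mul_sum]
      exact Finset.sum_congr rfl fun i _ => (Matrix.mul_smul _ _ _).symm
  rw [h2] at h1
  exact smul_right_injective _ (two_ne_zero (α := k)) h1

lemma mul_combination_mul (hM : ∀ i, M i * M i = 1)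
    (hMM : ∀ i j, i ≠ j → M i * M j = - (M j * M i)) (x : Fin 3 → k) (i : Fin 3) :
    M i * (∑ j, x j • M j) * M i = ∑ j, (if j = i then x j else - x j) • M j := by
  rw [Finset.mul_sum, Finset.sum_mul]
  refine Finset.sum_congr rfl fun j _ => ?_
  by_cases h : j = i
  · rw [if_pos h, h, Matrix.mul_smul, Matrix.smul_mul, hM, one_mul]
  · rw [if_neg h, Matrix.mul_smul, Matrix.smul_mul, hMM i j (Ne.symm h), neg_mul, mul_assoc, hM,
      mul_one, smul_neg, neg_smul]

/-- Changing the signs of the coefficients of a combination of three anticommuting matrices amounts,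
up to a global sign, to conjugating by one of them. -/
lemma combination_sign_change (hM : ∀ i, M i * M i = 1)
    (hMM : ∀ i j, i ≠ j → M i * M j = - (M j * M i)) (x δ : Fin 3 → k)
    (hδ : ∀ i, δ i = 1 ∨ δ i = -1) : ∃ ε : k, ε ≠ 0 ∧
      ((∑ j, (δ j * x j) • M j) = ε • ∑ j, x j • M j ∨
        ∃ i, (∑ j, (δ j * x j) • M j) = ε • (M i * (∑ j, x j • M j) * M i)) := by
  simp only [mul_combination_mul hM hMM]
  have h1 : (-1 : k) ≠ 0 := neg_ne_zero.mpr one_ne_zero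
  rcases hδ 0 with h0 | h0 <;> rcases hδ 1 with h1' | h1' <;> rcases hδ 2 with h2 | h2
  · exact ⟨1, one_ne_zero, Or.inl (by simp [Fin.sum_univ_three, h0, h1', h2])⟩
  · exact ⟨-1, h1, Or.inr ⟨2, by simp [Fin.sum_univ_three, h0, h1', h2]⟩⟩
  · exact ⟨-1, h1, Or.inr ⟨1, by simp [Fin.sum_univ_three, h0, h1', h2]⟩⟩
  · exact ⟨1, one_ne_zero, Or.inr ⟨0, by simp [Fin.sum_univ_three, h0, h1', h2]⟩⟩
  · exact ⟨-1, h1, Or.inr ⟨0, by simp [Fin.sum_univ_three, h0, h1', h2]⟩⟩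
  · exact ⟨1, one_ne_zero, Or.inr ⟨1, by simp [Fin.sum_univ_three, h0, h1', h2]⟩⟩
  · exact ⟨1, one_ne_zero, Or.inr ⟨2, by simp [Fin.sum_univ_three, h0, h1', h2]⟩⟩
  · exact ⟨-1, h1, Or.inl (by simp [Fin.sum_univ_three, h0, h1', h2])⟩

/-- The kernel of a non-zero singular matrix is a single point of the projective line. -/
lemma eq_of_mulVec_eq_zero {N : Matrix (Fin 2) (Fin 2) k} (hN : N ≠ 0) {p q : Fin 2 → k}
    (hp : p ≠ 0) (hq : q ≠ 0) (hNp : N.mulVec p = 0) (hNq : N.mulVec q = 0) :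
    Projectivization.mk k p hp = Projectivization.mk k q hq := by
  rw [← bracket_eq_zero_iff hp hq]
  by_contra hb
  apply hN
  apply Matrix.toLin'.injective
  apply LinearMap.ext
  intro v
  rw [Matrix.toLin'_apply, eq_combination hb v, Matrix.mulVec_add, Matrix.mulVec_smul,
    Matrix.mulVec_smul, hNp, hNq]
  simp

end Klein

/-! ### The stabiliser of a finite set of points -/

section Stab
variable {k : Type*} [Field k] {ι : Type*}

/-- The group of the projective transformations permuting the members of the family `ℓ`. -/
def branchStab (ℓ : ι → ProjLine k) : Subgroup (Equiv.Perm (ProjLine k)) where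
  carrier := {m | m ∈ (mob k).range ∧ ∃ π : Equiv.Perm ι, ∀ i, m (ℓ i) = ℓ (π i)}
  one_mem' := ⟨one_mem _, 1, fun _ => rfl⟩
  mul_mem' := by
    rintro a b ⟨ha, π, hπ⟩ ⟨hb, ρ, hρ⟩
    exact ⟨mul_mem ha hb, π * ρ, fun i => by simp [hρ, hπ]⟩
  inv_mem' := by
    rintro a ⟨ha, π, hπ⟩
    refine ⟨inv_mem ha, π⁻¹, fun i => ?_⟩
    rw [Equiv.Perm.inv_eq_iff_eq, hπ]
    simp

variable {ℓ : ι → ProjLine k}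

lemma eq_of_mem_branchStab [Fintype ι] (hℓ : Function.Injective ℓ) (hι : 3 ≤ Fintype.card ι)
    {m m' : Equiv.Perm (ProjLine k)} (hm : m ∈ branchStab ℓ) (hm' : m' ∈ branchStab ℓ)
    (h : ∀ i, m (ℓ i) = m' (ℓ i)) : m = m' := by
  obtain ⟨a, b, c, hab, hac, hbc⟩ := Fintype.two_lt_card_iff.mp hι
  obtain ⟨g, hg⟩ := (mul_mem (inv_mem hm') hm).1
  have hfix : ∀ i, mob k g (ℓ i) = ℓ i := by
    intro i
    rw [hg, Equiv.Perm.mul_apply, h]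
    simp
  have := mob_eq_one_of_triple (hℓ.ne hab) (hℓ.ne hbc.symm) (hℓ.ne hac) (hfix a) (hfix b) (hfix c)
  rw [hg] at this
  exact (inv_mul_eq_one.mp this).symm

lemma finite_branchStab [Fintype ι] (hℓ : Function.Injective ℓ) (hι : 3 ≤ Fintype.card ι) :
    Finite (branchStab ℓ) := by
  choose π hπ using fun m : branchStab ℓ => m.2.2
  refine Finite.of_injective (fun m => (π m : ι → ι)) fun m m' h => ?_
  apply Subtype.ext
  refine eq_of_mem_branchStab hℓ hι m.2 m'.2 fun i => ?_
  rw [hπ, hπ]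
  exact congrArg ℓ (congrFun h i)

/-- A semilinear transformation permuting the members of `ℓ` normalises their stabiliser. -/
lemma conj_mem_branchStab {σ : k ≃+* k} {γ : GL (Fin 2) k} {κ : Equiv.Perm ι}
    (hκ : ∀ i, (mob k γ * galPerm σ) (ℓ i) = ℓ (κ i)) {h : Equiv.Perm (ProjLine k)}
    (hh : h ∈ branchStab ℓ) :
    (mob k γ * galPerm σ) * h * (mob k γ * galPerm σ)⁻¹ ∈ branchStab ℓ := by
  obtain ⟨⟨g, rfl⟩, π, hπ⟩ := hh
  refine ⟨⟨γ * Matrix.GeneralLinearGroup.map (σ : k →+* k) g * γ⁻¹, ?_⟩, κ * π * κ⁻¹, fun i => ?_⟩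
  · rw [map_mul, map_mul, map_inv, mul_assoc (mob k γ) (galPerm σ), galPerm_mul_mob]
    group
  · rw [Equiv.Perm.mul_apply, Equiv.Perm.mul_apply]
    have h1 : (mob k γ * galPerm σ)⁻¹ (ℓ i) = ℓ (κ⁻¹ i) := by
      rw [Equiv.Perm.inv_eq_iff_eq, hκ]
      simp
    rw [h1, hπ, hκ]
    simp

/-- A permutation normalising `H` and preserving a class of points which is a single orbit of `H`
can be corrected by an element of `H` so as to fix a point. -/
lemma exists_mem_mul_fixes {α : Type*} {H : Subgroup (Equiv.Perm α)} [Finite H]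
    {φ : Equiv.Perm α} (hφ : ∀ h ∈ H, φ * h * φ⁻¹ ∈ H) {x : α}
    (hx : ∃ h ∈ H, h ≠ 1 ∧ h x = x)
    (hu : ∀ y, (∃ h ∈ H, h ≠ 1 ∧ h y = y) →
      (MulAction.orbit H y).ncard = (MulAction.orbit H x).ncard → y ∈ MulAction.orbit H x) :
    ∃ h ∈ H, (h * φ) x = x := by
  -- as `H` is finite, conjugation by `φ` maps it onto itself
  have hsurj : ∀ h ∈ H, ∃ h' ∈ H, φ * h' * φ⁻¹ = h := by
    have hinj : Function.Injective fun h : H => (⟨φ * h * φ⁻¹, hφ h h.2⟩ : H) := by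
      intro a b hab
      have h1 : φ * a * φ⁻¹ = φ * b * φ⁻¹ := congrArg Subtype.val hab
      exact Subtype.ext (mul_left_cancel (mul_right_cancel h1))
    intro h hh
    obtain ⟨h', h'h⟩ := Finite.surjective_of_injective hinj ⟨h, hh⟩
    exact ⟨h', h'.2, congrArg Subtype.val h'h⟩
  have horb : MulAction.orbit H (φ x) = φ '' MulAction.orbit H x := by
    ext y
    constructor
    · rintro ⟨h, rfl⟩
      obtain ⟨h', hh', e⟩ := hsurj h h.2
      refine ⟨h' x, ⟨⟨h', hh'⟩, rfl⟩, ?_⟩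
      change φ (h' x) = h.1 (φ x)
      rw [← e]
      simp
    · rintro ⟨_, ⟨h, rfl⟩, rfl⟩
      refine ⟨⟨φ * h * φ⁻¹, hφ h h.2⟩, ?_⟩
      change (φ * h * φ⁻¹) (φ x) = φ (h.1 x)
      simp
  obtain ⟨h, hh, h1, hhx⟩ := hx
  obtain ⟨m, hm⟩ := hu (φ x) ⟨φ * h * φ⁻¹, hφ h hh, fun e => h1 (by simpa using e), by simp [hhx]⟩
    (by rw [horb, Set.ncard_image_of_injective _ φ.injective])
  have hm' : m.1 x = φ x := hm
  exact ⟨m⁻¹, inv_mem m.2, by rw [Equiv.Perm.mul_apply, ← hm']; simp⟩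

variable [Fintype ι]

open Classical in
/-- The sum of a character over all the labellings of the points in which the permutation `h` acts
on the labels in the prescribed way `θ`. -/
def labelledSum (ℓ : ι → ProjLine k) (θ : Equiv.Perm ι) (h : Equiv.Perm (ProjLine k))
    (r : Multiplicative (RegularGraphs ι)) : k :=
  ∑ π : {π : Equiv.Perm ι // ∀ a, h (ℓ (π a)) = ℓ (π (θ a))}, crossChar (ℓ ∘ π.1) r

lemma labelledSum_conj {θ : Equiv.Perm ι} {σ : k ≃+* k} {γ : GL (Fin 2) k} {κ : Equiv.Perm ι}
    (hκ : ∀ i, (mob k γ * galPerm σ) (ℓ i) = ℓ (κ i)) (h : Equiv.Perm (ProjLine k))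
    (r : Multiplicative (RegularGraphs ι)) :
    σ (labelledSum ℓ θ h r) =
      labelledSum ℓ θ ((mob k γ * galPerm σ) * h * (mob k γ * galPerm σ)⁻¹) r := by
  classical
  rw [labelledSum, labelledSum, map_sum]
  refine Fintype.sum_equiv ((Equiv.mulLeft κ).subtypeEquiv fun π => ?_) _ _ fun π => ?_
  · refine forall_congr' fun a => ?_
    simp only [Equiv.coe_mulLeft, Equiv.Perm.mul_apply (f := κ)]
    rw [← hκ, ← hκ, Equiv.Perm.mul_apply, Equiv.Perm.mul_apply _ h, Equiv.Perm.inv_def,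
      Equiv.symm_apply_apply,
      EmbeddingLike.apply_eq_iff_eq]
  · rw [← crossChar_galPerm, ← crossChar_gl_smul γ]
    congr 2
    ext1 a
    exact hκ _

/-- The labelled sums separate commuting elements of the stabiliser. -/
lemma exists_labelledSum_ne [IsAlgClosed k] [CharZero k] (hℓ : Function.Injective ℓ)
    (hι : 3 ≤ Fintype.card ι) {s t : Equiv.Perm (ProjLine k)} {θ : Equiv.Perm ι}
    (hθ : ∀ a, s (ℓ a) = ℓ (θ a)) (hs : s ∈ branchStab ℓ) (ht : t ∈ branchStab ℓ) (hst : s ≠ t)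
    (hcomm : ∀ g ∈ branchStab ℓ, g * s = s * g) :
    ∃ r, labelledSum ℓ θ s r ≠ labelledSum ℓ θ t r := by
  classical
  by_contra! h
  obtain ⟨π, hπ⟩ := exists_eq_of_sum_monoidHom_eq
    (fun π : {π : Equiv.Perm ι // ∀ a, s (ℓ (π a)) = ℓ (π (θ a))} => crossChar (ℓ ∘ π.1))
    (fun π : {π : Equiv.Perm ι // ∀ a, t (ℓ (π a)) = ℓ (π (θ a))} => crossChar (ℓ ∘ π.1))
    h ⟨1, hθ⟩
  obtain ⟨g, hg⟩ := exists_gl_of_crossChar_eq hι (hℓ.comp (1 : Equiv.Perm ι).injective)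
    (hℓ.comp π.1.injective) hπ.symm
  have hg' : ∀ a, mob k g (ℓ a) = ℓ (π.1 a) := hg
  have hgm : mob k g ∈ branchStab ℓ := ⟨⟨g, rfl⟩, π.1, hg'⟩
  have h1 : mob k g * s = t * mob k g := by
    refine eq_of_mem_branchStab hℓ hι (mul_mem hgm hs) (mul_mem ht hgm) fun a => ?_
    rw [Equiv.Perm.mul_apply, Equiv.Perm.mul_apply, hθ, hg', hg', π.2]
  rw [hcomm _ hgm] at h1
  exact hst (mul_right_cancel h1)

lemma exists_three_involutions {G : Type*} [Group G] (hG : Nat.card G = 4) {s t : G} (hst : s ≠ t)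
    (hs : orderOf s = 2) (ht : orderOf t = 2) : (∀ a b : G, a * b = b * a) ∧
    ∃ h : Fin 3 → G, Function.Injective h ∧ (∀ i, h i ≠ 1 ∧ h i * h i = 1) ∧
      ∀ a, a ≠ 1 → ∃ i, h i = a := by
  have hfin : Finite G := Nat.finite_of_card_ne_zero (by omega)
  have hcomm : ∀ a b : G, a * b = b * a := by
    have : Fact (Nat.Prime 2) := ⟨Nat.prime_two⟩
    exact (IsPGroup.commGroupOfCardEqPrimeSq (p := 2) hG).mul_comm
  have hs1 : s ≠ 1 := fun h => by rw [h, orderOf_one] at hs; omega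
  have ht1 : t ≠ 1 := fun h => by rw [h, orderOf_one] at ht; omega
  have hss : s * s = 1 := by rw [← pow_two, ← hs, pow_orderOf_eq_one]
  have htt : t * t = 1 := by rw [← pow_two, ← ht, pow_orderOf_eq_one]
  have h3 : s * t ≠ 1 := fun h => hst (mul_right_cancel (h.trans htt.symm))
  have h4 : s ≠ s * t := fun h => ht1 (by simpa using h)
  have h5 : t ≠ s * t := fun h => hs1 (by simpa using h)
  have hinj : Function.Injective ![1, s, t, s * t] := by
    intro a b
    fin_cases a <;> fin_cases b <;>
      simp [hs1, ht1, h3, hst, hs1.symm, ht1.symm, h3.symm, hst.symm, h4, h5, h4.symm, h5.symm]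
  refine ⟨hcomm, ![s, t, s * t], ?_, ?_, ?_⟩
  · intro a b
    fin_cases a <;> fin_cases b <;> simp [hst, hst.symm, hs1, ht1]
  · intro i
    fin_cases i
    · exact ⟨hs1, hss⟩
    · exact ⟨ht1, htt⟩
    · refine ⟨h3, ?_⟩
      change s * t * (s * t) = 1
      calc s * t * (s * t) = s * t * (t * s) := by rw [hcomm s t]
        _ = s * (t * t) * s := by group
        _ = 1 := by rw [htt, mul_one, hss]
  · intro a ha
    have := Fintype.ofFinite G
    have hsurj := ((Fintype.bijective_iff_injective_and_card ![1, s, t, s * t]).mpr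
      ⟨hinj, by rw [← Nat.card_eq_fintype_card (α := G), hG]; simp⟩).2
    obtain ⟨i, hi⟩ := hsurj a
    refine Fin.cases (fun h => absurd h.symm ha) (fun j hj => ⟨j, hj⟩) i hi

end Stab

/-! ### The marked point -/

section Marked
variable {k : Type*} [Field k] {ι : Type*}

/-- Conjugating by a semilinear map a matrix with square one gives, up to sign, the matrix with
square one of the conjugate involution. -/
lemma exists_sign_of_conj {σ : k ≃+* k} {γ g g' : GL (Fin 2) k} (hg : g.1 * g.1 = 1)
    (hg' : g'.1 * g'.1 = 1)
    (h : (mob k γ * galPerm σ) * mob k g * (mob k γ * galPerm σ)⁻¹ = mob k g') :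
    ∃ c : k, (c = 1 ∨ c = -1) ∧ γ.1 * g.1.map σ = c • (g'.1 * γ.1) := by
  have h1 : mob k (γ * Matrix.GeneralLinearGroup.map (σ : k →+* k) g * γ⁻¹) = mob k g' := by
    rw [← h, map_mul, map_mul, map_inv, mul_assoc (mob k γ) (galPerm σ), galPerm_mul_mob]
    group
  obtain ⟨c, -, hc⟩ := mob_eq_mob_iff.mp h1
  set m := γ * Matrix.GeneralLinearGroup.map (σ : k →+* k) g * γ⁻¹ with hm
  have hgg : g * g = 1 := Units.ext hg
  have hmm : m.1 * m.1 = 1 := by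
    have : m * m = 1 := by
      have e : m * m = γ * Matrix.GeneralLinearGroup.map (σ : k →+* k) (g * g) * γ⁻¹ := by
        rw [hm, map_mul]
        group
      rw [e, hgg, map_one]
      group
    exact congrArg Units.val this
  refine ⟨c, ?_, ?_⟩
  · rw [hc, Matrix.smul_mul, Matrix.mul_smul, hg', smul_smul] at hmm
    have h2 := congrFun (congrFun hmm 0) 0
    simp only [Matrix.smul_apply, Matrix.one_apply_eq, smul_eq_mul, mul_one] at h2
    exact mul_self_eq_one_iff.mp h2
  · have h2 : (m * γ).1 = γ.1 * g.1.map σ := by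
      rw [hm, inv_mul_cancel_right]
      rfl
    rw [← h2, Units.val_mul, hc, Matrix.smul_mul]

/-- The nilpotent combination of three anticommuting matrices attached to a Klein four-group, and
the point it kills. If a semilinear map permutes the three involutions and the squares of the
coefficients accordingly, it moves the point within its orbit under the four-group. -/
lemma exists_fixed_of_klein [CharZero k] {g : Fin 3 → GL (Fin 2) k}
    (hg : ∀ i, (g i).1 * (g i).1 = 1)
    (hgg : ∀ i j, i ≠ j → (g i).1 * (g j).1 = - ((g j).1 * (g i).1)) {x : Fin 3 → k}
    (hN : ∑ i, x i • (g i).1 ≠ 0) {p : Fin 2 → k} (hp : p ≠ 0)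
    (hNp : (∑ i, x i • (g i).1).mulVec p = 0) {σ : k ≃+* k} {γ : GL (Fin 2) k}
    (κ : Equiv.Perm (Fin 3)) (hκ : ∀ i, (mob k γ * galPerm σ) * mob k (g i) *
      (mob k γ * galPerm σ)⁻¹ = mob k (g (κ i)))
    (hx : ∀ i, σ (x i) ^ 2 = x (κ i) ^ 2) :
    (mob k γ * galPerm σ) (Projectivization.mk k p hp) = Projectivization.mk k p hp ∨
    ∃ i, (mob k (g i) * (mob k γ * galPerm σ)) (Projectivization.mk k p hp) =
      Projectivization.mk k p hp := by
  choose c hc hc' using fun i => exists_sign_of_conj (hg i) (hg (κ i)) (hκ i)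
  have hδ : ∀ i, ∃ δ : k, (δ = 1 ∨ δ = -1) ∧ σ (x i) * c i = δ * x (κ i) := by
    intro i
    rcases sq_eq_sq_iff_eq_or_eq_neg.mp (hx i) with h | h <;> rcases hc i with h' | h'
    · exact ⟨1, Or.inl rfl, by rw [h, h']; ring⟩
    · exact ⟨-1, Or.inr rfl, by rw [h, h']; ring⟩
    · exact ⟨-1, Or.inr rfl, by rw [h, h']; ring⟩
    · exact ⟨1, Or.inl rfl, by rw [h, h']; ring⟩
  choose δ hδ1 hδ2 using hδ
  have hconj : γ.1 * (∑ i, x i • (g i).1).map σ =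
      (∑ j, (δ (κ.symm j) * x j) • (g j).1) * γ.1 := by
    have h1 : (∑ i, x i • (g i).1).map σ = ∑ i, σ (x i) • (g i).1.map σ := by
      ext a b
      simp [Matrix.sum_apply]
    rw [h1, Finset.mul_sum, Finset.sum_mul]
    refine Fintype.sum_equiv κ _ _ fun i => ?_
    rw [Equiv.symm_apply_apply, ← hδ2, Matrix.mul_smul, hc', smul_smul, Matrix.smul_mul]
  set q : Fin 2 → k := γ • (σ ∘ p) with hq
  have hq0 : q ≠ 0 := (smul_ne_zero_iff_ne γ).mpr (comp_ne_zero σ hp)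
  have hφ : (mob k γ * galPerm σ) (Projectivization.mk k p hp) = Projectivization.mk k q hq0 := rfl
  have hNq : (∑ j, (δ (κ.symm j) * x j) • (g j).1).mulVec q = 0 := by
    have h2 : ((∑ i, x i • (g i).1).map σ).mulVec (σ ∘ p) = 0 := by
      have := RingHom.map_mulVec (σ : k →+* k) (∑ i, x i • (g i).1) p
      ext a
      rw [hNp] at this
      have := this a
      simpa using this.symm
    rw [hq, gl_smul_eq_mulVec, Matrix.mulVec_mulVec, ← hconj, ← Matrix.mulVec_mulVec, h2,
      Matrix.mulVec_zero]
  obtain ⟨ε, hε, h | ⟨i, h⟩⟩ := combination_sign_change hg hgg x (fun j => δ (κ.symm j))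
    fun j => hδ1 _
  · left
    rw [h, Matrix.smul_mulVec, smul_eq_zero_iff_right hε] at hNq
    rw [hφ]
    exact eq_of_mulVec_eq_zero hN hq0 hp hNq hNp
  · right
    refine ⟨i, ?_⟩
    rw [h, Matrix.smul_mulVec, smul_eq_zero_iff_right hε, mul_assoc, ← Matrix.mulVec_mulVec] at hNq
    have h3 : (∑ j, x j • (g j).1).mulVec (g i • q) = 0 := by
      have h4 := congrArg (fun v => (g i).1.mulVec v) hNq
      simp only [Matrix.mulVec_mulVec, ← mul_assoc, hg, one_mul, Matrix.mulVec_zero] at h4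
      rw [gl_smul_eq_mulVec, Matrix.mulVec_mulVec]
      exact h4
    rw [Equiv.Perm.mul_apply, hφ, mob_mk]
    exact eq_of_mulVec_eq_zero hN _ hp h3 hNp

variable [Fintype ι] {ℓ : ι → ProjLine k}

/-- The marked point when the stabiliser is a Klein four-group `{1, h₀, h₁, h₂}`. The labelled sums
`eᵢ` of the `hᵢ` are permuted by the automorphisms `σ` as the `hᵢ` are permuted by the semilinear
maps, and they are not all equal. Let `μ` be their mean, `xᵢ² = eᵢ - μ` and `Mᵢ` matrices with
square one which lift the `hᵢ`. Then `N = ∑ xᵢ Mᵢ` has square `∑ xᵢ² = 0`, it is not zero, and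
its kernel is the marked point. The choice of the square roots `xᵢ` only matters up to the action of
the four-group. -/
lemma exists_marked_of_klein [IsAlgClosed k] [CharZero k] (hℓ : Function.Injective ℓ)
    (hι : 3 ≤ Fintype.card ι) {s t : branchStab ℓ} (hst : s ≠ t) (hs : orderOf s = 2)
    (ht : orderOf t = 2) (h4 : Nat.card (branchStab ℓ) = 4) :
    ∃ P : ProjLine k, ∀ (σ : k ≃+* k) (γ : GL (Fin 2) k) (κ : Equiv.Perm ι),
      (∀ i, (mob k γ * galPerm σ) (ℓ i) = ℓ (κ i)) →
        ∃ h ∈ branchStab ℓ, (h * (mob k γ * galPerm σ)) P = P := by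
  obtain ⟨hcomm, h, hinj, hh, hall⟩ := exists_three_involutions h4 hst hs ht
  obtain ⟨θ, hθ⟩ := (h 0).2.2
  obtain ⟨r, hr⟩ := exists_labelledSum_ne hℓ hι hθ (h 0).2 (h 1).2
    (fun e => zero_ne_one (hinj (Subtype.ext e)))
    fun g hg => congrArg Subtype.val (hcomm ⟨g, hg⟩ (h 0))
  have hlift : ∀ i, ∃ g : GL (Fin 2) k, mob k g = (h i).1 ∧ g.1 * g.1 = 1 := by
    intro i
    obtain ⟨g, hg⟩ := (h i).2.1
    have h1 : mob k g ^ 2 = 1 := by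
      rw [hg, pow_two]
      exact congrArg Subtype.val (hh i).2
    obtain ⟨g', e, hg'⟩ := exists_lift_mul_self_eq_one h1
    exact ⟨g', e.trans hg, hg'⟩
  choose g hg hg1 using hlift
  have hne1 : ∀ i, mob k (g i) ≠ 1 := fun i e => (hh i).1 (Subtype.ext ((hg i).symm.trans e))
  have hgg : ∀ i j, i ≠ j → (g i).1 * (g j).1 = - ((g j).1 * (g i).1) := by
    intro i j hij
    refine mul_eq_neg_mul_of_commute (hg1 i) (hg1 j) (hne1 i) (hne1 j) ?_ ?_
    · rw [hg, hg]
      exact fun e => hij (hinj (Subtype.ext e))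
    · rw [hg, hg]
      exact congrArg Subtype.val (hcomm (h i) (h j))
  set e : Fin 3 → k := fun i => labelledSum ℓ θ (h i).1 r with he
  -- centring makes the sum of the squares `xᵢ²` vanish
  set μ : k := (∑ i, e i) / 3 with hμ
  choose x hx using fun i => IsAlgClosed.exists_pow_nat_eq (e i - μ) two_pos
  have hx0 : ∑ i, x i ^ 2 = 0 := by
    simp only [hx, Finset.sum_sub_distrib, hμ, Finset.sum_const, Finset.card_univ, Fintype.card_fin]
    rw [nsmul_eq_mul]
    push_cast
    field_simp
    ring
  set N := ∑ i, x i • (g i).1 with hN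
  have hNN : N * N = 0 := by rw [hN, combination_mul_self hg1 hgg, hx0, zero_smul]
  have hN0 : N ≠ 0 := by
    intro h0
    have hxi : ∀ i, e i = μ := by
      intro i
      have h1 := mul_combination_add hg1 hgg x i
      rw [← hN, h0, mul_zero, zero_mul, add_zero] at h1
      have h2 := congrFun (congrFun h1 0) 0
      simp only [Matrix.zero_apply, Matrix.smul_apply, Matrix.one_apply_eq, smul_eq_mul,
        mul_one] at h2
      have h3 : x i = 0 := (mul_eq_zero.mp h2.symm).resolve_left two_ne_zero
      have h5 := hx i
      rw [h3, zero_pow two_ne_zero] at h5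
      exact sub_eq_zero.mp h5.symm
    exact hr ((hxi 0).trans (hxi 1).symm)
  obtain ⟨p, hp, hNp⟩ : ∃ p : Fin 2 → k, p ≠ 0 ∧ N.mulVec p = 0 := by
    by_contra! hcon
    apply hN0
    apply Matrix.toLin'.injective
    apply LinearMap.ext
    intro v
    rw [Matrix.toLin'_apply, map_zero, LinearMap.zero_apply]
    by_contra hv
    exact hcon _ hv (by rw [Matrix.mulVec_mulVec, hNN, Matrix.zero_mulVec])
  refine ⟨Projectivization.mk k p hp, fun σ γ κ hκ => ?_⟩
  have hperm : ∀ i, ∃ j, (mob k γ * galPerm σ) * (h i).1 * (mob k γ * galPerm σ)⁻¹ = (h j).1 := by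
    intro i
    obtain ⟨j, hj⟩ := hall ⟨_, conj_mem_branchStab hκ (h i).2⟩ (by
      intro e
      have e1 := congrArg Subtype.val e
      exact (hh i).1 (Subtype.ext (conj_eq_one_iff.mp e1)))
    exact ⟨j, (congrArg Subtype.val hj).symm⟩
  choose ρ hρ using hperm
  have hρinj : Function.Injective ρ := by
    intro i j hij
    have h1 := (hρ i).trans ((congrArg (fun l => (h l).1) hij).trans (hρ j).symm)
    exact hinj (Subtype.ext (mul_left_cancel (mul_right_cancel h1)))
  have hσe : ∀ i, σ (e i) = e (ρ i) := by
    intro i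
    rw [he]
    simp only
    rw [labelledSum_conj hκ, hρ]
  let ρ' : Equiv.Perm (Fin 3) := Equiv.ofBijective ρ (Finite.injective_iff_bijective.mp hρinj)
  have hσμ : σ μ = μ := by
    rw [hμ, map_div₀, map_sum, map_ofNat]
    congr 1
    exact Fintype.sum_equiv ρ' _ _ hσe
  rcases exists_fixed_of_klein hg1 hgg hN0 hp hNp (σ := σ) (γ := γ) ρ'
    (fun i => by rw [hg, hg]; exact hρ i)
    (fun i => by rw [← map_pow, hx, hx, map_sub, hσμ, hσe]; rfl) with h1 | ⟨i, h1⟩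
  · exact ⟨1, one_mem _, by rw [one_mul]; exact h1⟩
  · exact ⟨mob k (g i), by rw [hg]; exact (h i).2, h1⟩

/-- A finite set of points with at least two involutions in its stabiliser has a marked point:
any semilinear map preserving the set can be corrected, within the stabiliser, so as to fix it. -/
theorem exists_marked_point [IsAlgClosed k] [CharZero k] (hℓ : Function.Injective ℓ)
    (hι : 3 ≤ Fintype.card ι) {s t : branchStab ℓ} (hst : s ≠ t) (hs : orderOf s = 2)
    (ht : orderOf t = 2) :
    ∃ P : ProjLine k, ∀ (σ : k ≃+* k) (γ : GL (Fin 2) k) (κ : Equiv.Perm ι),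
      (∀ i, γ • galPerm σ (ℓ i) = ℓ (κ i)) →
        ∃ (γ' : GL (Fin 2) k) (κ' : Equiv.Perm ι), (∀ i, γ' • galPerm σ (ℓ i) = ℓ (κ' i)) ∧
          γ' • galPerm σ P = P := by
  suffices h : ∃ P : ProjLine k, ∀ (σ : k ≃+* k) (γ : GL (Fin 2) k) (κ : Equiv.Perm ι),
      (∀ i, (mob k γ * galPerm σ) (ℓ i) = ℓ (κ i)) →
        ∃ h ∈ branchStab ℓ, (h * (mob k γ * galPerm σ)) P = P by
    obtain ⟨P, hP⟩ := h
    refine ⟨P, fun σ γ κ hκ => ?_⟩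
    obtain ⟨m, ⟨⟨g, rfl⟩, π, hπ⟩, hm⟩ := hP σ γ κ hκ
    refine ⟨g * γ, π * κ, fun i => ?_, ?_⟩
    · rw [mul_smul, hκ]
      exact hπ _
    · rw [mul_smul]
      exact hm
  have hfin := finite_branchStab hℓ hι
  have hlift : ∀ s : branchStab ℓ, orderOf s = 2 → ∃ g, mob k g = s.1 ∧ mob k g ^ 2 = 1 ∧
      mob k g ≠ 1 := by
    intro s hs
    obtain ⟨g, hg⟩ := s.2.1
    refine ⟨g, hg, ?_, ?_⟩
    · rw [hg]
      have := pow_orderOf_eq_one s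
      rw [hs] at this
      exact congrArg Subtype.val this
    · rw [hg]
      intro e
      rw [show s = 1 from Subtype.ext e, orderOf_one] at hs
      omega
  obtain ⟨gs, hgs, hgs2, hgs1⟩ := hlift s hs
  obtain ⟨gt, hgt, hgt2, hgt1⟩ := hlift t ht
  have hbot : branchStab ℓ ≠ ⊥ := by
    intro hbot
    exact hgs1 (hgs.trans ((Subgroup.eq_bot_iff_forall _).mp hbot _ s.2))
  have htwo : ∀ m ∈ branchStab ℓ, m ≠ 1 → ∃ x y, x ≠ y ∧ ∀ z, m z = z ↔ z = x ∨ z = y := by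
    rintro m hm hm1
    obtain ⟨g, rfl⟩ := hm.1
    refine exists_two_fixed (n := orderOf (⟨mob k g, hm⟩ : branchStab ℓ)) (orderOf_pos _).ne' ?_ hm1
    exact congrArg Subtype.val (pow_orderOf_eq_one (⟨mob k g, hm⟩ : branchStab ℓ))
  have hfix : ∀ x y, (∀ m ∈ branchStab ℓ, m x = x) → (∀ m ∈ branchStab ℓ, m y = y) → x = y := by
    intro x y hx hy
    by_contra hxy
    apply hst
    apply Subtype.ext
    rw [← hgs, ← hgt]
    exact mob_involution_unique hgs2 hgs1 hgt2 hgt1 hxy (by rw [hgs]; exact hx _ s.2)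
      (by rw [hgs]; exact hy _ s.2) (by rw [hgt]; exact hx _ t.2) (by rw [hgt]; exact hy _ t.2)
  rcases exists_unique_orbit_or_card_eq_four (branchStab ℓ) hbot htwo hfix with ⟨P, hP, hu⟩ | h4
  · refine ⟨P, fun σ γ κ hκ => ?_⟩
    exact exists_mem_mul_fixes (fun h hh => conj_mem_branchStab hκ hh) hP hu
  · exact exists_marked_of_klein hℓ hι hst hs ht h4

end Marked

/-! ### Descent of a finite set of points of the affine line -/

section AffineDescent
variable {k : Type*} [Field k]

lemma scaleRoots_prod_X_sub_C {ι : Type*} (s : Finset ι) (f : ι → k) (a : k) :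
    (∏ i ∈ s, (X - C (f i))).scaleRoots a = ∏ i ∈ s, (X - C (a * f i)) := by
  classical
  induction s using Finset.induction_on with
  | empty => simp
  | insert i s hi ih =>
    rw [Finset.prod_insert hi, Finset.prod_insert hi, mul_scaleRoots_of_noZeroDivisors, ih,
      X_sub_C_scaleRoots, mul_comm a]

/-- If every automorphism over `L` multiplies each `cᵢ` by the `-i`-th power of some scalar, then a
single rescaling puts all of them in `L`. Say that `e ≠ 0` has weight `n` if it is multiplied by the
`-n`-th powers of these scalars. The weights form a group `hℤ`, and an `h`-th root of an element of
weight `h` is the inverse of the required scalar. The indeterminacy of the root plays no role, since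
only its powers with exponents divisible by `h` occur. -/
lemma exists_rescale_mem [IsAlgClosed k] [CharZero k] (L : Subfield k) (c : ℕ → k)
    (hc : ∀ σ : k ≃ₐ[L] k, ∃ a : k, a ≠ 0 ∧ ∀ i, a ^ i * σ (c i) = c i) :
    ∃ r : k, r ≠ 0 ∧ ∀ i, r ^ i * c i ∈ L := by
  choose a ha0 ha using hc
  -- the weights of non-zero elements of `k`
  let W : AddSubgroup ℤ :=
    { carrier := {n | ∃ e : k, e ≠ 0 ∧ ∀ σ : k ≃ₐ[L] k, a σ ^ n * σ e = e}
      zero_mem' := ⟨1, one_ne_zero, fun σ => by simp⟩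
      add_mem' := by
        rintro m n ⟨e, he, h⟩ ⟨e', he', h'⟩
        refine ⟨e * e', mul_ne_zero he he', fun σ => ?_⟩
        conv_rhs => rw [← h σ, ← h' σ]
        rw [zpow_add₀ (ha0 σ), map_mul]
        ring
      neg_mem' := by
        rintro m ⟨e, he, h⟩
        refine ⟨e⁻¹, inv_ne_zero he, fun σ => ?_⟩
        conv_rhs => rw [← h σ]
        rw [zpow_neg, map_inv₀, mul_inv] }
  obtain ⟨w, hw⟩ := Int.subgroup_cyclic W
  rw [← AddSubgroup.zmultiples_eq_closure] at hw
  have hdvd : ∀ i, c i ≠ 0 → w.natAbs ∣ i := by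
    intro i hi
    have h1 : (i : ℤ) ∈ W := ⟨c i, hi, fun σ => by rw [zpow_natCast]; exact ha σ i⟩
    rw [hw, Int.mem_zmultiples_iff] at h1
    exact Int.natAbs_dvd_natAbs.mpr h1
  have hwW : (w.natAbs : ℤ) ∈ W := by
    rw [hw, Int.mem_zmultiples_iff]
    exact Int.dvd_natAbs.mpr dvd_rfl
  obtain ⟨e, he, hσe⟩ := hwW
  obtain ⟨s, hs0, hs⟩ : ∃ s : k, s ≠ 0 ∧ ∀ q, w.natAbs ≠ 0 → s ^ (w.natAbs * q) = e ^ q := by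
    by_cases h0 : w.natAbs = 0
    · exact ⟨1, one_ne_zero, fun q hq => absurd h0 hq⟩
    · obtain ⟨s, hs⟩ := IsAlgClosed.exists_pow_nat_eq e (Nat.pos_of_ne_zero h0)
      refine ⟨s, ?_, fun q _ => by rw [pow_mul, hs]⟩
      rintro rfl
      rw [zero_pow h0] at hs
      exact he hs.symm
  refine ⟨s⁻¹, inv_ne_zero hs0, fun i => mem_of_forall_algEquiv_eq L _ fun σ => ?_⟩
  by_cases hi : c i = 0
  · simp [hi]
  obtain ⟨q, hq⟩ := hdvd i hi
  have hpow : σ (s ^ i) * a σ ^ i = s ^ i := by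
    by_cases h0 : w.natAbs = 0
    · rw [hq, h0]
      simp
    · have h1 := hσe σ
      rw [zpow_natCast] at h1
      rw [hq, hs q h0, map_pow, pow_mul, ← mul_pow, mul_comm, h1]
  have hsi : s ^ i ≠ 0 := pow_ne_zero _ hs0
  have hσsi : σ (s ^ i) ≠ 0 := (map_ne_zero σ).mpr hsi
  rw [inv_pow, map_mul, map_inv₀]
  have h2 := ha σ i
  rw [inv_mul_eq_iff_eq_mul₀ hσsi]
  have ha' := pow_ne_zero i (ha0 σ)
  field_simp
  linear_combination σ (s ^ i) * h2 - σ (c i) * hpow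

/-- A finite set of points of the affine line all of whose conjugates over `L` are affinely
equivalent to it is affinely equivalent to the set of roots of a polynomial over `L`. -/
lemma exists_affine_descent [IsAlgClosed k] [CharZero k] (L : Subfield k) (B : Finset k)
    (hB : B.Nonempty)
    (h : ∀ σ : k ≃ₐ[L] k, ∃ a b : k, a ≠ 0 ∧ ∀ x ∈ B, a * σ x + b ∈ B) :
    ∃ r τ : k, r ≠ 0 ∧ ∃ f : L[X], f.map L.subtype = ∏ x ∈ B, (X - C (r * x + τ)) := by
  classical
  have hm : (B.card : k) ≠ 0 := Nat.cast_ne_zero.mpr hB.card_ne_zero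
  set β : k := (∑ x ∈ B, x) / B.card with hβ
  set f : k[X] := ∏ x ∈ B, (X - C (x - β)) with hf
  have hfd : f.natDegree = B.card := by
    rw [hf, natDegree_prod_of_monic _ _ fun i _ => monic_X_sub_C _]
    simp only [natDegree_X_sub_C, Finset.sum_const, smul_eq_mul, mul_one]
  have hσf : ∀ σ : k ≃ₐ[L] k, ∃ a : k, a ≠ 0 ∧ (f.map (σ : k →+* k)).scaleRoots a = f := by
    intro σ
    obtain ⟨a, b, ha, hab⟩ := h σ
    have hinj : Set.InjOn (fun x => a * σ x + b) (B : Set k) := by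
      intro x _ y _ hxy
      simpa [ha] using hxy
    have himg : B.image (fun x => a * σ x + b) = B := by
      refine Finset.eq_of_subset_of_card_le ?_ ?_
      · intro y hy
        obtain ⟨x, hx, rfl⟩ := Finset.mem_image.mp hy
        exact hab x hx
      · rw [Finset.card_image_of_injOn hinj]
    -- the barycentre is preserved
    have hβσ : a * σ β + b = β := by
      have h1 : ∑ x ∈ B, x = ∑ x ∈ B, (a * σ x + b) := by
        conv_lhs => rw [← himg]
        exact Finset.sum_image hinj
      rw [Finset.sum_add_distrib, ← Finset.mul_sum, ← map_sum, Finset.sum_const,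
        nsmul_eq_mul] at h1
      rw [hβ, map_div₀, map_natCast]
      field_simp
      linear_combination -h1
    refine ⟨a, ha, ?_⟩
    have h2 : f.map (σ : k →+* k) = ∏ x ∈ B, (X - C (σ (x - β))) := by
      rw [hf, Polynomial.map_prod]
      simp
    rw [h2, scaleRoots_prod_X_sub_C, hf]
    conv_rhs => rw [← himg]
    rw [Finset.prod_image hinj]
    refine Finset.prod_congr rfl fun x _ => ?_
    congr 2
    rw [map_sub]
    linear_combination -hβσ
  obtain ⟨r, hr0, hr⟩ := exists_rescale_mem L
    (fun i => if i ≤ B.card then f.coeff (B.card - i) else 0) (by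
    intro σ
    obtain ⟨a, ha, hfa⟩ := hσf σ
    refine ⟨a, ha, fun i => ?_⟩
    split_ifs with hi
    · have h3 := congrArg (fun p => p.coeff (B.card - i)) hfa
      simp only [coeff_scaleRoots, natDegree_map, hfd, coeff_map, Nat.sub_sub_self hi] at h3
      rw [mul_comm]
      exact h3
    · simp)
  refine ⟨r, -(r * β), hr0, ?_⟩
  have hprod : f.scaleRoots r = ∏ x ∈ B, (X - C (r * x + -(r * β))) := by
    rw [hf, scaleRoots_prod_X_sub_C]
    refine Finset.prod_congr rfl fun x _ => ?_
    congr 2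
    ring
  rw [← hprod]
  have hlift : f.scaleRoots r ∈ Polynomial.lifts L.subtype := by
    rw [lifts_iff_coeff_lifts]
    intro j
    rw [coeff_scaleRoots, hfd]
    by_cases hj : j ≤ B.card
    · have h4 := hr (B.card - j)
      rw [if_pos (Nat.sub_le _ _), Nat.sub_sub_self hj, mul_comm] at h4
      exact ⟨⟨_, h4⟩, rfl⟩
    · rw [coeff_eq_zero_of_natDegree_lt (by omega), zero_mul]
      exact ⟨0, rfl⟩
  exact (mem_lifts _).mp hlift

end AffineDescent

/-! ### Descent of a finite set of points of the projective line -/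

section ProjectiveDescent
variable {k : Type*} [Field k]

/-- The point `[x : 1]` of the projective line. -/
def affinePt (x : k) : ProjLine k := Projectivization.mk k ![x, 1] (by simp)

variable (k) in
/-- The point `[1 : 0]` of the projective line. -/
def inftyPt : ProjLine k := Projectivization.mk k ![1, 0] (by simp)

lemma affinePt_ne_inftyPt (x : k) : affinePt x ≠ inftyPt k := by
  rw [affinePt, inftyPt, Ne, ← bracket_eq_zero_iff]
  simp [bracket]

lemma affinePt_injective : Function.Injective (affinePt : k → ProjLine k) := by
  intro x y h
  rw [affinePt, affinePt, ← bracket_eq_zero_iff] at h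
  simpa [bracket, sub_eq_zero] using h

lemma exists_eq_affinePt {P : ProjLine k} (h : P ≠ inftyPt k) : ∃ x, P = affinePt x := by
  induction P using Projectivization.ind with
  | h v hv =>
    rw [inftyPt, Ne, ← bracket_eq_zero_iff] at h
    have h1 : v 1 ≠ 0 := by simpa [bracket] using h
    refine ⟨v 0 / v 1, ?_⟩
    rw [affinePt, ← bracket_eq_zero_iff]
    simp [bracket]
    field_simp
    simp

lemma galPerm_affinePt (σ : k ≃+* k) (x : k) : galPerm σ (affinePt x) = affinePt (σ x) := by
  rw [affinePt, galPerm_mk, affinePt]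
  congr 1
  ext i
  fin_cases i <;> simp

lemma galPerm_inftyPt (σ : k ≃+* k) : galPerm σ (inftyPt k) = inftyPt k := by
  rw [inftyPt, galPerm_mk]
  congr 1
  ext i
  fin_cases i <;> simp

/-- A projective transformation fixing the point at infinity is affine. -/
lemma exists_affine_of_fix {γ : GL (Fin 2) k} (h : γ • inftyPt k = inftyPt k) :
    ∃ a b : k, a ≠ 0 ∧ ∀ x, γ • affinePt x = affinePt (a * x + b) := by
  have hc : γ.1 1 0 = 0 := by
    rw [inftyPt, Projectivization.smul_mk, ← bracket_eq_zero_iff] at h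
    simpa [bracket] using h
  have hdet := γ.det_ne_zero
  rw [Matrix.det_fin_two, hc, mul_zero, sub_zero] at hdet
  have ha := left_ne_zero_of_mul hdet
  have hd := right_ne_zero_of_mul hdet
  refine ⟨γ.1 0 0 / γ.1 1 1, γ.1 0 1 / γ.1 1 1, div_ne_zero ha hd, fun x => ?_⟩
  rw [affinePt, Projectivization.smul_mk, affinePt, ← bracket_eq_zero_iff]
  simp [bracket, hc]
  field_simp
  ring

lemma exists_gl_smul_eq_inftyPt (P : ProjLine k) : ∃ A : GL (Fin 2) k, A • P = inftyPt k := by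
  obtain ⟨w, hw⟩ := exists_bracket_ne_zero P.rep_nonzero
  refine ⟨(glOfColumns P.rep w hw)⁻¹, ?_⟩
  rw [inv_smul_eq_iff, inftyPt, Projectivization.smul_mk]
  conv_lhs => rw [← P.mk_rep]
  congr 1
  rw [glOfColumns_smul]
  simp

/-- A finite set of points of the projective line whose conjugates over `L` are equivalent to it
by transformations compatible with a marked point is equivalent to the set of roots of a form
over `L`. -/
theorem exists_projective_descent [IsAlgClosed k] [CharZero k] (L : Subfield k) {ι : Type*}
    [Fintype ι] (hι : 2 ≤ Fintype.card ι) {ℓ : ι → ProjLine k} (hℓ : Function.Injective ℓ)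
    (P : ProjLine k)
    (h : ∀ σ : k ≃ₐ[L] k, ∃ (γ : GL (Fin 2) k) (κ : Equiv.Perm ι),
      (∀ i, γ • galPerm (σ : k ≃+* k) (ℓ i) = ℓ (κ i)) ∧ γ • galPerm (σ : k ≃+* k) P = P) :
    ∃ (A : GL (Fin 2) k) (v : ι → Fin 2 → k) (hv : ∀ i, v i ≠ 0) (f : L[X]),
      (∀ i, A • ℓ i = Projectivization.mk k (v i) (hv i)) ∧ f.map L.subtype = formOf v ∧
      f.Separable ∧ (f.natDegree + 1 = Fintype.card ι ∨ f.natDegree = Fintype.card ι) := by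
  classical
  obtain ⟨A₀, hA₀⟩ := exists_gl_smul_eq_inftyPt P
  set ℓ' : ι → ProjLine k := fun i => A₀ • ℓ i with hℓ'
  have hinj' : Function.Injective ℓ' := (MulAction.injective A₀).comp hℓ
  have hσ : ∀ σ : k ≃ₐ[L] k, ∃ (a b : k) (κ : Equiv.Perm ι), a ≠ 0 ∧ ∀ x i, ℓ' i = affinePt x →
      ℓ' (κ i) = affinePt (a * σ x + b) := by
    intro σ
    obtain ⟨γ, κ, hκ, hP⟩ := h σ
    set γ' := A₀ * γ * (Matrix.GeneralLinearGroup.map ((σ : k ≃+* k) : k →+* k) A₀)⁻¹ with hγ'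
    have hconj : ∀ Q, γ' • galPerm (σ : k ≃+* k) (A₀ • Q) = A₀ • γ • galPerm (σ : k ≃+* k) Q := by
      intro Q
      rw [galPerm_gl_smul, hγ', mul_smul, inv_smul_smul, mul_smul]
    obtain ⟨a, b, ha, hab⟩ := exists_affine_of_fix (γ := γ') (by
      have := hconj P
      rwa [hA₀, galPerm_inftyPt, hP, hA₀] at this)
    refine ⟨a, b, κ, ha, fun x i hx => ?_⟩
    have := hconj (ℓ i)
    rw [hκ] at this
    rw [hℓ']
    simp only
    rw [← this]
    change γ' • galPerm (σ : k ≃+* k) (ℓ' i) = _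
    rw [hx, galPerm_affinePt, hab]
    rfl
  set J : Finset ι := Finset.univ.filter fun i => ℓ' i ≠ inftyPt k with hJ
  have hx : ∀ i, ∃ x, i ∈ J → ℓ' i = affinePt x := by
    intro i
    by_cases hi : ℓ' i = inftyPt k
    · exact ⟨0, fun h => absurd hi (Finset.mem_filter.mp h).2⟩
    · obtain ⟨x, hx⟩ := exists_eq_affinePt hi
      exact ⟨x, fun _ => hx⟩
  choose x hx using hx
  have hxinj : Set.InjOn x (J : Set ι) := by
    intro i hi j hj hij
    exact hinj' (by rw [hx i hi, hx j hj, hij])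
  have hJcard : J.card + 1 = Fintype.card ι ∨ J.card = Fintype.card ι := by
    have h1 : (Finset.univ.filter fun i => ¬ ℓ' i ≠ inftyPt k).card ≤ 1 := by
      rw [Finset.card_le_one]
      intro i hi j hj
      have hi' := not_not.mp (Finset.mem_filter.mp hi).2
      have hj' := not_not.mp (Finset.mem_filter.mp hj).2
      exact hinj' (hi'.trans hj'.symm)
    have h2 := Finset.card_filter_add_card_filter_not (s := (Finset.univ : Finset ι))
      (fun i => ℓ' i ≠ inftyPt k)
    rw [Finset.card_univ, ← hJ] at h2
    omega
  have hJne : (J.image x).Nonempty := by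
    rw [Finset.image_nonempty, ← Finset.card_pos]
    omega
  obtain ⟨r, τ, hr, f, hf⟩ := exists_affine_descent L (J.image x) hJne (by
    intro σ
    obtain ⟨a, b, κ, ha, hab⟩ := hσ σ
    refine ⟨a, b, ha, fun y hy => ?_⟩
    obtain ⟨i, hi, rfl⟩ := Finset.mem_image.mp hy
    have h1 := hab _ i (hx i hi)
    have h2 : κ i ∈ J := Finset.mem_filter.mpr
      ⟨Finset.mem_univ _, by rw [h1]; exact affinePt_ne_inftyPt _⟩
    rw [hx _ h2] at h1
    rw [← affinePt_injective h1]
    exact Finset.mem_image_of_mem _ h2)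
  rw [Finset.prod_image hxinj] at hf
  have hD : bracket ![r, 0] ![τ, 1] ≠ 0 := by simpa [bracket] using hr
  refine ⟨glOfColumns ![r, 0] ![τ, 1] hD * A₀,
    fun i => if i ∈ J then ![r * x i + τ, 1] else ![-1, 0], fun i => ?_, f, fun i => ?_, ?_, ?_, ?_⟩
  · dsimp only
    split_ifs <;> simp
  · rw [mul_smul]
    change _ • ℓ' i = _
    by_cases hi : i ∈ J
    · simp only [if_pos hi]
      rw [hx i hi, affinePt, Projectivization.smul_mk]
      congr 1
      rw [glOfColumns_smul]
      ext j
      fin_cases j <;> simp [mul_comm]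
    · simp only [if_neg hi]
      have h1 : ℓ' i = inftyPt k := by
        by_contra h1
        exact hi (Finset.mem_filter.mpr ⟨Finset.mem_univ _, h1⟩)
      rw [h1, inftyPt, Projectivization.smul_mk, ← bracket_eq_zero_iff, glOfColumns_smul]
      simp [bracket]
  · rw [hf, formOf, ← Finset.prod_filter_mul_prod_filter_not Finset.univ (fun i => i ∈ J)]
    have h2 : Finset.univ.filter (fun i => i ∈ J) = J := by ext; simp
    rw [h2, Finset.prod_eq_one (s := Finset.univ.filter fun i => ¬ i ∈ J), mul_one]
    · refine Finset.prod_congr rfl fun i hi => ?_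
      simp [hi]
    · intro i hi
      simp [(Finset.mem_filter.mp hi).2]
  · rw [← separable_map L.subtype, hf, separable_prod_X_sub_C_iff']
    intro i hi j hj hij
    exact hxinj hi hj (mul_left_cancel₀ hr (add_right_cancel hij))
  · rw [← natDegree_map L.subtype, hf, natDegree_prod_of_monic _ _ fun i _ => monic_X_sub_C _]
    simpa only [natDegree_X_sub_C, Finset.sum_const, smul_eq_mul, mul_one] using hJcard

end ProjectiveDescent

/-! ### Möbius transformations of the rational function field -/

section MobRat
variable {k : Type*} [Field k]

/-- The numerator `aX + b` of the Möbius transformation of a matrix `(a, b; c, d)`. -/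
def mobNum (A : GL (Fin 2) k) : k[X] := C (A.1 0 0) * X + C (A.1 0 1)

/-- The denominator `cX + d` of the Möbius transformation of a matrix `(a, b; c, d)`. -/
def mobDen (A : GL (Fin 2) k) : k[X] := C (A.1 1 0) * X + C (A.1 1 1)

lemma mobDen_ne_zero (A : GL (Fin 2) k) : mobDen A ≠ 0 := by
  intro h
  have h0 := congrArg (fun p => p.coeff 0) h
  have h1 := congrArg (fun p => p.coeff 1) h
  simp [mobDen] at h0 h1
  apply A.det_ne_zero
  rw [Matrix.det_fin_two, h0, h1]
  ring

lemma algebraMap_mobDen_ne_zero (A : GL (Fin 2) k) :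
    algebraMap k[X] (RatFunc k) (mobDen A) ≠ 0 :=
  RatFunc.algebraMap_ne_zero (mobDen_ne_zero A)

/-- The rational function `(aX + b) / (cX + d)`. -/
def mobRat (A : GL (Fin 2) k) : RatFunc k :=
  algebraMap k[X] (RatFunc k) (mobNum A) / algebraMap k[X] (RatFunc k) (mobDen A)

lemma mobRat_mul_den (A : GL (Fin 2) k) : mobRat A * algebraMap k[X] (RatFunc k) (mobDen A) =
    algebraMap k[X] (RatFunc k) (mobNum A) :=
  div_mul_cancel₀ _ (algebraMap_mobDen_ne_zero A)

lemma transcendental_mobRat (A : GL (Fin 2) k) : Transcendental k (mobRat A) := by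
  apply RatFunc.transcendental_of_ne_C
  rintro ⟨e, he⟩
  have h := mobRat_mul_den A
  rw [he, ← RatFunc.algebraMap_C, ← map_mul] at h
  have h' := RatFunc.algebraMap_injective k h
  have h0 := congrArg (fun p => p.coeff 0) h'
  have h1 := congrArg (fun p => p.coeff 1) h'
  simp [mobDen, mobNum] at h0 h1
  apply A.det_ne_zero
  rw [Matrix.det_fin_two, ← h0, ← h1]
  ring

lemma aeval_mobRat_mul (A : GL (Fin 2) k) {F : k[X]} {n : ℕ} (hF : F.natDegree ≤ n) :
    aeval (mobRat A) F * algebraMap k[X] (RatFunc k) (mobDen A) ^ n =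
      algebraMap k[X] (RatFunc k) (∑ i ∈ Finset.range (n + 1),
        C (F.coeff i) * mobNum A ^ i * mobDen A ^ (n - i)) := by
  rw [aeval_eq_sum_range' (Nat.lt_succ_of_le hF), Finset.sum_mul, map_sum]
  refine Finset.sum_congr rfl fun i hi => ?_
  have hi' : i ≤ n := Nat.lt_succ_iff.mp (Finset.mem_range.mp hi)
  rw [map_mul, map_mul, map_pow, map_pow, ← mobRat_mul_den, RatFunc.algebraMap_C, mul_pow,
    Algebra.smul_def, RatFunc.algebraMap_eq_C]
  conv_lhs => rw [← Nat.add_sub_cancel' hi', pow_add]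
  ring

/-- The substitution `X ↦ (aX + b) / (cX + d)`. -/
def mobHom (A : GL (Fin 2) k) : RatFunc k →ₐ[k] RatFunc k :=
  IsFractionRing.liftAlgHom (g := (aeval (mobRat A) : k[X] →ₐ[k] RatFunc k))
    (transcendental_iff_injective.mp (transcendental_mobRat A))

lemma mobHom_algebraMap (A : GL (Fin 2) k) (p : k[X]) :
    mobHom A (algebraMap k[X] (RatFunc k) p) = aeval (mobRat A) p := by
  rw [mobHom, IsFractionRing.liftAlgHom_apply]
  exact IsFractionRing.lift_algebraMap _ p

lemma mobHom_surjective (A : GL (Fin 2) k) : Function.Surjective (mobHom A) := by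
  rw [← AlgHom.fieldRange_eq_top, eq_top_iff, ← RatFunc.adjoin_X,
    IntermediateField.adjoin_simple_le_iff]
  have hw : mobRat A ∈ (mobHom A).fieldRange :=
    ⟨algebraMap k[X] (RatFunc k) X, by
      change mobHom A _ = _
      rw [mobHom_algebraMap, aeval_X]⟩
  have hc : ∀ c : k, RatFunc.C c ∈ (mobHom A).fieldRange := fun c => by
    rw [← RatFunc.algebraMap_eq_C]
    exact (mobHom A).fieldRange.algebraMap_mem c
  have hdet := A.det_ne_zero
  rw [Matrix.det_fin_two] at hdet
  have h1 := mobRat_mul_den A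
  have h0 := algebraMap_mobDen_ne_zero A
  simp only [mobDen, mobNum, map_add, map_mul, RatFunc.algebraMap_C, RatFunc.algebraMap_X]
    at h1 h0
  have h2 : (RatFunc.C (A.1 0 0) - RatFunc.C (A.1 1 0) * mobRat A) ≠ 0 := by
    intro h3
    apply hdet
    apply RatFunc.C.injective
    rw [map_sub, map_mul, map_mul, map_zero]
    linear_combination (RatFunc.C (A.1 1 0) * RatFunc.X + RatFunc.C (A.1 1 1)) * h3 +
      RatFunc.C (A.1 1 0) * h1
  have h3 : RatFunc.X = (RatFunc.C (A.1 1 1) * mobRat A - RatFunc.C (A.1 0 1)) /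
      (RatFunc.C (A.1 0 0) - RatFunc.C (A.1 1 0) * mobRat A) := by
    rw [eq_div_iff h2]
    linear_combination -h1
  rw [h3]
  exact div_mem (sub_mem (mul_mem (hc _) hw) (hc _)) (sub_mem (hc _) (mul_mem (hc _) hw))

end MobRat

/-! ### Function fields of equivalent forms -/

section QuadExt
variable {k : Type*} [Field k]

lemma quadExt_of_injective (F : k[X]) : Function.Injective (AdjoinRoot.of
    (X ^ 2 - C (algebraMap k[X] (RatFunc k) F) : (RatFunc k)[X])) := by
  apply AdjoinRoot.of.injective_of_degree_ne_zero
  rw [degree_X_pow_sub_C (by norm_num)]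
  norm_num

/-- Forms of even degree `2m` equivalent under `GL₂` define isomorphic function fields, by
`X ↦ (aX + b) / (cX + d)` and `Y ↦ √e Y / (cX + d)ᵐ`. -/
lemma nonempty_quadExt_equiv [IsAlgClosed k] {F F' : k[X]} {m : ℕ} (hF' : F'.natDegree ≤ 2 * m)
    (A : GL (Fin 2) k) {e : k} (he : e ≠ 0) (h : ∑ i ∈ Finset.range (2 * m + 1),
      C (F'.coeff i) * mobNum A ^ i * mobDen A ^ (2 * m - i) = C e * F) :
    Nonempty (QuadExt F' ≃ₐ[k] QuadExt F) := by
  obtain ⟨r, hr⟩ := IsAlgClosed.exists_pow_nat_eq e two_pos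
  have hr0 : r ≠ 0 := by
    rintro rfl
    rw [zero_pow two_ne_zero] at hr
    exact he hr.symm
  have hden := pow_ne_zero m (algebraMap_mobDen_ne_zero A)
  set u : RatFunc k := RatFunc.C r / algebraMap k[X] (RatFunc k) (mobDen A) ^ m with hu
  have hrC : RatFunc.C r ≠ 0 := by simpa using hr0
  have hu0 : u ≠ 0 := div_ne_zero hrC hden
  have huF : u ^ 2 * algebraMap k[X] (RatFunc k) F = aeval (mobRat A) F' := by
    have h1 := aeval_mobRat_mul A hF'
    rw [h, map_mul, RatFunc.algebraMap_C, ← hr, map_pow] at h1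
    rw [hu, div_pow, div_mul_eq_mul_div, div_eq_iff (pow_ne_zero 2 hden), ← h1]
    ring
  let y : QuadExt F := AdjoinRoot.of _ u * AdjoinRoot.root _
  have hy : eval₂ ((IsScalarTower.toAlgHom k (RatFunc k) (QuadExt F)).comp (mobHom A)).toRingHom y
      (X ^ 2 - C (algebraMap k[X] (RatFunc k) F')) = 0 := by
    rw [eval₂_sub, eval₂_X_pow, eval₂_C, sub_eq_zero, mul_pow, root_sq]
    change _ = AdjoinRoot.of _ (mobHom A (algebraMap k[X] (RatFunc k) F'))
    rw [mobHom_algebraMap, ← huF, map_mul, map_pow]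
  let Φ : QuadExt F' →ₐ[k] QuadExt F := AdjoinRoot.liftAlgHom _
    ((IsScalarTower.toAlgHom k (RatFunc k) (QuadExt F)).comp (mobHom A)) y hy
  have hΦ : ∀ a b, Φ (AdjoinRoot.of _ a + AdjoinRoot.of _ b * AdjoinRoot.root _) =
      AdjoinRoot.of _ (mobHom A a) + AdjoinRoot.of _ (mobHom A b * u) * AdjoinRoot.root _ := by
    intro a b
    rw [map_add, map_mul]
    have h1 : ∀ a, Φ (AdjoinRoot.of _ a) = AdjoinRoot.of _ (mobHom A a) := fun a =>
      AdjoinRoot.lift_of hy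
    have h2 : Φ (AdjoinRoot.root _) = y := AdjoinRoot.lift_root hy
    rw [h1, h1, h2, map_mul, mul_assoc]
  refine ⟨AlgEquiv.ofBijective Φ ⟨?_, ?_⟩⟩
  · rw [injective_iff_map_eq_zero]
    intro z hz
    obtain ⟨a, b, rfl⟩ := exists_coords F' z
    rw [hΦ] at hz
    obtain ⟨ha, hb⟩ := coords_zero F hz
    have ha' : a = 0 := by simpa using ha
    have hb' : b = 0 := by simpa [hu0] using hb
    rw [ha', hb']
    simp
  · intro z
    obtain ⟨a, b, rfl⟩ := exists_coords F z
    obtain ⟨a', ha'⟩ := mobHom_surjective A a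
    obtain ⟨b', hb'⟩ := mobHom_surjective A (b / u)
    refine ⟨AdjoinRoot.of _ a' + AdjoinRoot.of _ b' * AdjoinRoot.root _, ?_⟩
    rw [hΦ, ha', hb', div_mul_cancel₀ _ hu0]

/-- Forms of even degree whose roots correspond under a projective transformation define
isomorphic function fields. -/
lemma nonempty_quadExt_equiv_of_roots [IsAlgClosed k] {m : ℕ} {v v' : Fin (2 * m) → Fin 2 → k}
    (hv : ∀ i, v i ≠ 0) (hv' : ∀ i, v' i ≠ 0) (A : GL (Fin 2) k)
    (hA : ∀ i, A • Projectivization.mk k (v i) (hv i) = Projectivization.mk k (v' i) (hv' i)) :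
    Nonempty (QuadExt (formOf v') ≃ₐ[k] QuadExt (formOf v)) := by
  have hc : ∀ i, ∃ c : k, c ≠ 0 ∧ v' i = c • (A • v i) := by
    intro i
    have h := hA i
    rw [Projectivization.smul_mk] at h
    obtain ⟨c, hc⟩ := (Projectivization.mk_eq_mk_iff' k _ _ _ _).mp h.symm
    refine ⟨c, ?_, hc.symm⟩
    rintro rfl
    exact hv' i (by rw [← hc, zero_smul])
  choose c hc0 hc using hc
  have hn : Fintype.card (Fin (2 * m)) = 2 * m := Fintype.card_fin _
  refine nonempty_quadExt_equiv (m := m) ((natDegree_formOf_le v').trans hn.le) A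
    (e := ∏ i, c i * A.1.det)
    (Finset.prod_ne_zero_iff.mpr fun i _ => mul_ne_zero (hc0 i) A.det_ne_zero) ?_
  have h1 := sum_coeff_formOf v' (mobNum A) (mobDen A)
  rw [hn] at h1
  rw [h1, formOf, map_prod, ← Finset.prod_mul_distrib]
  refine Finset.prod_congr rfl fun i _ => ?_
  rw [hc]
  simp [mobNum, mobDen, Matrix.det_fin_two]
  ring

end QuadExt

/-! ### Automorphisms of the function field as Möbius transformations -/

section Aut
variable {k : Type*} [Field k]

/-- A generator of the rational function field is a Möbius transformation of `X`. -/
lemma exists_eq_mobRat {w : RatFunc k} (hw : IntermediateField.adjoin k {w} = ⊤) :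
    ∃ A : GL (Fin 2) k, w = mobRat A := by
  have hmax : max w.num.natDegree w.denom.natDegree = 1 := by
    rw [← RatFunc.finrank_eq_max_natDegree, hw, IntermediateField.finrank_top]
  obtain ⟨a, b, hab⟩ := exists_eq_X_add_C_of_natDegree_le_one (le_of_max_le_left hmax.le)
  obtain ⟨c, d, hcd⟩ := exists_eq_X_add_C_of_natDegree_le_one (le_of_max_le_right hmax.le)
  have hdet : a * d - b * c ≠ 0 := by
    intro h
    obtain ⟨p, q, hpq⟩ := w.isCoprime_num_denom
    have hC : C a * C d - C b * C c = (0 : k[X]) := by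
      rw [← C_mul, ← C_mul, ← C_sub, h, C_0]
    have hu : (C a : k[X]) = w.num * (p * C a + q * C c) := by
      rw [hab, hcd] at hpq
      rw [hab]
      linear_combination (-C a) * hpq + q * hC
    have hv : (C c : k[X]) = w.denom * (p * C a + q * C c) := by
      rw [hab, hcd] at hpq
      rw [hcd]
      linear_combination (-C c) * hpq - p * hC
    have key : ∀ (e f : k) (r s : k[X]), r = C e * X + C f → C e = r * s → e = 0 := by
      intro e f r s hr he
      by_contra he0
      have h1 := natDegree_eq_zero_of_isUnit
        (isUnit_of_dvd_unit ⟨s, he⟩ (isUnit_C.mpr (Ne.isUnit he0)))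
      rw [hr, natDegree_linear he0] at h1
      exact one_ne_zero h1
    have ha := key a b _ _ hab hu
    have hc := key c d _ _ hcd hv
    rw [hab, hcd, ha, hc] at hmax
    simp at hmax
  refine ⟨Matrix.GeneralLinearGroup.mkOfDetNeZero !![a, b; c, d]
    (by rwa [Matrix.det_fin_two_of]), ?_⟩
  conv_lhs => rw [← w.num_div_denom, hab, hcd]
  rfl

/-- The automorphism `τ` of `k(X, √F)` acts on `X` by the Möbius transformation `A`. -/
def ActsBy {F : k[X]} (τ : QuadExt F ≃ₐ[k] QuadExt F) (A : GL (Fin 2) k) : Prop :=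
  τ (AdjoinRoot.of _ (algebraMap k[X] (RatFunc k) X)) = AdjoinRoot.of _ (mobRat A)

lemma ActsBy.apply_polynomial {F : k[X]} {τ : QuadExt F ≃ₐ[k] QuadExt F} {A : GL (Fin 2) k}
    (h : ActsBy τ A) (p : k[X]) : τ (AdjoinRoot.of _ (algebraMap k[X] (RatFunc k) p)) =
      AdjoinRoot.of _ (aeval (mobRat A) p) := by
  rw [aut_polynomial, h, ← AdjoinRoot.algebraMap_eq, aeval_algebraMap_apply]

lemma exists_actsBy {F : k[X]} (h2 : (2 : k) ≠ 0) (hF : Squarefree F) (h5 : 5 ≤ F.natDegree)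
    (τ : QuadExt F ≃ₐ[k] QuadExt F) : ∃ A, ActsBy τ A := by
  obtain ⟨w, hw⟩ := aut_mem F h2 hF h5 τ (algebraMap k[X] (RatFunc k) X)
  obtain ⟨u, hu⟩ := aut_mem F h2 hF h5 τ.symm (algebraMap k[X] (RatFunc k) X)
  have hp : ∀ p : k[X], τ (AdjoinRoot.of _ (algebraMap k[X] (RatFunc k) p)) =
      AdjoinRoot.of _ (aeval w p) := fun p => by
    rw [aut_polynomial, hw, ← AdjoinRoot.algebraMap_eq, aeval_algebraMap_apply]
  have hd0 : aeval w u.denom ≠ 0 := by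
    intro h0
    have h1 := hp u.denom
    rw [h0, map_zero, EmbeddingLike.map_eq_zero_iff] at h1
    have h3 := quadExt_of_injective F (h1.trans (map_zero _).symm)
    exact RatFunc.algebraMap_ne_zero u.denom_ne_zero h3
  have hX : RatFunc.X = aeval w u.num / aeval w u.denom := by
    rw [eq_div_iff hd0]
    apply quadExt_of_injective F
    rw [← hp, map_mul, ← hp, (div_eq_iff (RatFunc.algebraMap_ne_zero u.denom_ne_zero)).mp
      u.num_div_denom, map_mul, map_mul, ← hu, AlgEquiv.apply_symm_apply, RatFunc.algebraMap_X]
  obtain ⟨A, hA⟩ := exists_eq_mobRat (w := w) (by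
    rw [eq_top_iff, ← RatFunc.adjoin_X, IntermediateField.adjoin_simple_le_iff, hX]
    have hmem : ∀ p : k[X], aeval w p ∈ IntermediateField.adjoin k {w} := fun p =>
      IntermediateField.algebra_adjoin_le_adjoin k _ (aeval_mem_adjoin_singleton k w)
    exact div_mem (hmem _) (hmem _))
  exact ⟨A, by rw [ActsBy, hw, hA]⟩

/-- The action on the generator `X` reverses products. -/
lemma ActsBy.mul {F : k[X]} {τ τ' : QuadExt F ≃ₐ[k] QuadExt F} {A A' : GL (Fin 2) k}
    (h : ActsBy τ A) (h' : ActsBy τ' A') : ActsBy (τ * τ') (A' * A) := by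
  have h1 := congrArg (fun z => τ (AdjoinRoot.of _ z)) (mobRat_mul_den A')
  simp only [map_mul] at h1
  rw [h.apply_polynomial, h.apply_polynomial, ← h'] at h1
  have h2 : AdjoinRoot.of (X ^ 2 - C (algebraMap k[X] (RatFunc k) F) : (RatFunc k)[X])
      (mobRat (A' * A) * aeval (mobRat A) (mobDen A')) =
      AdjoinRoot.of _ (aeval (mobRat A) (mobNum A')) := by
    congr 1
    have h3 := mobRat_mul_den A
    have h4 := mobRat_mul_den (A' * A)
    have h5 := algebraMap_mobDen_ne_zero A
    apply mul_right_cancel₀ h5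
    simp only [mobDen, mobNum, map_add, map_mul, aeval_C, aeval_X, RatFunc.algebraMap_C,
      RatFunc.algebraMap_X, RatFunc.algebraMap_eq_C, Units.val_mul, Matrix.mul_apply,
      Fin.sum_univ_two] at h3 h4 ⊢
    linear_combination h4 + (mobRat (A' * A) * RatFunc.C (A'.1 1 0) - RatFunc.C (A'.1 0 0)) * h3
  have h0 : aeval (mobRat A) (mobDen A') ≠ 0 := by
    intro h0
    have := transcendental_iff.mp (transcendental_mobRat A) _ h0
    exact mobDen_ne_zero A' this
  have h6 : AdjoinRoot.of (X ^ 2 - C (algebraMap k[X] (RatFunc k) F) : (RatFunc k)[X])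
      (aeval (mobRat A) (mobDen A')) * AdjoinRoot.of _ (aeval (mobRat A) (mobDen A'))⁻¹ = 1 := by
    rw [← map_mul, mul_inv_cancel₀ h0, map_one]
  rw [map_mul] at h2
  rw [ActsBy, AlgEquiv.mul_apply]
  linear_combination (AdjoinRoot.of _ (aeval (mobRat A) (mobDen A'))⁻¹) * (h1 - h2) -
    (τ (τ' (AdjoinRoot.of _ (algebraMap k[X] (RatFunc k) X))) - AdjoinRoot.of _ (mobRat (A' * A))) *
      h6

lemma mobRat_eq_iff {A A' : GL (Fin 2) k} : mobRat A = mobRat A' ↔ mob k A = mob k A' := by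
  rw [mob_eq_mob_iff]
  constructor
  · intro h
    have h1 := mobRat_mul_den A
    rw [h, mobRat, div_mul_eq_mul_div, div_eq_iff (algebraMap_mobDen_ne_zero A'), ← map_mul,
      ← map_mul] at h1
    have h2 := RatFunc.algebraMap_injective k h1
    have h3 : mob k A = mob k A' := by
      ext x
      induction x using Projectivization.ind with
      | h v hv =>
        rw [mob_mk, mob_mk, ← bracket_eq_zero_iff]
        have h4 : C (A.1 0 0 * A'.1 1 0 - A'.1 0 0 * A.1 1 0) * X ^ 2 +
            C (A.1 0 0 * A'.1 1 1 + A.1 0 1 * A'.1 1 0 - A'.1 0 0 * A.1 1 1 - A'.1 0 1 * A.1 1 0) *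
              X + C (A.1 0 1 * A'.1 1 1 - A'.1 0 1 * A.1 1 1) = 0 := by
          simp only [mobNum, mobDen] at h2
          simp only [C_sub, C_add, C_mul]
          linear_combination -h2
        have e0 := congrArg (fun p => p.coeff 0) h4
        have e1 := congrArg (fun p => p.coeff 1) h4
        have e2 := congrArg (fun p => p.coeff 2) h4
        simp [coeff_X, coeff_C, -map_sub, -map_add, -map_mul] at e0 e1 e2
        simp [bracket]
        linear_combination v 0 ^ 2 * e2 + v 0 * v 1 * e1 + v 1 ^ 2 * e0
    exact mob_eq_mob_iff.mp h3
  · rintro ⟨c, hc0, hc⟩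
    have hC : RatFunc.C c ≠ 0 := by simpa using hc0
    rw [mobRat, mobRat, mobNum, mobDen, hc]
    simp only [Matrix.smul_apply, smul_eq_mul, mul_assoc, ← mul_add, map_mul,
      RatFunc.algebraMap_C]
    rw [mul_div_mul_left _ _ hC]
    rfl

end Aut

/-! ### Automorphisms and branch points -/

section BranchPoints
variable {k : Type*} [Field k]

lemma sum_coeff_formOf_eq_prod_bracket {ι : Type*} [Fintype ι] (v : ι → Fin 2 → k)
    (x : Fin 2 → k) : ∑ i ∈ Finset.range (Fintype.card ι + 1), (formOf v).coeff i * x 0 ^ i *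
      x 1 ^ (Fintype.card ι - i) = ∏ i, bracket x (v i) := by
  apply C_injective
  have h := sum_coeff_formOf v (C (x 0)) (C (x 1))
  simp only [map_sum, map_prod, map_mul, map_pow, bracket, map_sub]
  rw [h]
  refine Finset.prod_congr rfl fun i _ => ?_
  ring

/-- Proportional forms have the same roots. -/
lemma exists_bracket_eq_zero_of_formOf_eq {ι : Type*} [Fintype ι] {v w : ι → Fin 2 → k} {c : k}
    (h : formOf w = C c * formOf v) {x : Fin 2 → k} {i : ι} (hx : bracket x (v i) = 0) :
    ∃ j, bracket x (w j) = 0 := by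
  have h1 : ∏ j, bracket x (w j) = c * ∏ j, bracket x (v j) := by
    rw [← sum_coeff_formOf_eq_prod_bracket, ← sum_coeff_formOf_eq_prod_bracket, h, Finset.mul_sum]
    refine Finset.sum_congr rfl fun i _ => ?_
    rw [coeff_C_mul]
    ring
  rw [Finset.prod_eq_zero (f := fun j => bracket x (v j)) (Finset.mem_univ i) hx, mul_zero,
    Finset.prod_eq_zero_iff] at h1
  obtain ⟨j, -, hj⟩ := h1
  exact ⟨j, hj⟩

/-- Two polynomials whose quotient is a square are proportional, when one of them is squarefree and
the degree of the other one is not larger by two. -/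
lemma exists_eq_C_mul_of_sq_mul {F D : k[X]} (hF : Squarefree F)
    (hD : D.natDegree ≤ F.natDegree + 1) {e : RatFunc k} (he : e ≠ 0)
    (h : e ^ 2 * algebraMap k[X] (RatFunc k) F = algebraMap k[X] (RatFunc k) D) :
    ∃ c : k, D = C c * F := by
  have hF0 : F ≠ 0 := hF.ne_zero
  have hq' := RatFunc.algebraMap_ne_zero e.denom_ne_zero
  have hp : e.num ≠ 0 := RatFunc.num_ne_zero he
  have h2 : e.num ^ 2 * F = e.denom ^ 2 * D := by
    apply RatFunc.algebraMap_injective k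
    rw [← RatFunc.num_div_denom e] at h
    simp only [map_mul, map_pow]
    rw [← h]
    field_simp
  have hdvd : e.denom * e.denom ∣ F := by
    have : IsCoprime (e.denom ^ 2) (e.num ^ 2) := (e.isCoprime_num_denom.symm).pow
    rw [← pow_two]
    exact this.dvd_of_dvd_mul_left ⟨D, h2⟩
  obtain ⟨d, hd⟩ := natDegree_eq_zero.mp (natDegree_eq_zero_of_isUnit (hF _ hdvd))
  have hd0 : d ≠ 0 := by
    rintro rfl
    exact e.denom_ne_zero (by rw [← hd, C_0])
  have hD' : D = C (d ^ 2)⁻¹ * (e.num ^ 2 * F) := by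
    rw [h2, ← hd, ← C_pow, ← mul_assoc, ← C_mul, inv_mul_cancel₀ (pow_ne_zero 2 hd0), C_1, one_mul]
  have hdeg := congrArg natDegree hD'
  rw [natDegree_C_mul (inv_ne_zero (pow_ne_zero 2 hd0)), natDegree_mul (pow_ne_zero 2 hp) hF0,
    natDegree_pow] at hdeg
  obtain ⟨n, hn⟩ := natDegree_eq_zero.mp (show e.num.natDegree = 0 by omega)
  refine ⟨(d ^ 2)⁻¹ * n ^ 2, ?_⟩
  rw [hD', ← hn, C_mul, C_pow, mul_assoc]

/-- An automorphism of `k(X, √F)` maps `√F` to a multiple of itself, by an element of `k(X)`. -/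
lemma ActsBy.exists_sq_mul {F : k[X]} (h2 : (2 : k) ≠ 0) (hF : Squarefree F)
    (h5 : 5 ≤ F.natDegree) {τ : QuadExt F ≃ₐ[k] QuadExt F} {A : GL (Fin 2) k} (h : ActsBy τ A) :
    ∃ β : RatFunc k, β ≠ 0 ∧ β ^ 2 * algebraMap k[X] (RatFunc k) F = aeval (mobRat A) F := by
  obtain ⟨α, β, hαβ⟩ := exists_coords F (τ (AdjoinRoot.root _))
  have hsq := congrArg τ (root_sq F)
  rw [map_pow, h.apply_polynomial, hαβ] at hsq
  have h1 := coords_zero F (a := α ^ 2 + β ^ 2 * algebraMap k[X] (RatFunc k) F -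
    aeval (mobRat A) F) (b := 2 * α * β) (by
      simp only [map_add, map_sub, map_mul, map_pow, map_ofNat]
      linear_combination hsq - (AdjoinRoot.of _ β) ^ 2 * root_sq F)
  have h2' : (2 : RatFunc k) ≠ 0 := by
    intro h
    apply h2
    apply (algebraMap k (RatFunc k)).injective
    rw [map_ofNat, map_zero, h]
  have hβ : β ≠ 0 := by
    rintro rfl
    obtain ⟨α', hα'⟩ := aut_mem F h2 hF h5 τ.symm α
    rw [map_zero, zero_mul, add_zero] at hαβ
    have h3 := congrArg τ.symm hαβ
    rw [AlgEquiv.symm_apply_apply, hα'] at h3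
    have h4 := coords_zero F (a := -α') (b := 1) (by
      rw [map_neg, map_one]
      linear_combination h3)
    exact one_ne_zero h4.2
  have hα : α = 0 := by
    have := (mul_eq_zero.mp h1.2).resolve_right hβ
    exact (mul_eq_zero.mp this).resolve_left h2'
  refine ⟨β, hβ, ?_⟩
  have h3 := h1.1
  rw [hα] at h3
  linear_combination h3

lemma ActsBy.mob_mem_branchStab {m : ℕ} {v : Fin (2 * m) → Fin 2 → k} (hv : ∀ i, v i ≠ 0)
    (hinj : Function.Injective fun i => Projectivization.mk k (v i) (hv i)) (h2 : (2 : k) ≠ 0)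
    (hF : Squarefree (formOf v)) (h5 : 5 ≤ (formOf v).natDegree)
    (hd : 2 * m ≤ (formOf v).natDegree + 1) {τ : QuadExt (formOf v) ≃ₐ[k] QuadExt (formOf v)}
    {A : GL (Fin 2) k} (h : ActsBy τ A) :
    mob k A ∈ branchStab fun i => Projectivization.mk k (v i) (hv i) := by
  obtain ⟨β, hβ, hβ2⟩ := h.exists_sq_mul h2 hF h5
  have hn : Fintype.card (Fin (2 * m)) = 2 * m := Fintype.card_fin _
  set w : Fin (2 * m) → Fin 2 → k := fun i =>
    ![A.1 1 1 * v i 0 - A.1 0 1 * v i 1, A.1 0 0 * v i 1 - A.1 1 0 * v i 0] with hw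
  have hbr : ∀ x j, bracket x (w j) = bracket (A • x) (v j) := by
    intro x j
    simp [bracket, hw]
    ring
  have hform : ∑ i ∈ Finset.range (2 * m + 1), C ((formOf v).coeff i) * mobNum A ^ i *
      mobDen A ^ (2 * m - i) = formOf w := by
    have := sum_coeff_formOf_linear A.1 v
    rwa [hn] at this
  have h1 := aeval_mobRat_mul A ((natDegree_formOf_le v).trans hn.le)
  rw [hform, ← hβ2] at h1
  obtain ⟨c, hc⟩ := exists_eq_C_mul_of_sq_mul (D := formOf w)
    (e := β * algebraMap k[X] (RatFunc k) (mobDen A) ^ m) hF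
    (((natDegree_formOf_le w).trans hn.le).trans hd)
    (mul_ne_zero hβ (pow_ne_zero _ (algebraMap_mobDen_ne_zero A))) (by
      rw [← h1]
      ring)
  have hex : ∀ i, ∃ j, mob k A (Projectivization.mk k (v i) (hv i)) =
      Projectivization.mk k (v j) (hv j) := by
    intro i
    obtain ⟨j, hj⟩ := exists_bracket_eq_zero_of_formOf_eq hc (bracket_self (v i))
    rw [hbr] at hj
    exact ⟨j, by rw [mob_mk, ← bracket_eq_zero_iff, hj]⟩
  choose π hπ using hex
  have hπinj : Function.Injective π := by
    intro i j hij
    apply hinj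
    apply (mob k A).injective
    simp only
    rw [hπ, hπ, hij]
  exact ⟨⟨A, rfl⟩, Equiv.ofBijective π (Finite.injective_iff_bijective.mp hπinj), hπ⟩

end BranchPoints
end HyperellipticModuli

namespace HyperellipticCurve
open HyperellipticModuli
variable {k : Type*} [Field k] {g : ℕ}

lemma mem_hyperellipticSubgroup_iff_apply_X (C : HyperellipticCurve k g) (τ : C.AutGroup) :
    τ ∈ C.hyperellipticSubgroup ↔
      τ (AdjoinRoot.of _ (algebraMap k[X] (RatFunc k) X)) =
        AdjoinRoot.of _ (algebraMap k[X] (RatFunc k) X) := by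
  rw [mem_hyperellipticSubgroup]
  refine ⟨fun h => h _, fun h r => ?_⟩
  have hp : ∀ p : k[X], τ (algebraMap (RatFunc k) C.FunctionField (algebraMap k[X] _ p)) =
      algebraMap (RatFunc k) C.FunctionField (algebraMap k[X] _ p) := by
    intro p
    have h1 := aut_polynomial C.F τ p
    have h2 := aut_polynomial C.F AlgEquiv.refl p
    rw [h] at h1
    exact h1.trans h2.symm
  have h1 : r * algebraMap k[X] (RatFunc k) r.denom = algebraMap k[X] (RatFunc k) r.num :=
    ((div_eq_iff (RatFunc.algebraMap_ne_zero r.denom_ne_zero)).mp r.num_div_denom).symm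
  have h2 := congrArg (fun z => τ (algebraMap (RatFunc k) C.FunctionField z)) h1
  simp only [map_mul, hp] at h2
  rw [← h1, map_mul] at h2
  have h3 : IsUnit (algebraMap (RatFunc k) C.FunctionField (algebraMap k[X] _ r.denom)) :=
    (RatFunc.algebraMap_ne_zero r.denom_ne_zero).isUnit.map _
  exact h3.mul_right_cancel h2

lemma mem_hyperellipticSubgroup_iff_mob (C : HyperellipticCurve k g) {τ : C.AutGroup}
    {A : GL (Fin 2) k} (h : ActsBy τ A) : τ ∈ C.hyperellipticSubgroup ↔ mob k A = 1 := by
  have h1 : mobRat (1 : GL (Fin 2) k) = algebraMap k[X] (RatFunc k) X := by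
    simp [mobRat, mobNum, mobDen]
  rw [mem_hyperellipticSubgroup_iff_apply_X, h, ← h1, (quadExt_of_injective C.F).eq_iff,
    mobRat_eq_iff, map_one]

lemma five_le_natDegree (C : HyperellipticCurve k g) : 5 ≤ C.F.natDegree := by
  have := C.two_le_genus
  have := C.natDegree_eq
  omega

/-- Two involutions of the reduced automorphism group give two involutions of the stabiliser of
the branch points. -/
lemma exists_involutions_branchStab [CharZero k] (C : HyperellipticCurve k g)
    {v : Fin (2 * g + 2) → Fin 2 → k} (hF : C.F = formOf v) (hv : ∀ i, v i ≠ 0)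
    (hinj : Function.Injective fun i => Projectivization.mk k (v i) (hv i))
    (hinv : ∃ s t : C.ReducedAutGroup, s ≠ t ∧ orderOf s = 2 ∧ orderOf t = 2) :
    ∃ s t : branchStab fun i => Projectivization.mk k (v i) (hv i),
      s ≠ t ∧ orderOf s = 2 ∧ orderOf t = 2 := by
  have hlift : ∀ s : C.ReducedAutGroup, orderOf s = 2 → ∃ (τ : C.AutGroup) (A : GL (Fin 2) k)
      (m : branchStab fun i => Projectivization.mk k (v i) (hv i)),
      (τ : C.ReducedAutGroup) = s ∧ ActsBy τ A ∧ mob k A = m.1 ∧ orderOf m = 2 := by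
    intro s hs
    obtain ⟨τ, rfl⟩ := QuotientGroup.mk_surjective s
    obtain ⟨A, hA⟩ := exists_actsBy two_ne_zero C.separable.squarefree C.five_le_natDegree τ
    have hmem : mob k A ∈ branchStab fun i => Projectivization.mk k (v i) (hv i) := by
      have hsq := C.separable.squarefree
      have h5 := C.five_le_natDegree
      have hd : 2 * (g + 1) ≤ C.F.natDegree + 1 := by
        have := C.natDegree_eq
        omega
      obtain ⟨F, h1, h2, h3⟩ := C
      simp only at hF
      subst hF
      exact ActsBy.mob_mem_branchStab (m := g + 1) hv hinj two_ne_zero hsq h5 hd hA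
    refine ⟨τ, A, ⟨mob k A, hmem⟩, rfl, hA, rfl, orderOf_eq_prime ?_ ?_⟩
    · have h1 := pow_orderOf_eq_one (τ : C.ReducedAutGroup)
      rw [hs, pow_two (τ : C.ReducedAutGroup), ← QuotientGroup.mk_mul, QuotientGroup.eq_one_iff,
        C.mem_hyperellipticSubgroup_iff_mob (hA.mul hA), map_mul] at h1
      rw [pow_two]
      exact Subtype.ext h1
    · intro h1
      have h2 := (C.mem_hyperellipticSubgroup_iff_mob hA).mpr (congrArg Subtype.val h1)
      rw [(QuotientGroup.eq_one_iff τ).mpr h2, orderOf_one] at hs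
      omega
  obtain ⟨s, t, hst, hs, ht⟩ := hinv
  obtain ⟨τ, A, m, hτ, hA, hm, hm2⟩ := hlift s hs
  obtain ⟨τ', A', m', hτ', hA', hm', hm2'⟩ := hlift t ht
  refine ⟨m, m', fun h => hst ?_, hm2, hm2'⟩
  have h1 : mobRat A = mobRat A' := mobRat_eq_iff.mpr (by rw [hm, hm', h])
  rw [← hτ, ← hτ', QuotientGroup.eq, mem_hyperellipticSubgroup_iff_apply_X, AlgEquiv.mul_apply,
    hA', ← h1, ← hA]
  exact τ.symm_apply_apply _

/-- A curve is isomorphic to every curve whose branch points correspond to its own under a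
projective transformation. -/
lemma isomorphic_of_roots [IsAlgClosed k] {C D : HyperellipticCurve k g}
    {v w : Fin (2 * g + 2) → Fin 2 → k} (hC : C.F = formOf w) (hD : D.F = formOf v)
    (hv : ∀ i, v i ≠ 0) (hw : ∀ i, w i ≠ 0) (A : GL (Fin 2) k)
    (hA : ∀ i, A • Projectivization.mk k (v i) (hv i) = Projectivization.mk k (w i) (hw i)) :
    C.Isomorphic D := by
  change Nonempty (QuadExt C.F ≃ₐ[k] QuadExt D.F)
  rw [hC, hD]
  exact nonempty_quadExt_equiv_of_roots (m := g + 1) hv hw A hA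

/-- If the moduli point of a curve is rational over `L` and its reduced automorphism group has at
least two involutions, then the curve has a model over `L`. -/
theorem hasModelOver_of_two_involutions [IsAlgClosed k] [CharZero k] (L : Subfield k)
    (C : HyperellipticCurve k g)
    (hinv : ∃ s t : C.ReducedAutGroup, s ≠ t ∧ orderOf s = 2 ∧ orderOf t = 2)
    (hL : C.ModuliPointRational L) : C.HasModelOver L := by
  obtain ⟨v, hF, hv⟩ := C.exists_formOf
  have hg := C.two_le_genus
  have hcard : Fintype.card (Fin (2 * g + 2)) = 2 * g + 2 := Fintype.card_fin _
  have hv0 : ∀ i, v i ≠ 0 := by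
    intro i hi
    have : Nontrivial (Fin (2 * g + 2)) := Fin.nontrivial_iff_two_le.mpr (by omega)
    obtain ⟨j, hj⟩ := exists_ne i
    exact hv i j hj.symm (by simp [hi, bracket])
  have hinj : Function.Injective fun i => Projectivization.mk k (v i) (hv0 i) := by
    intro i j hij
    by_contra h
    exact hv i j h ((bracket_eq_zero_iff (hv0 i) (hv0 j)).mpr hij)
  obtain ⟨s, t, hst, hs, ht⟩ := C.exists_involutions_branchStab hF hv0 hinj hinv
  obtain ⟨P, hP⟩ := exists_marked_point hinj (by omega) hst hs ht
  obtain ⟨A, w, hw, f, hA, hf, hsep, hdeg⟩ := exists_projective_descent L (by omega) hinj P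
    fun σ => by
      obtain ⟨γ, κ, hκ⟩ := C.exists_gl_galPerm_eq hL hF hv hv0 (fun _ => rfl) σ
      exact hP σ γ κ hκ
  exact ⟨⟨f, hg, hsep, by omega⟩, isomorphic_of_roots hf hF hv0 hw A hA⟩

end HyperellipticCurve

end

theorem corollary4p2 {k : Type*} [Field k] [IsAlgClosed k] [CharZero k] (g : ℕ)
    (L : Subfield k) (C : HyperellipticCurve k g)
    (hextra : C.HasExtraInvolution)
    (hinv : ∃ s t : C.ReducedAutGroup, s ≠ t ∧ orderOf s = 2 ∧ orderOf t = 2)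
    (hL : C.ModuliPointRational L) :
    C.HasModelOver L :=
  C.hasModelOver_of_two_involutions L hinv hL
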